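/- Let $n\in\mathbb{N}$ and let $A=(a_1,\dots,a_n)$ be a labelled configuration of points in $\mathbb{R}^2$ that affinely span $\mathbb{R}^2$. Then the oriented-matroid realization space $\mathcal R_{\mathrm{om}}(A)$ of $A$ is homotopy equivalent to the inscribed realization space $\mathcal R_{\mathrm{ins}}(\Lambda(A))$ of its Lawrence polytope. Here: - The chirotope of a vector configuration $V=(v_1,\dots,v_n)$ in $\mathbb{R}^3$ is the map $\chi^V(i_1,i_2,i_3)=\operatorname{sign}\det(v_{i_1},v_{i_2},v_{i_3})$ on $\{1,\dots,n\}^3$. Let $\bar A=((a_1,1),\dots,(a_n,1))$. Then $\mathcal R_{\mathrm{om}}(A)=\{V\in(\mathbb{R}^{3})^n : \chi^V=\chi^{\bar A}\text{ or }\chi^V=-\chi^{\bar A}\}/\mathrm{GL}(\mathbb{R}^3)$, where $\mathrm{GL}(\mathbb{R}^3)$ acts simultaneously on all vectors. - The Lawrence polytope $\Lambda(A)\subset\mathbb{R}^{2+n}$ is the convex hull of the $2n$ points $(a_i,e_i)$ and $(a_i,2e_i)$, $1\le i\le n$, where $e_1,\dots,e_n$ is the standard basis of $\mathbb{R}^n$.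 These points are its vertices and are labelled accordingly. - For a polytope $P\subset\mathbb{R}^d$ with $m$ labelled vertices, $\mathcal R_{\mathrm{ins}}(P)=\{Q\in(\mathbb{S}^{d-1})^m : \operatorname{conv}(Q)\simeq P\}/\text{Möb}(\mathbb{S}^{d-1})$. Here $\simeq$ means that the face lattices coincide when each face is identified with the set of labels of the points that it contains, and $\text{Möb}(\mathbb{S}^{d-1})$ is the group of all Möbius transformations of the unit sphere $\mathbb{S}^{d-1}\subset\mathbb R^d$ (orientation-reversing ones included), acting simultaneously on all points. Sets of configurations carry the subspace topology and the quotients the quotient topology. -/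

import Mathlib

open Set

noncomputable section

namespace LawrenceInscribed

/-! ### Oriented matroids and their realization spaces -/

/-- The chirotope of a labelled vector configuration in `ℝ^r`: the signs of all `r × r`
determinants (the chosen vectors are the rows of the matrix). -/
def chirotope {ι : Type*} {r : ℕ} (V : ι → Fin r → ℝ) (t : Fin r → ι) : SignType :=
  SignType.sign (Matrix.det (Matrix.of fun k => V (t k)))

/-- The homogenization of a point configuration in `ℝ^d`: append `1` as last coordinate. -/
def homogenization {ι : Type*} {d : ℕ} (A : ι → EuclideanSpace ℝ (Fin d)) :
    ι → Fin (d + 1) → ℝ :=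
  fun i => Fin.snoc (α := fun _ => ℝ) (fun k => A i k) 1

/-- The vector configurations of rank `d + 1` that realize the oriented matroid of the point
configuration `A`. An oriented matroid is a chirotope up to a global sign. -/
def omRealizations {ι : Type*} {d : ℕ} (A : ι → EuclideanSpace ℝ (Fin d)) :
    Set (ι → Fin (d + 1) → ℝ) :=
  {V | (∀ t, chirotope V t = chirotope (homogenization A) t) ∨
    (∀ t, chirotope V t = -chirotope (homogenization A) t)}

/-- The realization space of the oriented matroid of `A`: realizing vector configurations, with
the subspace topology, modulo the diagonal action of the general linear group of `ℝ^(d+1)`,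
with the quotient topology. -/
abbrev OMRealizationSpace {ι : Type*} {d : ℕ} (A : ι → EuclideanSpace ℝ (Fin d)) : Type _ :=
  Quotient ((MulAction.orbitRel ((Fin (d + 1) → ℝ) ≃ₗ[ℝ] (Fin (d + 1) → ℝ))
    (ι → Fin (d + 1) → ℝ)).comap (Subtype.val : omRealizations A → (ι → Fin (d + 1) → ℝ)))

/-! ### Polytopes, inscribed realizations, Möbius transformations -/

/-- The face lattice of the convex hull of a labelled point configuration, each face `F` being
identified with the set of labels of the points lying in `F`. The exposed faces of a polytope
are its intersections with supporting hyperplanes, together with `∅` and the polytope. -/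
def faceLattice {ι E : Type*} [NormedAddCommGroup E] [NormedSpace ℝ E] (P : ι → E) :
    Set (Set ι) :=
  {S | ∃ F : Set E, IsExposed ℝ (convexHull ℝ (range P)) F ∧ S = P ⁻¹' F}

/-- The unit sphere of the Euclidean space with coordinates indexed by `κ`. -/
abbrev UnitSphere (κ : Type*) [Fintype κ] : Type _ :=
  Metric.sphere (0 : EuclideanSpace ℝ κ) 1

/-- The group of Möbius transformations of the unit sphere, orientation reversing ones included:
the group of permutations of the sphere generated by the orthogonal transformations and by the
restrictions of those inversions in spheres of the ambient space that map the unit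
sphere to itself. -/
def mobiusGroup (κ : Type*) [Fintype κ] : Subgroup (Equiv.Perm (UnitSphere κ)) :=
  Subgroup.closure
    {σ | (∃ u : EuclideanSpace ℝ κ ≃ₗᵢ[ℝ] EuclideanSpace ℝ κ,
            ∀ x : UnitSphere κ, (σ x : EuclideanSpace ℝ κ) = u x) ∨
         (∃ (c : EuclideanSpace ℝ κ) (R : ℝ), 0 < R ∧
            ∀ x : UnitSphere κ,
              (σ x : EuclideanSpace ℝ κ) = EuclideanGeometry.inversion c R x)}

/-- The labelled point configurations on the unit sphere whose convex hull is combinatorially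
equivalent (equal labelled face lattice) to the convex hull of `P`. -/
def inscribedRealizations {ι κ : Type*} [Fintype κ] (P : ι → EuclideanSpace ℝ κ) :
    Set (ι → UnitSphere κ) :=
  {Q | faceLattice (fun i => (Q i : EuclideanSpace ℝ κ)) = faceLattice P}

/-- The inscribed realization space of the polytope with labelled vertices `P`: inscribed
realizations, with the subspace topology, modulo the diagonal action of the Möbius group of the
unit sphere, with the quotient topology. -/
abbrev InscribedRealizationSpace {ι κ : Type*} [Fintype κ] (P : ι → EuclideanSpace ℝ κ) :
    Type _ :=
  Quotient ((MulAction.orbitRel (mobiusGroup κ) (ι → UnitSphere κ)).comap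
    (Subtype.val : inscribedRealizations P → (ι → UnitSphere κ)))

/-! ### Lawrence polytopes -/

/-- The vertices of the Lawrence polytope. Extending a configuration at the point `a` means to
add a coordinate that is `0` at all other points and to replace `a` by `(a, 1)` and `(a, 2)`;
this is done once for every label `i`, the coordinate added at that step being `Sum.inr i`.
The label `Sum.inl i` is that of the point at height `1`, `Sum.inr i` of the one at height
`2`. -/
def lawrence {ι : Type*} [DecidableEq ι] {d : ℕ} (A : ι → EuclideanSpace ℝ (Fin d)) :
    ι ⊕ ι → EuclideanSpace ℝ (Fin d ⊕ ι)
  | Sum.inl i => WithLp.toLp 2 (Sum.elim (fun k => A i k) (Pi.single i 1))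
  | Sum.inr i => WithLp.toLp 2 (Sum.elim (fun k => A i k) (Pi.single i 2))

end LawrenceInscribed

end

/-!
The proof compares both realization spaces with a space of triples `(V, B, h)`, the marked forms.

Fix three labels `b` at which the points of `A` are affinely independent. Every class in the
oriented-matroid realization space has exactly one representative in which the vectors labelled by
`b` are the standard basis of `ℝ³`, so this space is homeomorphic to the set `chart A b` of these
representatives (`omRealizationHomeomorph`).

A point configuration has the face lattice of the Lawrence polytope exactly if its homogeneous
coordinates become, after positive scalings and a linear change of coordinates, the vectors
`(V i, e i)` and `(-V i, e i)` of `ℝ³ × ℝⁿ` for a realization `V` of the oriented matroid. Indeed,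
the complement of each pair of twin vertices is a face, and the functionals cutting out these faces
have a three-dimensional common kernel, which carries `V`; the other faces are encoded by the
covectors of `V`, and covectors and chirotope determine each other (`IsLawrence.faceLattice_eq`,
`exists_isLawrence`, `covectors_eq_of_chirotope`, `chirotope_eq_of_covectors_eq`).

In these coordinates the unit sphere becomes the null cone of a Lorentzian quadratic form `B` that
contains the vectors `(±V i, e i)`, and Möbius transformations are Lorentz transformations
(`exists_mobius_of_lorentz`). So `V` and `B` determine the Möbius class of the inscribed polytope.
A functional `h` that places the hyperplane at infinity outside the sphere makes the condition on
`B` convex, and an explicit `B` exists for every `V` and `h`. Hence the marked forms deform to the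
chart: move `B` linearly to the explicit form, and shrink `h` to `0`
(`chartSection_comp_chartProj_homotopic`).

The map `realizationClass` from the marked forms to the inscribed realization space is continuous,
because the configurations with the prescribed distances form a closed family with compact fibres.
It has a continuous section `canonClass`, computed from a Gram matrix of the vertices that is
weighted so as to be invariant under Möbius transformations. The remaining ambiguity of `V`, for a
given inscribed polytope, is a positive scaling of its rows and columns
(`canonVectors_eq_rescale`), and taking powers of the scaling factors gives the homotopy that
completes the equivalence (`homotopic_id_of_rescale`).
-/

namespace LawrenceInscribed

open Matrix

/-! ### Covectors and chirotopes -/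

/-- The covectors of a configuration of vectors in `ℝ³`: the sign vectors of the restrictions of
linear functionals to the configuration. -/
def covectors {ι : Type*} (V : ι → Fin 3 → ℝ) : Set (ι → SignType) :=
  {σ | ∃ w : Fin 3 → ℝ, ∀ i, σ i = SignType.sign (w ⬝ᵥ V i)}

lemma chirotope_triple {ι : Type*} (V : ι → Fin 3 → ℝ) (i j k : ι) :
    chirotope V ![i, j, k] = SignType.sign (V i ⬝ᵥ V j ⨯₃ V k) := by
  rw [triple_product_eq_det, chirotope]
  congr 2

/-- The next step of a conformal decomposition: subtracting a suitable multiple of `z` from `y`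
makes a new coordinate vanish and reverses no sign. -/
lemma exists_conformal_sub {ι : Type*} [Fintype ι] (y z : ι → ℝ) (hsupp : ∀ i, y i = 0 → z i = 0)
    (hpos : ∃ i, 0 < z i * y i) :
    ∃ t : ℝ, 0 < t ∧ (∀ i, SignType.sign (y i - t * z i) = 0 ∨
      SignType.sign (y i - t * z i) = SignType.sign (y i)) ∧ ∃ i, y i ≠ 0 ∧ y i - t * z i = 0 := by
  classical
  obtain ⟨i₀, hi₀⟩ := hpos
  obtain ⟨m, hm, hmin⟩ := Finset.exists_min_image (Finset.univ.filter fun i => 0 < z i * y i)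
    (fun i => y i / z i) ⟨i₀, by simpa using hi₀⟩
  simp only [Finset.mem_filter, Finset.mem_univ, true_and] at hm hmin
  have hz : z m ≠ 0 := fun h => by simp [h] at hm
  have hy : y m ≠ 0 := fun h => by simp [h] at hm
  have ht : 0 < y m / z m := by
    rw [show y m / z m = z m * y m / (z m) ^ 2 by field_simp]
    positivity
  refine ⟨y m / z m, ht, fun i => ?_, m, hy, by field_simp; ring⟩
  set t := y m / z m
  rcases lt_trichotomy (y i) 0 with h | h | h
  · have : y i - t * z i ≤ 0 := by
      by_cases hz' : z i < 0
      · have := hmin i (mul_pos_of_neg_of_neg hz' h)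
        rw [le_div_iff_of_neg hz'] at this
        linarith
      · have := mul_nonneg ht.le (not_lt.1 hz')
        linarith
    rcases this.lt_or_eq with h' | h'
    · right; rw [sign_neg h, sign_neg h']
    · left; rw [h', sign_zero]
  · left; simp [h, hsupp i h]
  · have : 0 ≤ y i - t * z i := by
      by_cases hz' : 0 < z i
      · have := hmin i (mul_pos hz' h)
        rw [le_div_iff₀ hz'] at this
        linarith
      · have := mul_nonneg ht.le (neg_nonneg.2 (not_lt.1 hz'))
        linarith
    rcases this.lt_or_eq with h' | h'
    · right; rw [sign_pos h, sign_pos h']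
    · left; rw [← h', sign_zero]

lemma eq_smul_of_cross_eq_zero {w n : Fin 3 → ℝ} (hn : n ≠ 0) (h : w ⨯₃ n = 0) :
    ∃ c : ℝ, w = c • n := by
  refine ⟨(w ⬝ᵥ n) / (n ⬝ᵥ n), ?_⟩
  have hnn : n ⬝ᵥ n ≠ 0 := fun h0 => hn (dotProduct_self_eq_zero.1 h0)
  have h1 := cross_cross_eq_smul_sub_smul w n n
  rw [h] at h1
  simp only [map_zero, LinearMap.zero_apply] at h1
  have h2 : (n ⬝ᵥ n) • w = (w ⬝ᵥ n) • n := by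
    have h3 := cross_cross_eq_smul_sub_smul n w n
    have h4 : n ⨯₃ w = 0 := by rw [← cross_anticomm, h, neg_zero]
    rw [h4] at h3
    simp only [map_zero, LinearMap.zero_apply] at h3
    exact (sub_eq_zero.1 h3.symm)
  rw [div_eq_inv_mul, mul_smul, ← h2, smul_smul, inv_mul_cancel₀ hnn, one_smul]

lemma exists_dotProduct_ne_zero {ι : Type*} {V : ι → Fin 3 → ℝ} (hV : ∃ t, chirotope V t ≠ 0)
    {z : Fin 3 → ℝ} (hz : z ≠ 0) : ∃ i, z ⬝ᵥ V i ≠ 0 := by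
  obtain ⟨t, ht⟩ := hV
  by_contra! h
  refine hz (Matrix.eq_zero_of_mulVec_eq_zero (M := Matrix.of fun k => V (t k)) ?_ ?_)
  · intro h0; exact ht (by rw [chirotope, h0, sign_zero])
  · ext k
    simpa [Matrix.mulVec, dotProduct_comm] using h (t k)

/-- If the vectors at which the functional `w` vanishes are pairwise parallel, some functional that
is not a multiple of `w` vanishes at them as well. -/
lemma exists_cross_ne_zero {ι : Type*} {V : ι → Fin 3 → ℝ} {w : Fin 3 → ℝ} (hw : w ≠ 0)
    (hpar : ∀ j k, w ⬝ᵥ V j = 0 → w ⬝ᵥ V k = 0 → V j ⨯₃ V k = 0) :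
    ∃ z : Fin 3 → ℝ, w ⨯₃ z ≠ 0 ∧ ∀ k, w ⬝ᵥ V k = 0 → z ⬝ᵥ V k = 0 := by
  have hww : w ⬝ᵥ w ≠ 0 := fun h0 => hw (dotProduct_self_eq_zero.1 h0)
  by_cases hex : ∃ j, w ⬝ᵥ V j = 0 ∧ V j ≠ 0
  · obtain ⟨j, hj, hj0⟩ := hex
    refine ⟨w ⨯₃ V j, fun h => ?_, fun k hk => ?_⟩
    · have h1 := cross_cross_eq_smul_sub_smul w (V j) w
      rw [← cross_anticomm, h, neg_zero] at h1
      rw [dotProduct_comm (V j) w, hj, zero_smul, sub_zero] at h1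
      exact (smul_ne_zero hww hj0) h1.symm
    · rw [dotProduct_comm, triple_product_permutation, hpar j k hj hk, dotProduct_zero]
  · push Not at hex
    by_contra! hcon
    have key : ∀ z : Fin 3 → ℝ, w ⨯₃ z = 0 := by
      intro z
      by_contra hz
      obtain ⟨k, hk, hk'⟩ := hcon z hz
      exact hk' (by rw [hex k hk, dotProduct_zero])
    have h0 := key ![1, 0, 0]
    have h1 := key ![0, 1, 0]
    rw [cross_apply] at h0 h1
    apply hw
    ext a
    have e0 := congrFun h0 1
    have e1 := congrFun h0 2
    have e2 := congrFun h1 2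
    simp at e0 e1 e2
    fin_cases a <;> simp [*]

/-- The functional `V j ⨯₃ V k` evaluates on `V` to determinants, so its signs are read off from the
chirotope. The factor `ε` is the global sign between the two chirotopes. -/
lemma sign_dotProduct_eq_of_cross {ι : Type*} {V V' : ι → Fin 3 → ℝ} {ε : SignType}
    (hε : ε * ε = 1) (h : ∀ t, chirotope V' t = ε * chirotope V t) (j k : ι) (c : ℝ) :
    ∃ w' : Fin 3 → ℝ, ∀ i,
      SignType.sign (w' ⬝ᵥ V' i) = SignType.sign ((c • (V j ⨯₃ V k)) ⬝ᵥ V i) := by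
  refine ⟨((ε : ℝ) * c) • (V' j ⨯₃ V' k), fun i => ?_⟩
  have h1 := h ![i, j, k]
  rw [chirotope_triple, chirotope_triple] at h1
  have h2 : SignType.sign ((ε : SignType) : ℝ) = ε := by
    cases ε <;> simp
  rw [smul_dotProduct, smul_dotProduct, smul_eq_mul, smul_eq_mul, sign_mul, sign_mul, sign_mul,
    h2, dotProduct_comm _ (V' i), dotProduct_comm _ (V i), h1]
  calc ε * SignType.sign c * (ε * SignType.sign (V i ⬝ᵥ V j ⨯₃ V k))
      = (ε * ε) * (SignType.sign c * SignType.sign (V i ⬝ᵥ V j ⨯₃ V k)) := by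
        simp only [mul_assoc, mul_left_comm]
    _ = _ := by rw [hε, one_mul]

/-- The signs of the determinants determine the covectors. A functional whose zero set spans a
plane is a multiple of a cross product of two vectors of the configuration; every other one is
a conformal sum of functionals with smaller support. -/
theorem exists_sign_dotProduct_eq {ι : Type*} [Fintype ι] {V V' : ι → Fin 3 → ℝ} {ε : SignType}
    (hε : ε * ε = 1) (h : ∀ t, chirotope V' t = ε * chirotope V t)
    (hV : ∃ t, chirotope V t ≠ 0) (w : Fin 3 → ℝ) :
    ∃ w' : Fin 3 → ℝ, ∀ i, SignType.sign (w' ⬝ᵥ V' i) = SignType.sign (w ⬝ᵥ V i) := by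
  classical
  induction hm : (Finset.univ.filter fun i => w ⬝ᵥ V i ≠ 0).card using Nat.strong_induction_on
    generalizing w with
  | _ m ih =>
  subst hm
  by_cases hw : w = 0
  · exact ⟨0, by simp [hw]⟩
  by_cases hpl : ∃ j k, w ⬝ᵥ V j = 0 ∧ w ⬝ᵥ V k = 0 ∧ V j ⨯₃ V k ≠ 0
  · obtain ⟨j, k, hj, hk, hjk⟩ := hpl
    have h0 : w ⨯₃ (V j ⨯₃ V k) = 0 := by
      rw [← cross_anticomm, cross_cross_eq_smul_sub_smul, dotProduct_comm (V j),
        dotProduct_comm (V k), hj, hk]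
      simp
    obtain ⟨c, rfl⟩ := eq_smul_of_cross_eq_zero hjk h0
    exact sign_dotProduct_eq_of_cross hε h j k c
  push Not at hpl
  obtain ⟨z₀, hz₀, hz₀'⟩ := exists_cross_ne_zero hw hpl
  obtain ⟨i₁, hi₁⟩ := exists_dotProduct_ne_zero hV hw
  -- `z₁` vanishes where `w` does and also at `i₁`
  set z₁ := z₀ - ((z₀ ⬝ᵥ V i₁) / (w ⬝ᵥ V i₁)) • w with hz₁
  have hz₁0 : z₁ ≠ 0 := by
    intro h0
    apply hz₀
    rw [sub_eq_zero.1 h0]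
    simp
  have hz₁' : ∀ k, w ⬝ᵥ V k = 0 → z₁ ⬝ᵥ V k = 0 := by
    intro k hk
    simp [hz₁, sub_dotProduct, hk, hz₀' k hk]
  have hz₁i : z₁ ⬝ᵥ V i₁ = 0 := by
    simp [hz₁, sub_dotProduct, hi₁]
  obtain ⟨i₂, hi₂⟩ := exists_dotProduct_ne_zero hV hz₁0
  have hwi₂ : w ⬝ᵥ V i₂ ≠ 0 := fun h0 => hi₂ (hz₁' _ h0)
  obtain ⟨z, hzsupp, hzi, hzpos⟩ : ∃ z : Fin 3 → ℝ, (∀ k, w ⬝ᵥ V k = 0 → z ⬝ᵥ V k = 0) ∧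
      z ⬝ᵥ V i₁ = 0 ∧ 0 < z ⬝ᵥ V i₂ * w ⬝ᵥ V i₂ := by
    rcases (mul_ne_zero hi₂ hwi₂).lt_or_gt with hlt | hgt
    · exact ⟨-z₁, fun k hk => by simp [hz₁' k hk], by simp [hz₁i], by
        rw [neg_dotProduct]; linarith⟩
    · exact ⟨z₁, hz₁', hz₁i, hgt⟩
  obtain ⟨t, -, hconf, i₃, hi₃, hi₃'⟩ := exists_conformal_sub (fun i => w ⬝ᵥ V i)
    (fun i => z ⬝ᵥ V i) hzsupp ⟨i₂, hzpos⟩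
  have hu : ∀ i, (w - t • z) ⬝ᵥ V i = w ⬝ᵥ V i - t * z ⬝ᵥ V i := fun i => by
    simp [sub_dotProduct]
  -- `w` is the sum of `v` and `s • u`; both have smaller support than `w` and agree in sign
  -- with `w` on their supports
  set u := w - t • z
  simp only [← hu] at hconf hi₃'
  have husupp : ∀ i, w ⬝ᵥ V i = 0 → u ⬝ᵥ V i = 0 := fun i hi => by
    rw [hu, hi, hzsupp i hi]; simp
  have hui₁ : u ⬝ᵥ V i₁ = w ⬝ᵥ V i₁ := by rw [hu, hzi]; simp
  obtain ⟨s, hs, hconf', i₄, hi₄, hi₄'⟩ := exists_conformal_sub (fun i => w ⬝ᵥ V i)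
    (fun i => u ⬝ᵥ V i) husupp ⟨i₁, by simp only [hui₁]; exact mul_self_pos.2 hi₁⟩
  have hv : ∀ i, (w - s • u) ⬝ᵥ V i = w ⬝ᵥ V i - s * u ⬝ᵥ V i := fun i => by
    simp [sub_dotProduct]
  set v := w - s • u
  simp only [← hv] at hconf' hi₄'
  have hsmall : ∀ (x : Fin 3 → ℝ) (i : ι),
      (∀ i, SignType.sign (x ⬝ᵥ V i) = 0 ∨
        SignType.sign (x ⬝ᵥ V i) = SignType.sign (w ⬝ᵥ V i)) → w ⬝ᵥ V i ≠ 0 → x ⬝ᵥ V i = 0 →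
      ∃ x' : Fin 3 → ℝ, ∀ i, SignType.sign (x' ⬝ᵥ V' i) = SignType.sign (x ⬝ᵥ V i) := by
    intro x i hx hi hi'
    refine ih _ (Finset.card_lt_card ?_) x rfl
    rw [Finset.ssubset_iff_of_subset]
    · exact ⟨i, by simp [hi], by simp [hi']⟩
    · intro k
      simp only [Finset.mem_filter, Finset.mem_univ, true_and]
      intro hk hk0
      rcases hx k with h1 | h1
      · exact hk (sign_eq_zero_iff.1 h1)
      · rw [hk0, sign_zero] at h1; exact hk (sign_eq_zero_iff.1 h1)
  obtain ⟨u', hu'⟩ := hsmall u i₃ hconf hi₃ hi₃'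
  obtain ⟨v', hv'⟩ := hsmall v i₄ hconf' hi₄ hi₄'
  refine ⟨v' + u', fun i => ?_⟩
  rw [add_dotProduct]
  have hwi : w ⬝ᵥ V i = v ⬝ᵥ V i + s * u ⬝ᵥ V i := by rw [hv]; ring
  have hu'i := hu' i
  have hv'i := hv' i
  have hci := hconf i
  have hci' := hconf' i
  rcases lt_trichotomy (w ⬝ᵥ V i) 0 with h0 | h0 | h0
  · rw [sign_neg h0] at hci hci' ⊢
    rw [← hu'i, sign_eq_zero_iff, sign_eq_neg_one_iff] at hci
    rw [← hv'i, sign_eq_zero_iff, sign_eq_neg_one_iff] at hci'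
    rw [sign_eq_neg_one_iff]
    rcases hci with a | a <;> rcases hci' with b | b
    · exfalso
      rw [a, sign_zero, eq_comm, sign_eq_zero_iff] at hu'i
      rw [b, sign_zero, eq_comm, sign_eq_zero_iff] at hv'i
      rw [hwi, hu'i, hv'i] at h0; simp at h0
    all_goals linarith
  · rw [husupp i h0] at hu'i
    have : v ⬝ᵥ V i = 0 := by rw [hv, h0, husupp i h0]; simp
    rw [this] at hv'i
    rw [sign_zero, sign_eq_zero_iff] at hu'i hv'i
    rw [hu'i, hv'i, h0]; simp
  · rw [sign_pos h0] at hci hci' ⊢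
    rw [← hu'i, sign_eq_zero_iff, sign_eq_one_iff] at hci
    rw [← hv'i, sign_eq_zero_iff, sign_eq_one_iff] at hci'
    rw [sign_eq_one_iff]
    rcases hci with a | a <;> rcases hci' with b | b
    · exfalso
      rw [a, sign_zero, eq_comm, sign_eq_zero_iff] at hu'i
      rw [b, sign_zero, eq_comm, sign_eq_zero_iff] at hv'i
      rw [hwi, hu'i, hv'i] at h0; simp at h0
    all_goals linarith

theorem covectors_eq_of_chirotope {ι : Type*} [Fintype ι] {V V' : ι → Fin 3 → ℝ}
    (h : (∀ t, chirotope V' t = chirotope V t) ∨ (∀ t, chirotope V' t = -chirotope V t))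
    (hV : ∃ t, chirotope V t ≠ 0) : covectors V' = covectors V := by
  obtain ⟨ε, hε, h⟩ : ∃ ε : SignType, ε * ε = 1 ∧ ∀ t, chirotope V' t = ε * chirotope V t := by
    rcases h with h | h
    · exact ⟨1, rfl, fun t => by rw [h, one_mul]⟩
    · exact ⟨-1, rfl, fun t => by rw [h]; generalize chirotope V t = s; cases s <;> rfl⟩
  have h' : ∀ t, chirotope V t = ε * chirotope V' t := fun t => by
    rw [h, ← mul_assoc, hε, one_mul]
  have hV' : ∃ t, chirotope V' t ≠ 0 := by
    obtain ⟨t, ht⟩ := hV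
    exact ⟨t, fun h0 => ht (by rw [h', h0, mul_zero])⟩
  ext σ
  constructor
  · rintro ⟨w, hw⟩
    obtain ⟨w', hw'⟩ := exists_sign_dotProduct_eq hε h' hV' w
    exact ⟨w', fun i => by rw [hw, hw']⟩
  · rintro ⟨w, hw⟩
    obtain ⟨w', hw'⟩ := exists_sign_dotProduct_eq hε h hV w
    exact ⟨w', fun i => by rw [hw, hw']⟩

lemma chirotope_cycle {ι : Type*} (V : ι → Fin 3 → ℝ) (i j k : ι) :
    chirotope V ![i, j, k] = chirotope V ![j, k, i] := by
  rw [chirotope_triple, chirotope_triple, triple_product_permutation]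

/-- Non-parallel vectors `V j` and `V k` are separated by functionals vanishing at only one of them;
this is visible in the covectors. -/
lemma cross_ne_zero_of_covectors {ι : Type*} {V V' : ι → Fin 3 → ℝ}
    (h : ∀ w : Fin 3 → ℝ, ∃ w' : Fin 3 → ℝ, ∀ i,
      SignType.sign (w' ⬝ᵥ V' i) = SignType.sign (w ⬝ᵥ V i)) {j k : ι}
    (hjk : V j ⨯₃ V k ≠ 0) : V' j ⨯₃ V' k ≠ 0 := by
  have hsep : ∀ {j k : ι}, V j ⨯₃ V k ≠ 0 → ∃ w' : Fin 3 → ℝ, w' ⬝ᵥ V' j = 0 ∧ w' ⬝ᵥ V' k ≠ 0 := by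
    intro j k hjk
    obtain ⟨w', hw'⟩ := h ((V j ⨯₃ V k) ⨯₃ V j)
    refine ⟨w', ?_, ?_⟩
    · rw [← sign_eq_zero_iff, hw', sign_eq_zero_iff, dotProduct_comm, dot_cross_self]
    · rw [← sign_ne_zero, hw', sign_ne_zero, dotProduct_comm, triple_product_permutation]
      exact fun h0 => hjk (dotProduct_self_eq_zero.1 h0)
  obtain ⟨f, hfj, hfk⟩ := hsep hjk
  obtain ⟨g, hgk, hgj⟩ := hsep (j := k) (k := j) (by rwa [← cross_anticomm, neg_ne_zero])
  intro h0
  have hk0 : V' k ≠ 0 := fun h0 => hfk (by rw [h0, dotProduct_zero])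
  obtain ⟨c, hc⟩ := eq_smul_of_cross_eq_zero hk0 h0
  rw [hc, dotProduct_smul, hgk, smul_zero] at hgj
  exact hgj rfl

/-- The covectors determine, for every pair of labels, the corresponding cocircuit up to sign. -/
lemma exists_sign_of_covectors_eq {ι : Type*} {V V' : ι → Fin 3 → ℝ}
    (h : covectors V' = covectors V) (hV : ∃ t, chirotope V t ≠ 0) (j k : ι) :
    ∃ ε : SignType, ε ≠ 0 ∧ ∀ i, chirotope V ![i, j, k] = ε * chirotope V' ![i, j, k] := by
  have h1 : ∀ w : Fin 3 → ℝ, ∃ w' : Fin 3 → ℝ, ∀ i,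
      SignType.sign (w' ⬝ᵥ V' i) = SignType.sign (w ⬝ᵥ V i) := fun w => by
    have : (fun i => SignType.sign (w ⬝ᵥ V i)) ∈ covectors V' := h ▸ ⟨w, fun i => rfl⟩
    obtain ⟨w', hw'⟩ := this
    exact ⟨w', fun i => (hw' i).symm⟩
  have h2 : ∀ w : Fin 3 → ℝ, ∃ w' : Fin 3 → ℝ, ∀ i,
      SignType.sign (w' ⬝ᵥ V i) = SignType.sign (w ⬝ᵥ V' i) := fun w => by
    have : (fun i => SignType.sign (w ⬝ᵥ V' i)) ∈ covectors V := h ▸ ⟨w, fun i => rfl⟩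
    obtain ⟨w', hw'⟩ := this
    exact ⟨w', fun i => (hw' i).symm⟩
  by_cases hjk : V j ⨯₃ V k = 0
  · have hjk' : V' j ⨯₃ V' k = 0 := by
      by_contra h0
      exact cross_ne_zero_of_covectors h2 h0 hjk
    exact ⟨1, by decide, fun i => by simp [chirotope_triple, hjk, hjk']⟩
  · obtain ⟨w', hw'⟩ := h1 (V j ⨯₃ V k)
    have hzero : ∀ l, (V j ⨯₃ V k) ⬝ᵥ V l = 0 → w' ⬝ᵥ V' l = 0 := fun l hl => by
      rw [← sign_eq_zero_iff, hw', hl, sign_zero]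
    have h0 : w' ⨯₃ (V' j ⨯₃ V' k) = 0 := by
      rw [← cross_anticomm, cross_cross_eq_smul_sub_smul, dotProduct_comm (V' j),
        dotProduct_comm (V' k), hzero j (by rw [dotProduct_comm, dot_self_cross]),
        hzero k (by rw [dotProduct_comm, dot_cross_self])]
      simp
    obtain ⟨c, rfl⟩ := eq_smul_of_cross_eq_zero (cross_ne_zero_of_covectors h1 hjk) h0
    refine ⟨SignType.sign c, ?_, fun i => ?_⟩
    · rw [sign_ne_zero]
      rintro rfl
      obtain ⟨i, hi⟩ := exists_dotProduct_ne_zero hV hjk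
      have := hw' i
      rw [zero_smul, zero_dotProduct, sign_zero, eq_comm, sign_eq_zero_iff] at this
      exact hi this
    · have := hw' i
      rw [smul_dotProduct, smul_eq_mul, sign_mul] at this
      rw [chirotope_triple, chirotope_triple, dotProduct_comm, ← this, dotProduct_comm (V' i)]

/-- The covectors of a spanning configuration determine its chirotope up to a global sign; the
signs of any two bases are linked by three basis exchanges. -/
theorem chirotope_eq_of_covectors_eq {ι : Type*} {V V' : ι → Fin 3 → ℝ}
    (h : covectors V' = covectors V) (hV : ∃ t, chirotope V t ≠ 0) :
    (∀ t, chirotope V' t = chirotope V t) ∨ (∀ t, chirotope V' t = -chirotope V t) := by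
  have htri : ∀ t : Fin 3 → ι, t = ![t 0, t 1, t 2] := fun t => by
    ext a; fin_cases a <;> rfl
  have hzero : ∀ t, chirotope V t = 0 → chirotope V' t = 0 := fun t ht => by
    obtain ⟨ε, hε, h1⟩ := exists_sign_of_covectors_eq h hV (t 1) (t 2)
    have h2 := h1 (t 0)
    rw [← htri, ht] at h2
    revert h2
    generalize chirotope V' t = s
    clear h1
    revert hε; revert ε s; decide
  have hexch : ∀ i i' j k, chirotope V ![i, j, k] ≠ 0 → chirotope V ![i', j, k] ≠ 0 →
      chirotope V ![i, j, k] * chirotope V' ![i, j, k] =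
      chirotope V ![i', j, k] * chirotope V' ![i', j, k] := fun i i' j k => by
    obtain ⟨ε, hε, h1⟩ := exists_sign_of_covectors_eq h hV j k
    rw [h1 i, h1 i']
    generalize chirotope V' ![i, j, k] = s
    generalize chirotope V' ![i', j, k] = s'
    revert hε; clear h1; revert ε s s'; decide
  obtain ⟨t, ht⟩ := hV
  have hbasis : ∀ (s : Fin 3 → ι) (j k : ι), chirotope V s ≠ 0 → (∃ i, chirotope V ![i, j, k] ≠ 0) →
      ∃ x, chirotope V ![s x, j, k] ≠ 0 := by
    rintro s j k hs ⟨i, hi⟩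
    have hjk : V j ⨯₃ V k ≠ 0 := fun h0 => hi (by rw [chirotope_triple, h0]; simp)
    obtain ⟨x, hx⟩ := exists_dotProduct_ne_zero (V := V ∘ s) ⟨id, hs⟩ hjk
    exact ⟨x, by rw [chirotope_triple, sign_ne_zero, dotProduct_comm]; exact hx⟩
  have hperm : ∀ (U : ι → Fin 3 → ℝ) (s : Fin 3 → ι) (σ : Equiv.Perm (Fin 3)),
      chirotope U (s ∘ σ) = SignType.sign ((Equiv.Perm.sign σ : ℤ) : ℝ) * chirotope U s := by
    intro U s σ
    rw [chirotope, chirotope, ← sign_mul, ← Matrix.det_permute]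
    rfl
  have hall : ∀ s, chirotope V s ≠ 0 →
      chirotope V s * chirotope V' s = chirotope V t * chirotope V' t := by
    intro s hs
    rw [htri t] at ht ⊢
    obtain ⟨x, hx⟩ := hbasis s (t 1) (t 2) hs ⟨_, ht⟩
    have e1 := hexch _ _ _ _ ht hx
    rw [chirotope_cycle] at hx
    rw [chirotope_cycle V (s x), chirotope_cycle V' (s x)] at e1
    obtain ⟨y, hy⟩ := hbasis s (t 2) (s x) hs ⟨_, hx⟩
    have e2 := hexch _ _ _ _ hx hy
    rw [chirotope_cycle] at hy
    rw [chirotope_cycle V (s y), chirotope_cycle V' (s y)] at e2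
    obtain ⟨z, hz⟩ := hbasis s (s x) (s y) hs ⟨_, hy⟩
    have e3 := hexch _ _ _ _ hy hz
    rw [e1, e2, e3]
    have hcomp : ![s z, s x, s y] = s ∘ ![z, x, y] := by
      ext a; fin_cases a <;> rfl
    rw [hcomp] at hz ⊢
    have hinj : Function.Injective ![z, x, y] := by
      intro a b hab
      by_contra hne
      apply hz
      rw [chirotope, sign_eq_zero_iff]
      exact Matrix.det_zero_of_row_eq hne (by
        ext m
        simp only [Matrix.of_apply, Function.comp_apply, hab])
    have hσ : (![z, x, y] : Fin 3 → Fin 3) =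
        Equiv.ofBijective _ (Finite.injective_iff_bijective.1 hinj) := rfl
    rw [hσ, hperm, hperm]
    set σ := Equiv.ofBijective _ (Finite.injective_iff_bijective.1 hinj)
    rcases Int.units_eq_one_or (Equiv.Perm.sign σ) with h1 | h1 <;> rw [h1] <;>
    · generalize chirotope V s = a
      generalize chirotope V' s = b
      simp
  generalize hε : chirotope V t * chirotope V' t = ε at hall
  have hε0 : ε ≠ 0 := by
    obtain ⟨ε', -, h1⟩ := exists_sign_of_covectors_eq h ⟨t, ht⟩ (t 1) (t 2)
    have h2 := h1 (t 0)
    rw [← htri] at h2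
    rw [← hε]
    revert h2 ht
    generalize chirotope V t = a
    generalize chirotope V' t = b
    clear h1 hε; revert ε' a b; decide
  have hfin : ∀ s, chirotope V' s = ε * chirotope V s := fun s => by
    by_cases hs : chirotope V s = 0
    · rw [hzero s hs, hs, mul_zero]
    · rw [← hall s hs]
      have := hall s hs
      revert hs this
      generalize chirotope V s = a
      generalize chirotope V' s = b
      clear hε hall
      revert a b hε0; revert ε; decide
  cases ε with
  | zero => exact absurd rfl hε0
  | neg => right; intro s; rw [hfin]; generalize chirotope V s = a; revert a; decide
  | pos => left; intro s; rw [hfin]; generalize chirotope V s = a; revert a; decide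

/-! ### Faces of Lawrence polytopes -/

lemma mem_faceLattice_iff {L E : Type*} [Nonempty L] [NormedAddCommGroup E] [NormedSpace ℝ E]
    (P : L → E) (S : Set L) : S ∈ faceLattice P ↔
      ∃ (l : E →L[ℝ] ℝ) (c : ℝ), (∀ a, l (P a) ≤ c) ∧ S = {a | l (P a) = c} := by
  have hmem : ∀ a, P a ∈ convexHull ℝ (range P) := fun a => subset_convexHull _ _ ⟨a, rfl⟩
  have hle : ∀ (l : E →L[ℝ] ℝ) (c : ℝ), (∀ a, l (P a) ≤ c) →
      ∀ x ∈ convexHull ℝ (range P), l x ≤ c := by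
    intro l c h
    refine convexHull_min (t := {x | l x ≤ c}) ?_ ?_
    · rintro _ ⟨a, rfl⟩; exact h a
    · exact convex_halfSpace_le l.toLinearMap.isLinear c
  constructor
  · rintro ⟨F, hF, rfl⟩
    rcases F.eq_empty_or_nonempty with rfl | hne
    · exact ⟨0, 1, fun a => by simp, by ext; simp⟩
    · obtain ⟨l, rfl⟩ := hF hne
      obtain ⟨x₀, hx₀, hx₀'⟩ := hne
      refine ⟨l, l x₀, fun a => hx₀' _ (hmem a), ?_⟩
      ext a
      simp only [mem_preimage, mem_ofPred_eq]
      constructor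
      · rintro ⟨-, h⟩; exact le_antisymm (hx₀' _ (hmem a)) (h _ hx₀)
      · intro h; exact ⟨hmem a, fun y hy => h ▸ hx₀' y hy⟩
  · rintro ⟨l, c, hlc, rfl⟩
    refine ⟨{x | x ∈ convexHull ℝ (range P) ∧ l x = c}, ?_, ?_⟩
    · rintro ⟨x₀, hx₀, hx₀'⟩
      refine ⟨l, ?_⟩
      ext x
      simp only [mem_ofPred_eq]
      constructor
      · rintro ⟨h1, h2⟩; exact ⟨h1, fun y hy => h2 ▸ hle l c hlc y hy⟩
      · rintro ⟨h1, h2⟩; exact ⟨h1, le_antisymm (hle l c hlc x h1) (hx₀' ▸ h2 x₀ hx₀)⟩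
    · ext a; simp [hmem]

/-- The homogeneous coordinates `(x, 1)` of a point `x`. -/
def lift {E : Type*} (x : E) : E × ℝ := (x, 1)

/-- In homogeneous coordinates the faces are the zero sets of the nonnegative linear functionals. -/
lemma mem_faceLattice_iff_lift {L E : Type*} [Nonempty L] [NormedAddCommGroup E]
    [NormedSpace ℝ E] [FiniteDimensional ℝ E] (P : L → E) (S : Set L) : S ∈ faceLattice P ↔
      ∃ f : E × ℝ →ₗ[ℝ] ℝ, (∀ a, 0 ≤ f (lift (P a))) ∧ S = {a | f (lift (P a)) = 0} := by
  rw [mem_faceLattice_iff]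
  constructor
  · rintro ⟨l, c, h, rfl⟩
    refine ⟨c • LinearMap.snd ℝ E ℝ - l.toLinearMap ∘ₗ LinearMap.fst ℝ E ℝ, fun a => ?_, ?_⟩
    · simpa [lift] using h a
    · ext a; simp [lift, eq_comm (b := l (P a)), sub_eq_zero]
  · rintro ⟨f, h, rfl⟩
    have hf : ∀ a, f (lift (P a)) = f (0, 1) - (-(f ∘ₗ LinearMap.inl ℝ E ℝ)) (P a) := fun a => by
      simp only [LinearMap.neg_apply, LinearMap.comp_apply, LinearMap.inl_apply, sub_neg_eq_add,
        ← map_add, lift]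
      simp
    refine ⟨LinearMap.toContinuousLinearMap (-(f ∘ₗ LinearMap.inl ℝ E ℝ)), f (0, 1), fun a => ?_, ?_⟩
    · have := h a
      rw [hf] at this
      exact sub_nonneg.1 this
    · ext a
      simp only [mem_ofPred_eq, hf, sub_eq_zero]
      exact eq_comm

/-- The sets of labels that are the faces of a Lawrence polytope, in terms of the covectors of the
underlying configuration: a functional on the polytope restricts to a functional `y` on the
configuration, it vanishes at neither or both vertices over `i` if `y i = 0`, and otherwise at
most at the vertex that the sign of `y i` permits. -/
def lawrenceFaces {ι : Type*} (C : Set (ι → SignType)) : Set (Set (ι ⊕ ι)) :=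
  {S | ∃ σ ∈ C, ∀ i, (Sum.inl i ∈ S → σ i ≤ 0) ∧ (Sum.inr i ∈ S → 0 ≤ σ i) ∧
    (σ i = 0 → (Sum.inl i ∈ S ↔ Sum.inr i ∈ S))}

/-- A covector `σ` is recovered from the largest of its faces, which contains `inl i` if `σ i ≤ 0`
and `inr i` if `0 ≤ σ i`. -/
lemma lawrenceFaces_injective {ι : Type*} :
    Function.Injective (lawrenceFaces : Set (ι → SignType) → Set (Set (ι ⊕ ι))) := by
  have key : ∀ C C' : Set (ι → SignType), lawrenceFaces C = lawrenceFaces C' → C ⊆ C' := by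
    intro C C' h σ hσ
    have hS : {a | Sum.elim (fun i => σ i ≤ 0) (fun i => 0 ≤ σ i) a} ∈ lawrenceFaces C :=
      ⟨σ, hσ, fun i => ⟨id, id, fun h0 => by simp [h0]⟩⟩
    rw [h] at hS
    obtain ⟨τ, hτ, hτσ⟩ := hS
    convert hτ
    ext i
    have := hτσ i
    simp only [mem_ofPred_eq, Sum.elim_inl, Sum.elim_inr] at this
    revert this
    generalize σ i = a
    generalize τ i = b
    revert a b; decide
  exact fun C C' h => (key _ _ h).antisymm (key _ _ h.symm)

/-- The points `x` are the vertices of a realization of a Lawrence polytope: for every `i` a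
positive combination of `lift (x (inl i))` and `-lift (x (inr i))` lies in a fixed three-dimensional
space with basis `w`, where it has coordinates `V i`; modulo that space the vectors
`lift (x (inr i))` are independent. -/
structure IsLawrence {ι E : Type*} [NormedAddCommGroup E] [NormedSpace ℝ E] (x : ι ⊕ ι → E)
    (lam : ι → ℝ) (w : Fin 3 → E × ℝ) (V : ι → Fin 3 → ℝ) : Prop where
  pos : ∀ i, 0 < lam i
  indep : LinearIndependent ℝ (Sum.elim w fun i => lift (x (Sum.inr i)))
  rel : ∀ i, lift (x (Sum.inl i)) - lam i • lift (x (Sum.inr i)) = ∑ r, V i r • w r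

lemma exists_linearMap_eq {K F L : Type*} [Field K] [AddCommGroup F] [Module K F] {v : L → F}
    (hv : LinearIndependent K v) (c : L → K) : ∃ f : F →ₗ[K] K, ∀ a, f (v a) = c a := by
  obtain ⟨f, hf⟩ := LinearMap.exists_extend ((Module.Basis.span hv).constr K c)
  refine ⟨f, fun a => ?_⟩
  have h := LinearMap.congr_fun hf (Module.Basis.span hv a)
  rw [Module.Basis.constr_basis] at h
  rw [← h]
  simp [Module.Basis.span_apply]

/-- A functional on `E × ℝ` is given by its restriction to the three-dimensional space, which is an
arbitrary functional on `V`, and by its values at the points `inr i`, which are arbitrary. -/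
theorem IsLawrence.faceLattice_eq {ι E : Type*} [Fintype ι] [Nonempty ι] [NormedAddCommGroup E]
    [NormedSpace ℝ E] [FiniteDimensional ℝ E] {x : ι ⊕ ι → E} {lam : ι → ℝ}
    {w : Fin 3 → E × ℝ} {V : ι → Fin 3 → ℝ} (h : IsLawrence x lam w V) :
    faceLattice x = lawrenceFaces (covectors V) := by
  have hrel : ∀ (f : E × ℝ →ₗ[ℝ] ℝ) (i : ι), f (lift (x (Sum.inl i))) =
      (fun r => f (w r)) ⬝ᵥ V i + lam i * f (lift (x (Sum.inr i))) := fun f i => by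
    have := congrArg f (h.rel i)
    rw [map_sub, map_smul, map_sum, smul_eq_mul, sub_eq_iff_eq_add] at this
    rw [this]
    simp [dotProduct, mul_comm]
  ext S
  rw [mem_faceLattice_iff_lift]
  constructor
  · rintro ⟨f, hf, rfl⟩
    refine ⟨_, ⟨fun r => f (w r), fun i => rfl⟩, fun i => ?_⟩
    have h1 := hf (Sum.inl i)
    have h2 := hf (Sum.inr i)
    have hp := h.pos i
    simp only [mem_ofPred_eq]
    rw [hrel f i] at h1 ⊢
    generalize (fun r => f (w r)) ⬝ᵥ V i = y at h1 ⊢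
    generalize f (lift (x (Sum.inr i))) = t at *
    have h3 := mul_nonneg hp.le h2
    refine ⟨fun h0 => ?_, fun h0 => ?_, fun h0 => ?_⟩
    · rw [sign_nonpos_iff]; linarith
    · rw [sign_nonneg_iff]; rw [h0] at h1; simpa using h1
    · rw [sign_eq_zero_iff] at h0
      simp [h0, hp.ne']
  · rintro ⟨σ, ⟨u, hu⟩, hσ⟩
    have : ∀ i, ∃ t : ℝ, 0 ≤ t ∧ 0 ≤ u ⬝ᵥ V i + lam i * t ∧ (Sum.inr i ∈ S ↔ t = 0) ∧
        (Sum.inl i ∈ S ↔ u ⬝ᵥ V i + lam i * t = 0) := fun i => by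
      have hp := h.pos i
      obtain ⟨h1, h2, h3⟩ := hσ i
      rw [hu i] at h1 h2 h3
      rw [sign_nonpos_iff] at h1
      rw [sign_nonneg_iff] at h2
      rw [sign_eq_zero_iff] at h3
      generalize u ⬝ᵥ V i = y at *
      rcases lt_trichotomy y 0 with hy | hy | hy
      · have hS : Sum.inr i ∉ S := fun h0 => absurd (h2 h0) (not_le.2 hy)
        by_cases hl : Sum.inl i ∈ S
        · refine ⟨-y / lam i, (div_pos (neg_pos.2 hy) hp).le, ?_, ?_, ?_⟩
          · field_simp; simp
          · simp [hS, hy.ne, hp.ne']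
          · field_simp; simp [hl]
        · have : 0 < (1 - y) / lam i := div_pos (by linarith) hp
          refine ⟨(1 - y) / lam i, this.le, ?_, ?_, ?_⟩
          · field_simp; norm_num
          · simp [hS, this.ne']
          · field_simp; simp [hl]
      · subst hy
        by_cases hl : Sum.inl i ∈ S
        · exact ⟨0, le_rfl, by simp, by simpa using (h3 rfl).1 hl, by simpa using hl⟩
        · refine ⟨1, zero_le_one, by simpa using hp.le, ?_, ?_⟩
          · simpa using fun h0 => hl ((h3 rfl).2 h0)
          · simp [hl, hp.ne']
      · have hS : Sum.inl i ∉ S := fun h0 => absurd (h1 h0) (not_le.2 hy)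
        by_cases hr : Sum.inr i ∈ S
        · exact ⟨0, le_rfl, by simpa using hy.le, by simpa using hr, by simp [hS, hy.ne']⟩
        · exact ⟨1, zero_le_one, by linarith, by simpa using hr, by simp [hS]; linarith⟩
    choose t ht1 ht2 ht3 ht4 using this
    obtain ⟨f, hf⟩ := exists_linearMap_eq h.indep (Sum.elim u t)
    have hfr : ∀ i, f (lift (x (Sum.inr i))) = t i := fun i => hf (Sum.inr i)
    have hfl : ∀ i, f (lift (x (Sum.inl i))) = u ⬝ᵥ V i + lam i * t i := fun i => by
      rw [hrel, hfr]
      congr 2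
      ext r
      exact hf (Sum.inl r)
    refine ⟨f, ?_, ?_⟩
    · rintro (i | i)
      · rw [hfl]; exact ht2 i
      · rw [hfr]; exact ht1 i
    · ext a
      rcases a with i | i
      · rw [mem_ofPred_eq, hfl, ht4]
      · rw [mem_ofPred_eq, hfr, ht3]

/-- The Lawrence polytope of `A` is in Lawrence position over the homogenization of `A`; the factor
`1 / 2` cancels the height `2` of the second vertex of each pair. -/
lemma isLawrence_lawrence {ι : Type*} [Fintype ι] [DecidableEq ι]
    (A : ι → EuclideanSpace ℝ (Fin 2)) :
    IsLawrence (lawrence A) (fun _ => 1 / 2)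
      ![(EuclideanSpace.single (Sum.inl 0) (1 / 2), 0),
        (EuclideanSpace.single (Sum.inl 1) (1 / 2), 0), (0, 1 / 2)] (homogenization A) where
  pos _ := by norm_num
  indep := by
    rw [Fintype.linearIndependent_iff]
    intro g hg
    rw [Fintype.sum_sum_type, Fin.sum_univ_three] at hg
    simp only [Sum.elim_inl, Sum.elim_inr] at hg
    have h1 := congrArg Prod.fst hg
    have h2 := congrArg Prod.snd hg
    simp [lift, Prod.fst_sum, Prod.snd_sum] at h1 h2
    have hr : ∀ i, g (Sum.inr i) = 0 := fun i => by
      have := congrArg (fun v => v (Sum.inr i)) h1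
      simp [lawrence, Pi.single_apply] at this
      exact this
    simp only [hr, zero_smul, Finset.sum_const_zero, add_zero] at h1 h2
    have e0 := congrArg (fun v => v (Sum.inl 0)) h1
    have e1 := congrArg (fun v => v (Sum.inl 1)) h1
    simp at e0 e1
    rintro (r | i)
    · fin_cases r
      · exact e0
      · exact e1
      · simpa using h2
    · exact hr i
  rel i := by
    rw [Fin.sum_univ_three]
    refine Prod.ext ?_ ?_
    · ext a
      rcases a with a | a
      · fin_cases a <;> simp [lift, lawrence, homogenization, Fin.snoc] <;> ring
      · simp [lift, lawrence, homogenization, Pi.single_apply]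
    · simp [lift, homogenization, Fin.snoc]
      norm_num

/-- Every point configuration with the face lattice of a Lawrence polytope is in Lawrence
position: the complement of each pair `{inl i, inr i}` is a face, and the common kernel of
functionals that cut out these faces has dimension three. -/
theorem exists_isLawrence {ι : Type*} [Fintype ι] [Nonempty ι]
    {x : ι ⊕ ι → EuclideanSpace ℝ (Fin 2 ⊕ ι)} {V₀ : ι → Fin 3 → ℝ}
    (h : faceLattice x = lawrenceFaces (covectors V₀)) :
    ∃ lam w V, IsLawrence x lam w V ∧ covectors V = covectors V₀ := by
  classical
  have hface : ∀ i, {a : ι ⊕ ι | a ≠ Sum.inl i ∧ a ≠ Sum.inr i} ∈ faceLattice x := fun i => by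
    rw [h]
    exact ⟨fun _ => 0, ⟨0, fun j => by simp⟩, fun j => by simp⟩
  simp only [mem_faceLattice_iff_lift] at hface
  -- `f i` vanishes at all points except `inl i` and `inr i`, where it is positive
  choose f hf0 hf using hface
  have hf' : ∀ i a, f i (lift (x a)) = 0 ↔ a ≠ Sum.inl i ∧ a ≠ Sum.inr i := fun i a =>
    (Set.ext_iff.1 (hf i) a).symm
  have hfl : ∀ i, 0 < f i (lift (x (Sum.inl i))) := fun i =>
    lt_of_le_of_ne (hf0 _ _) fun h0 => ((hf' _ _).1 h0.symm).1 rfl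
  have hfr : ∀ i, 0 < f i (lift (x (Sum.inr i))) := fun i =>
    lt_of_le_of_ne (hf0 _ _) fun h0 => ((hf' _ _).1 h0.symm).2 rfl
  have hfl0 : ∀ i j, j ≠ i → f i (lift (x (Sum.inl j))) = 0 := fun i j hij =>
    (hf' _ _).2 ⟨by simpa using hij, by simp⟩
  have hfr0 : ∀ i j, j ≠ i → f i (lift (x (Sum.inr j))) = 0 := fun i j hij =>
    (hf' _ _).2 ⟨by simp, by simpa using hij⟩
  set Φ : EuclideanSpace ℝ (Fin 2 ⊕ ι) × ℝ →ₗ[ℝ] ι → ℝ := LinearMap.pi f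
  have hsurj : Function.Surjective Φ := by
    intro c
    refine ⟨∑ j, (c j / f j (lift (x (Sum.inr j)))) • lift (x (Sum.inr j)), ?_⟩
    ext i
    simp only [Φ, LinearMap.pi_apply, map_sum, map_smul, smul_eq_mul]
    rw [Finset.sum_eq_single i]
    · field_simp [(hfr i).ne']
    · intro j _ hj; rw [hfr0 i j hj, mul_zero]
    · simp
  have hdim : Module.finrank ℝ (LinearMap.ker Φ) = Fintype.card (Fin 3) := by
    have := LinearMap.finrank_range_add_finrank_ker Φ
    rw [LinearMap.range_eq_top.2 hsurj, finrank_top] at this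
    simp at this ⊢
    omega
  let bw := Module.finBasisOfFinrankEq ℝ (LinearMap.ker Φ) (by simpa using hdim)
  set lam : ι → ℝ := fun i => f i (lift (x (Sum.inl i))) / f i (lift (x (Sum.inr i)))
  have hker : ∀ i, lift (x (Sum.inl i)) - lam i • lift (x (Sum.inr i)) ∈ LinearMap.ker Φ := by
    intro i
    rw [LinearMap.mem_ker]
    ext j
    simp only [Φ, LinearMap.pi_apply, map_sub, map_smul, smul_eq_mul, Pi.zero_apply]
    by_cases hij : i = j
    · subst hij; simp only [lam]; field_simp [(hfr i).ne']; simp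
    · rw [hfl0 j i hij, hfr0 j i hij]; simp
  have hL : IsLawrence x lam (fun r => (bw r : EuclideanSpace ℝ (Fin 2 ⊕ ι) × ℝ))
      (fun i => bw.equivFun ⟨_, hker i⟩) := by
    refine ⟨fun i => div_pos (hfl i) (hfr i), ?_, fun i => ?_⟩
    · rw [Fintype.linearIndependent_iff]
      intro g hg
      rw [Fintype.sum_sum_type] at hg
      simp only [Sum.elim_inl, Sum.elim_inr] at hg
      have hr : ∀ i, g (Sum.inr i) = 0 := fun i => by
        have h1 := congrArg (f i) hg
        simp only [map_add, map_sum, map_smul, smul_eq_mul, map_zero] at h1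
        rw [Finset.sum_eq_zero, zero_add, Finset.sum_eq_single i] at h1
        · exact (mul_eq_zero.1 h1).resolve_right (hfr i).ne'
        · intro j _ hj; rw [hfr0 i j hj, mul_zero]
        · simp
        · intro r _
          have : Φ (bw r) = 0 := (bw r).2
          rw [show f i (bw r : EuclideanSpace ℝ (Fin 2 ⊕ ι) × ℝ) = Φ (bw r) i from rfl, this]
          simp
      simp only [hr, zero_smul, Finset.sum_const_zero, add_zero] at hg
      have hbw : LinearIndependent ℝ fun r => (bw r : EuclideanSpace ℝ (Fin 2 ⊕ ι) × ℝ) :=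
        bw.linearIndependent.map' (LinearMap.ker Φ).subtype (Submodule.ker_subtype _)
      rw [Fintype.linearIndependent_iff] at hbw
      rintro (r | i)
      · exact hbw (fun r => g (Sum.inl r)) hg r
      · exact hr i
    · have := congrArg Subtype.val (bw.sum_equivFun ⟨_, hker i⟩)
      rw [AddSubmonoidClass.coe_finsetSum] at this
      exact this.symm
  refine ⟨lam, _, _, hL, ?_⟩
  exact lawrenceFaces_injective (hL.faceLattice_eq.symm.trans h)

/-! ### Lorentz transformations and Möbius transformations -/

section Lorentz

variable {E : Type*} [NormedAddCommGroup E] [InnerProductSpace ℝ E]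

/-- The Lorentzian form `⟪x, y⟫ - s t` on `E × ℝ`. -/
noncomputable def lorentz (E : Type*) [NormedAddCommGroup E] [InnerProductSpace ℝ E] :
    LinearMap.BilinForm ℝ (E × ℝ) :=
  (innerₗ E).compl₁₂ (LinearMap.fst ℝ E ℝ) (LinearMap.fst ℝ E ℝ) -
    (LinearMap.mul ℝ ℝ).compl₁₂ (LinearMap.snd ℝ E ℝ) (LinearMap.snd ℝ E ℝ)

lemma lorentz_apply (u v : E × ℝ) : lorentz E u v = inner ℝ u.1 v.1 - u.2 * v.2 := rfl

lemma lorentz_comm (u v : E × ℝ) : lorentz E u v = lorentz E v u := by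
  rw [lorentz_apply, lorentz_apply, real_inner_comm, mul_comm]

lemma lorentz_lift {x y : E} (hx : ‖x‖ = 1) (hy : ‖y‖ = 1) :
    lorentz E (lift x) (lift y) = -(dist x y ^ 2 / 2) := by
  rw [lorentz_apply, dist_eq_norm, norm_sub_sq_real, hx, hy]
  simp only [lift]
  ring

lemma lorentz_nondegenerate {z : E × ℝ} (h : ∀ w, lorentz E z w = 0) : z = 0 := by
  have h1 := h (z.1, 0)
  have h2 := h (0, 1)
  simp [lorentz_apply] at h1 h2
  exact Prod.ext h1 h2

/-- The form is positive definite on the orthogonal complement of a timelike vector. -/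
lemma lorentz_pos_of_orthogonal {T z : E × ℝ} (hT : lorentz E T T < 0) (hTz : lorentz E T z = 0)
    (hz : z ≠ 0) : 0 < lorentz E z z := by
  rw [lorentz_apply, real_inner_self_eq_norm_sq] at hT ⊢
  rw [lorentz_apply, sub_eq_zero] at hTz
  have hcs := abs_real_inner_le_norm T.1 z.1
  rw [hTz] at hcs
  have hsq : (T.2 * z.2) ^ 2 ≤ (‖T.1‖ * ‖z.1‖) ^ 2 := by
    rw [← sq_abs]
    exact pow_le_pow_left₀ (abs_nonneg _) hcs 2
  have hT2 : 0 < T.2 ^ 2 := by nlinarith [sq_nonneg ‖T.1‖]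
  by_cases hz1 : z.1 = 0
  · rw [hz1] at hsq
    have : z.2 = 0 := by
      have h0 : T.2 ^ 2 * z.2 ^ 2 ≤ 0 := by simpa [mul_pow] using hsq
      have h1 : z.2 ^ 2 = 0 := le_antisymm (by nlinarith) (sq_nonneg _)
      simpa using h1
    exact absurd (Prod.ext hz1 this) hz
  · have hz1' : 0 < ‖z.1‖ ^ 2 := by positivity
    have h0 : T.2 ^ 2 * z.2 ^ 2 < T.2 ^ 2 * ‖z.1‖ ^ 2 := by
      calc T.2 ^ 2 * z.2 ^ 2 = (T.2 * z.2) ^ 2 := by ring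
        _ ≤ ‖T.1‖ ^ 2 * ‖z.1‖ ^ 2 := by rw [← mul_pow]; exact hsq
        _ < T.2 ^ 2 * ‖z.1‖ ^ 2 := mul_lt_mul_of_pos_right (by nlinarith) hz1'
    have := lt_of_mul_lt_mul_left h0 hT2.le
    nlinarith

end Lorentz

/-- Vectors with the same Gram matrix for a nondegenerate and an arbitrary bilinear form
correspond under a linear isomorphism. -/
theorem exists_linearEquiv_of_gram {L F F' : Type*} [Fintype L] [AddCommGroup F] [Module ℝ F]
    [AddCommGroup F'] [Module ℝ F'] [FiniteDimensional ℝ F] [FiniteDimensional ℝ F']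
    {B : LinearMap.BilinForm ℝ F} {J : LinearMap.BilinForm ℝ F'} {y : L → F} {P : L → F'}
    (hgram : ∀ a b, B (y a) (y b) = J (P a) (P b)) (hB : ∀ z, (∀ w, B z w = 0) → z = 0)
    (hy : Submodule.span ℝ (range y) = ⊤)
    (hdim : Module.finrank ℝ F' ≤ Module.finrank ℝ F) :
    ∃ M : F ≃ₗ[ℝ] F', (∀ a, M (y a) = P a) ∧ ∀ u v, J (M u) (M v) = B u v := by
  classical
  set Y := Fintype.linearCombination ℝ y
  set Q := Fintype.linearCombination ℝ P
  have hY : LinearMap.range Y = ⊤ := by rw [Fintype.range_linearCombination, hy]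
  have hle : LinearMap.ker Q ≤ LinearMap.ker Y := by
    intro c hc
    rw [LinearMap.mem_ker] at hc ⊢
    refine hB _ fun w => ?_
    have hw : w ∈ Submodule.span ℝ (range y) := hy ▸ Submodule.mem_top
    induction hw using Submodule.span_induction with
    | mem w hw =>
      obtain ⟨b, rfl⟩ := hw
      have h0 : J (Q c) (P b) = 0 := by rw [hc]; simp
      simp only [Y, Q, Fintype.linearCombination_apply, map_sum, map_smul, LinearMap.sum_apply,
        LinearMap.smul_apply, hgram] at h0 ⊢
      exact h0
    | zero => simp
    | add u v _ _ hu hv => rw [map_add, hu, hv, add_zero]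
    | smul t u _ hu => rw [map_smul, hu, smul_zero]
  have hrY := LinearMap.finrank_range_add_finrank_ker Y
  have hrQ := LinearMap.finrank_range_add_finrank_ker Q
  rw [hY, finrank_top] at hrY
  have hQle : Module.finrank ℝ (LinearMap.range Q) ≤ Module.finrank ℝ F' :=
    Submodule.finrank_le _
  have hkle := Submodule.finrank_mono hle
  have hker : LinearMap.ker Q = LinearMap.ker Y :=
    Submodule.eq_of_le_of_finrank_eq hle (by omega)
  have hQ : LinearMap.range Q = ⊤ := Submodule.eq_top_of_finrank_eq (by omega)
  suffices ∃ M : F ≃ₗ[ℝ] F', ∀ a, M (y a) = P a by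
    obtain ⟨M, hM⟩ := this
    refine ⟨M, hM, fun u v => ?_⟩
    have h1 : J.compl₁₂ M.toLinearMap M.toLinearMap = B := by
      refine LinearMap.ext_on_range hy fun a => LinearMap.ext_on_range hy fun b => ?_
      simp [hM, hgram]
    rw [← h1]
    rfl
  refine ⟨(Y.quotKerEquivOfSurjective (LinearMap.range_eq_top.1 hY)).symm ≪≫ₗ
    (Submodule.quotEquivOfEq _ _ hker.symm) ≪≫ₗ
    (Q.quotKerEquivOfSurjective (LinearMap.range_eq_top.1 hQ)), fun a => ?_⟩
  have hYa : y a = Y.quotKerEquivOfSurjective (LinearMap.range_eq_top.1 hY)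
      (Submodule.Quotient.mk (Pi.single a 1)) := by
    rw [LinearMap.quotKerEquivOfSurjective_apply_mk]
    simp [Y]
  rw [hYa, LinearEquiv.trans_apply, LinearEquiv.trans_apply, LinearEquiv.symm_apply_apply,
    Submodule.quotEquivOfEq_mk, LinearMap.quotKerEquivOfSurjective_apply_mk]
  simp [Q]

section Moebius

variable {κ : Type*} [Fintype κ]

lemma norm_unitSphere (x : UnitSphere κ) : ‖(x : EuclideanSpace ℝ κ)‖ = 1 :=
  mem_sphere_zero_iff_norm.1 x.2

/-- An inversion that maps the unit sphere to itself and whose centre lies on the sphere is the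
identity there. -/
lemma inversion_eq_self_of_mem {c x : EuclideanSpace ℝ κ} {R : ℝ} (hc : ‖c‖ = 1)
    (hx : ‖x‖ = 1) (hR : 0 < R) (h : ‖EuclideanGeometry.inversion c R x‖ = 1) :
    EuclideanGeometry.inversion c R x = x := by
  by_cases hxc : x = c
  · rw [hxc, EuclideanGeometry.inversion_self]
  have hd : 0 < dist x c := dist_pos.2 hxc
  rw [EuclideanGeometry.inversion, vsub_eq_sub, vadd_eq_add] at h ⊢
  have hk : 0 < (R / dist x c) ^ 2 := by positivity
  generalize (R / dist x c) ^ 2 = k at *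
  have hn : 0 < ‖x - c‖ ^ 2 := by rw [← dist_eq_norm]; positivity
  have h1 : ‖k • (x - c) + c‖ ^ 2 = 1 := by rw [h]; norm_num
  have h2 : inner ℝ (x - c) c = -(‖x - c‖ ^ 2 / 2) := by
    rw [norm_sub_sq_real, inner_sub_left, hx, hc, real_inner_self_eq_norm_sq, hc]
    ring
  rw [norm_add_sq_real, norm_smul, mul_pow, inner_smul_left, h2, hc, Real.norm_eq_abs, sq_abs] at h1
  simp only [conj_trivial] at h1
  have h3 : k * ‖x - c‖ ^ 2 * (k - 1) = 0 := by linarith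
  have h4 : k = 1 := by
    rcases mul_eq_zero.1 h3 with h0 | h0
    · exact absurd h0 (by positivity)
    · linarith
  rw [h4, one_smul, sub_add_cancel]

/-- Möbius transformations are conformal in the strong sense that they multiply every squared
distance by a product of positive factors of the two points. -/
theorem exists_conformal_factor {σ : Equiv.Perm (UnitSphere κ)} (hσ : σ ∈ mobiusGroup κ) :
    ∃ μ : UnitSphere κ → ℝ, (∀ x, 0 < μ x) ∧
      ∀ x y, dist (σ x) (σ y) ^ 2 = μ x * μ y * dist x y ^ 2 := by
  induction hσ using Subgroup.closure_induction with
  | mem σ hσ =>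
    rcases hσ with ⟨u, hu⟩ | ⟨c, R, hR, hc⟩
    · refine ⟨fun _ => 1, fun _ => one_pos, fun x y => ?_⟩
      rw [Subtype.dist_eq, hu, hu, u.dist_map]
      simp [Subtype.dist_eq]
    · by_cases hc1 : ‖c‖ = 1
      · refine ⟨fun _ => 1, fun _ => one_pos, fun x y => ?_⟩
        have hid : ∀ x : UnitSphere κ, (σ x : EuclideanSpace ℝ κ) = x := fun x => by
          rw [hc]
          exact inversion_eq_self_of_mem hc1 (norm_unitSphere x) hR (by
            rw [← hc]; exact norm_unitSphere _)
        rw [Subtype.dist_eq, hid, hid]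
        simp [Subtype.dist_eq]
      · have hne : ∀ x : UnitSphere κ, (x : EuclideanSpace ℝ κ) ≠ c := fun x h0 =>
          hc1 (h0 ▸ norm_unitSphere x)
        have hd : ∀ x : UnitSphere κ, 0 < dist (x : EuclideanSpace ℝ κ) c := fun x =>
          dist_pos.2 (hne x)
        refine ⟨fun x => R ^ 2 / dist (x : EuclideanSpace ℝ κ) c ^ 2, fun x => ?_, fun x y => ?_⟩
        · have := hd x; positivity
        · rw [Subtype.dist_eq, hc, hc, EuclideanGeometry.dist_inversion_inversion (hne x) (hne y),
            Subtype.dist_eq]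
          have := hd x
          have := hd y
          field_simp
  | one => exact ⟨fun _ => 1, fun _ => one_pos, fun x y => by simp⟩
  | mul σ τ _ _ hσ hτ =>
    obtain ⟨μ, hμ, h1⟩ := hσ
    obtain ⟨ν, hν, h2⟩ := hτ
    refine ⟨fun x => μ (τ x) * ν x, fun x => mul_pos (hμ _) (hν _), fun x y => ?_⟩
    rw [Equiv.Perm.mul_apply, Equiv.Perm.mul_apply, h1, h2]
    ring
  | inv σ _ hσ =>
    obtain ⟨μ, hμ, h1⟩ := hσ
    refine ⟨fun x => (μ (σ⁻¹ x))⁻¹, fun x => inv_pos.2 (hμ _), fun x y => ?_⟩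
    have := h1 (σ⁻¹ x) (σ⁻¹ y)
    simp only [Equiv.Perm.coe_inv, Equiv.apply_symm_apply] at this ⊢
    rw [this]
    have := hμ (σ.symm x)
    have := hμ (σ.symm y)
    field_simp

/-- A Lorentz transformation that fixes the time axis is given by an orthogonal map. -/
lemma exists_mobius_of_lorentz_fix {Λ : EuclideanSpace ℝ κ × ℝ →ₗ[ℝ] EuclideanSpace ℝ κ × ℝ}
    (hΛ : ∀ u v, lorentz _ (Λ u) (Λ v) = lorentz _ u v) (hfix : Λ (0, 1) = (0, 1)) :
    ∃ σ ∈ mobiusGroup κ, ∀ (x x' : UnitSphere κ) (m : ℝ),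
      Λ (lift (x : EuclideanSpace ℝ κ)) = m • lift (x' : EuclideanSpace ℝ κ) → σ x = x' := by
  have hsnd : ∀ u : EuclideanSpace ℝ κ, (Λ (u, 0)).2 = 0 := fun u => by
    have := hΛ (u, 0) (0, 1)
    rw [hfix] at this
    simpa [lorentz_apply] using this
  let L : EuclideanSpace ℝ κ →ₗ[ℝ] EuclideanSpace ℝ κ :=
    LinearMap.fst ℝ _ ℝ ∘ₗ Λ ∘ₗ LinearMap.inl ℝ _ ℝ
  have hL : ∀ u, Λ (u, 0) = (L u, 0) := fun u => Prod.ext rfl (hsnd u)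
  have hnorm : ∀ u, ‖L u‖ = ‖u‖ := fun u => by
    have := hΛ (u, 0) (u, 0)
    rw [hL] at this
    simp only [lorentz_apply, real_inner_self_eq_norm_sq, mul_zero, sub_zero] at this
    exact (sq_eq_sq₀ (norm_nonneg _) (norm_nonneg _)).1 this
  let u : EuclideanSpace ℝ κ ≃ₗᵢ[ℝ] EuclideanSpace ℝ κ :=
    LinearIsometry.toLinearIsometryEquiv ⟨L, hnorm⟩ rfl
  have hu : ∀ v, u v = L v := fun v => rfl
  let σ : Equiv.Perm (UnitSphere κ) :=
    { toFun := fun x => ⟨u x, by rw [mem_sphere_zero_iff_norm, u.norm_map, norm_unitSphere]⟩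
      invFun := fun x => ⟨u.symm x, by
        rw [mem_sphere_zero_iff_norm, u.symm.norm_map, norm_unitSphere]⟩
      left_inv := fun x => Subtype.ext (u.symm_apply_apply _)
      right_inv := fun x => Subtype.ext (u.apply_symm_apply _) }
  refine ⟨σ, Subgroup.subset_closure (Or.inl ⟨u, fun x => rfl⟩), fun x x' m h => ?_⟩
  have hx : lift (x : EuclideanSpace ℝ κ) = ((x : EuclideanSpace ℝ κ), (0 : ℝ)) + (0, 1) := by
    simp [lift]
  rw [hx, map_add, hfix, hL] at h
  have h1 := congrArg Prod.fst h
  have h2 := congrArg Prod.snd h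
  simp [lift] at h1 h2
  apply Subtype.ext
  change u x = x'
  rw [hu, h1, ← h2, one_smul]

/-- The inversion in a sphere orthogonal to the unit sphere restricts to a Möbius transformation
that is the projective action of a Lorentz reflection. -/
lemma exists_mobius_reflection {c : EuclideanSpace ℝ κ} {R : ℝ} (hR : 0 < R)
    (hc : ‖c‖ ^ 2 = 1 + R ^ 2) :
    ∃ τ ∈ mobiusGroup κ, ∀ x : UnitSphere κ, ∃ m : ℝ, lift (x : EuclideanSpace ℝ κ) -
      (2 / R ^ 2 * lorentz _ (lift (x : EuclideanSpace ℝ κ)) (lift c)) • lift c =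
        m • lift (τ x : EuclideanSpace ℝ κ) := by
  have hne : ∀ x : UnitSphere κ, (x : EuclideanSpace ℝ κ) ≠ c := fun x h0 => by
    rw [← h0, norm_unitSphere] at hc
    nlinarith
  have hinner : ∀ x : UnitSphere κ, 2 * inner ℝ (x : EuclideanSpace ℝ κ) c =
      2 + R ^ 2 - dist (x : EuclideanSpace ℝ κ) c ^ 2 := fun x => by
    rw [dist_eq_norm, norm_sub_sq_real, hc, norm_unitSphere]; ring
  have hmem : ∀ x : UnitSphere κ,
      EuclideanGeometry.inversion c R (x : EuclideanSpace ℝ κ) ∈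
        Metric.sphere (0 : EuclideanSpace ℝ κ) 1 := fun x => by
    have hd : 0 < dist (x : EuclideanSpace ℝ κ) c := dist_pos.2 (hne x)
    have hi := hinner x
    rw [mem_sphere_zero_iff_norm, ← sq_eq_sq₀ (norm_nonneg _) zero_le_one,
      EuclideanGeometry.inversion, vsub_eq_sub, vadd_eq_add, norm_add_sq_real, norm_smul, mul_pow,
      inner_smul_left, inner_sub_left, real_inner_self_eq_norm_sq, hc, ← dist_eq_norm,
      Real.norm_eq_abs, sq_abs]
    simp only [conj_trivial]
    generalize inner ℝ (x : EuclideanSpace ℝ κ) c = p at *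
    generalize dist (x : EuclideanSpace ℝ κ) c = d at *
    have hp : p = (2 + R ^ 2 - d ^ 2) / 2 := by linarith
    rw [hp]
    field_simp
    ring
  let τ : Equiv.Perm (UnitSphere κ) :=
    Function.Involutive.toPerm (fun x => ⟨_, hmem x⟩) fun x =>
      Subtype.ext (EuclideanGeometry.inversion_inversion c hR.ne' _)
  refine ⟨τ, Subgroup.subset_closure (Or.inr ⟨c, R, hR, fun x => rfl⟩), fun x =>
    ⟨dist (x : EuclideanSpace ℝ κ) c ^ 2 / R ^ 2, ?_⟩⟩
  have hd : 0 < dist (x : EuclideanSpace ℝ κ) c := dist_pos.2 (hne x)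
  have hi := hinner x
  have hJ : 2 / R ^ 2 * lorentz _ (lift (x : EuclideanSpace ℝ κ)) (lift c) =
      1 - dist (x : EuclideanSpace ℝ κ) c ^ 2 / R ^ 2 := by
    rw [lorentz_apply]
    simp only [lift]
    field_simp
    linarith
  rw [hJ]
  refine Prod.ext ?_ (by simp [lift])
  change (x : EuclideanSpace ℝ κ) - _ • c =
    _ • ((R / dist (x : EuclideanSpace ℝ κ) c) ^ 2 • ((x : EuclideanSpace ℝ κ) - c) + c)
  rw [smul_add, smul_smul]
  have : dist (x : EuclideanSpace ℝ κ) c ^ 2 / R ^ 2 * (R / dist (x : EuclideanSpace ℝ κ) c) ^ 2 =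
      1 := by field_simp
  rw [this, one_smul]
  module

/-- Lorentz transformations act on the unit sphere, the projectivized light cone, by Möbius
transformations. -/
theorem exists_mobius_of_lorentz {Λ : EuclideanSpace ℝ κ × ℝ →ₗ[ℝ] EuclideanSpace ℝ κ × ℝ}
    (hΛ : ∀ u v, lorentz _ (Λ u) (Λ v) = lorentz _ u v) {x₀ x₀' : UnitSphere κ} {m₀ : ℝ}
    (hm₀ : 0 < m₀) (h₀ : Λ (lift (x₀ : EuclideanSpace ℝ κ)) = m₀ • lift (x₀' : EuclideanSpace ℝ κ)) :
    ∃ σ ∈ mobiusGroup κ, ∀ (x x' : UnitSphere κ) (m : ℝ),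
      Λ (lift (x : EuclideanSpace ℝ κ)) = m • lift (x' : EuclideanSpace ℝ κ) → σ x = x' := by
  set a := (Λ (0, 1)).1 with ha
  set α := (Λ (0, 1)).2 with hα
  have hΛe : Λ (0, 1) = (a, α) := rfl
  have hsq : ‖a‖ ^ 2 = α ^ 2 - 1 := by
    have := hΛ (0, 1) (0, 1)
    rw [hΛe] at this
    simp only [lorentz_apply, real_inner_self_eq_norm_sq, norm_zero] at this
    linarith
  have hαpos : 0 < α := by
    have := hΛ (0, 1) (lift (x₀ : EuclideanSpace ℝ κ))
    rw [hΛe, h₀] at this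
    simp only [lorentz_apply, lift, inner_zero_left, Prod.smul_fst, Prod.smul_snd,
      inner_smul_right, smul_eq_mul] at this
    have h1 := abs_real_inner_le_norm a (x₀' : EuclideanSpace ℝ κ)
    rw [norm_unitSphere, mul_one] at h1
    by_contra hneg
    have h3 : ‖a‖ ≤ -α := abs_le_of_sq_le_sq' (by nlinarith) (by linarith) |>.2
    have h4 := neg_abs_le (inner ℝ a (x₀' : EuclideanSpace ℝ κ))
    have h5 : 0 ≤ m₀ * (inner ℝ a (x₀' : EuclideanSpace ℝ κ) - α) :=
      mul_nonneg hm₀.le (by linarith)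
    linarith
  by_cases ha0 : a = 0
  · rw [ha0] at hsq
    have : α = 1 := by
      simp at hsq
      nlinarith
    exact exists_mobius_of_lorentz_fix hΛ (by rw [hΛe, ha0, this])
  · have hα1 : 0 < α - 1 := by
      have : 0 < ‖a‖ ^ 2 := by positivity
      nlinarith
    -- the reflection in the difference of `(a, α)` and the time axis interchanges the two
    set c : EuclideanSpace ℝ κ := (α - 1)⁻¹ • a
    set R := Real.sqrt (2 / (α - 1))
    have hR : 0 < R := Real.sqrt_pos.2 (by positivity)
    have hR2 : R ^ 2 = 2 / (α - 1) := Real.sq_sqrt (by positivity)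
    have hc : ‖c‖ ^ 2 = 1 + R ^ 2 := by
      rw [hR2, norm_smul, mul_pow, hsq, Real.norm_eq_abs, sq_abs]
      field_simp
      ring
    obtain ⟨τ, hτ, hτ'⟩ := exists_mobius_reflection hR hc
    let ρ : EuclideanSpace ℝ κ × ℝ →ₗ[ℝ] EuclideanSpace ℝ κ × ℝ :=
      LinearMap.id - (2 / R ^ 2) • ((lorentz _).flip (lift c)).smulRight (lift c)
    have hρ : ∀ v, ρ v = v - (2 / R ^ 2 * lorentz _ v (lift c)) • lift c := fun v => by
      simp [ρ, smul_smul]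
    have hcc : lorentz _ (lift c) (lift c) = R ^ 2 := by
      rw [lorentz_apply]
      simp only [lift, real_inner_self_eq_norm_sq, hc]
      ring
    have hρJ : ∀ u v, lorentz _ (ρ u) (ρ v) = lorentz _ u v := fun u v => by
      rw [hρ, hρ]
      simp only [map_sub, map_smul, LinearMap.sub_apply, LinearMap.smul_apply, smul_eq_mul, hcc,
        lorentz_comm (lift c) v]
      field_simp
      ring
    have hfix : (ρ ∘ₗ Λ) (0, 1) = (0, 1) := by
      rw [LinearMap.comp_apply, hΛe, hρ]
      have : lorentz _ (a, α) (lift c) = 1 := by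
        rw [lorentz_apply]
        simp only [lift, c, inner_smul_right, real_inner_self_eq_norm_sq, hsq]
        field_simp
        ring
      rw [this, hR2]
      refine Prod.ext ?_ ?_
      · simp only [lift, c, Prod.fst_sub, Prod.smul_fst, smul_smul]
        have : 2 / (2 / (α - 1)) * 1 * (α - 1)⁻¹ = 1 := by field_simp
        rw [this, one_smul, sub_self]
      · simp only [lift, Prod.snd_sub, Prod.smul_snd, smul_eq_mul]
        field_simp
        ring
    obtain ⟨σ, hσ, hσ'⟩ := exists_mobius_of_lorentz_fix (Λ := ρ ∘ₗ Λ)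
      (fun u v => by rw [LinearMap.comp_apply, LinearMap.comp_apply, hρJ, hΛ]) hfix
    refine ⟨τ⁻¹ * σ, mul_mem (inv_mem hτ) hσ, fun x x' m h => ?_⟩
    obtain ⟨m', hm'⟩ := hτ' x'
    rw [Equiv.Perm.mul_apply, Equiv.Perm.inv_eq_iff_eq]
    refine hσ' x (τ x') (m * m') ?_
    rw [LinearMap.comp_apply, h, map_smul, hρ, hm', smul_smul]

end Moebius

/-! ### Charts and marked forms -/

/-- The realizations of the oriented matroid of `A` in which the vectors with labels `b` form the
standard basis. -/
def chart {ι : Type*} (A : ι → EuclideanSpace ℝ (Fin 2)) (b : Fin 3 → ι) :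
    Set (ι → Fin 3 → ℝ) :=
  {V | V ∈ omRealizations A ∧ ∀ r, V (b r) = Pi.single r 1}

lemma of_chart {ι : Type*} {A : ι → EuclideanSpace ℝ (Fin 2)} {b : Fin 3 → ι}
    {V : ι → Fin 3 → ℝ} (hV : V ∈ chart A b) : (Matrix.of fun k => V (b k)) = 1 := by
  ext r s
  rw [Matrix.of_apply, hV.2, Matrix.one_apply, Pi.single_apply]
  simp [eq_comm]

lemma chirotope_chart {ι : Type*} {A : ι → EuclideanSpace ℝ (Fin 2)} {b : Fin 3 → ι}
    {V : ι → Fin 3 → ℝ} (hV : V ∈ chart A b) : chirotope V b = 1 := by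
  rw [chirotope, of_chart hV, det_one, sign_one]

lemma chirotope_homogenization_ne_zero {ι : Type*} {A : ι → EuclideanSpace ℝ (Fin 2)}
    {V : ι → Fin 3 → ℝ} (hV : V ∈ omRealizations A) (t : Fin 3 → ι) :
    chirotope V t ≠ 0 ↔ chirotope (homogenization A) t ≠ 0 := by
  rcases hV with h | h
  · rw [h t]
  · rw [h t]
    generalize chirotope (homogenization A) t = s
    revert s; decide

lemma chirotope_rescale {ι : Type*} (V : ι → Fin 3 → ℝ) {u : ι → ℝ} {g : Fin 3 → ℝ}
    (hu : ∀ i, 0 < u i) (hg : ∀ r, 0 < g r) (t : Fin 3 → ι) :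
    chirotope (fun i r => u i * (g r * V i r)) t = chirotope V t := by
  have h1 : Matrix.det (Matrix.of fun k r => u (t k) * (g r * V (t k) r)) =
      (∏ k, u (t k)) * ((∏ r, g r) * Matrix.det (Matrix.of fun k r => V (t k) r)) := by
    rw [← Matrix.det_mul_row, ← Matrix.det_mul_column]
    rfl
  have h2 : 0 < ∏ k, u (t k) := Finset.prod_pos fun k _ => hu _
  have h3 : 0 < ∏ r, g r := Finset.prod_pos fun k _ => hg _
  change SignType.sign (Matrix.det (Matrix.of fun k r => u (t k) * (g r * V (t k) r))) = _
  rw [h1, sign_mul, sign_mul, sign_pos h2, sign_pos h3, one_mul, one_mul]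
  rfl

lemma rescale_mem_omRealizations {ι : Type*} {A : ι → EuclideanSpace ℝ (Fin 2)}
    {V : ι → Fin 3 → ℝ} (hV : V ∈ omRealizations A) {u : ι → ℝ} {g : Fin 3 → ℝ}
    (hu : ∀ i, 0 < u i) (hg : ∀ r, 0 < g r) :
    (fun i r => u i * (g r * V i r)) ∈ omRealizations A := by
  rcases hV with h | h
  · exact Or.inl fun t => by rw [chirotope_rescale V hu hg, h]
  · exact Or.inr fun t => by rw [chirotope_rescale V hu hg, h]

section MarkedForms

variable {ι : Type*} [Fintype ι] [DecidableEq ι]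

/-- Homogeneous coordinates for the vertices of a Lawrence polytope over the vector configuration
`V`: the vectors `(V i, e i)` and `(-V i, e i)` in `ℝ³ × ℝ^ι`. -/
def vertexVec (V : ι → Fin 3 → ℝ) : ι ⊕ ι → Fin 3 ⊕ ι → ℝ
  | Sum.inl i => Sum.elim (V i) (Pi.single i 1)
  | Sum.inr i => Sum.elim (-V i) (Pi.single i 1)

/-- The linear functional on `ℝ³ × ℝ^ι` that is `h` on the first factor and the sum of the
coordinates on the second one. -/
def heightVec (h : Fin 3 → ℝ) : Fin 3 ⊕ ι → ℝ := Sum.elim h 1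

/-- A symmetric form `B` on `ℝ³ × ℝ^ι` that vanishes at the vertex vectors and is positive definite
on the kernel of a functional that is positive at the vertex vectors. In the affine chart in which
that kernel is the hyperplane at infinity, `B = 0` is an ellipsoid through the vertices. -/
structure IsMarked (V : ι → Fin 3 → ℝ) (B : Matrix (Fin 3 ⊕ ι) (Fin 3 ⊕ ι) ℝ)
    (h : Fin 3 → ℝ) : Prop where
  height_lt : ∀ i, |h ⬝ᵥ V i| < 1
  symm : B.IsSymm
  null : ∀ a, vertexVec V a ⬝ᵥ B *ᵥ vertexVec V a = 0
  pos : ∀ x, x ≠ 0 → heightVec h ⬝ᵥ x = 0 → 0 < x ⬝ᵥ B *ᵥ x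

lemma height_inl (V : ι → Fin 3 → ℝ) (h : Fin 3 → ℝ) (i : ι) :
    heightVec h ⬝ᵥ vertexVec V (Sum.inl i) = 1 + h ⬝ᵥ V i := by
  simp [heightVec, vertexVec, dotProduct, Fintype.sum_sum_type, add_comm]

lemma height_inr (V : ι → Fin 3 → ℝ) (h : Fin 3 → ℝ) (i : ι) :
    heightVec h ⬝ᵥ vertexVec V (Sum.inr i) = 1 - h ⬝ᵥ V i := by
  simp [heightVec, vertexVec, dotProduct, Fintype.sum_sum_type]
  ring

/-- The coefficient of the Euclidean norm in `standardForm`. -/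
noncomputable def standardCoeff (V : ι → Fin 3 → ℝ) (h : Fin 3 → ℝ) : ℝ :=
  (∏ i, (1 - (h ⬝ᵥ V i) ^ 2)) / (1 + ∑ i, V i ⬝ᵥ V i)

/-- An explicit form marked by `h`. On the kernel of `heightVec h` the two squares `(h ⬝ᵥ w) ^ 2`
and `(∑ i, x i) ^ 2` cancel, and a positive diagonal form remains. -/
noncomputable def standardForm (V : ι → Fin 3 → ℝ) (h : Fin 3 → ℝ) :
    Matrix (Fin 3 ⊕ ι) (Fin 3 ⊕ ι) ℝ :=
  vecMulVec (Sum.elim h 0) (Sum.elim h 0) - vecMulVec (Sum.elim 0 1) (Sum.elim 0 1) +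
    Matrix.diagonal (Sum.elim (fun _ => standardCoeff V h)
      fun i => 1 - (h ⬝ᵥ V i) ^ 2 - standardCoeff V h * (V i ⬝ᵥ V i))

lemma standardForm_apply (V : ι → Fin 3 → ℝ) (h w : Fin 3 → ℝ) (x : ι → ℝ) :
    Sum.elim w x ⬝ᵥ standardForm V h *ᵥ Sum.elim w x =
      (h ⬝ᵥ w) ^ 2 - (∑ i, x i) ^ 2 + (standardCoeff V h * (w ⬝ᵥ w) +
        ∑ i, (1 - (h ⬝ᵥ V i) ^ 2 - standardCoeff V h * (V i ⬝ᵥ V i)) * x i ^ 2) := by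
  rw [standardForm, add_mulVec, sub_mulVec, vecMulVec_mulVec, vecMulVec_mulVec, dotProduct_add,
    dotProduct_sub]
  congr 1
  · simp [sumElim_dotProduct_sumElim, dotProduct_comm w h, sq, one_dotProduct, dotProduct_one]
  · simp only [mulVec_diagonal, dotProduct, Fintype.sum_sum_type, Sum.elim_inl, Sum.elim_inr,
      Finset.mul_sum]
    congr 1 <;> exact Finset.sum_congr rfl fun _ _ => by ring

lemma standardCoeff_pos {V : ι → Fin 3 → ℝ} {h : Fin 3 → ℝ} (hh : ∀ i, |h ⬝ᵥ V i| < 1) :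
    0 < standardCoeff V h ∧
      ∀ i, 0 < 1 - (h ⬝ᵥ V i) ^ 2 - standardCoeff V h * (V i ⬝ᵥ V i) := by
  have h1 : ∀ i, 0 < 1 - (h ⬝ᵥ V i) ^ 2 := fun i => by
    have := (sq_lt_one_iff_abs_lt_one _).2 (hh i)
    linarith
  have h2 : ∀ i, 0 ≤ V i ⬝ᵥ V i := fun i => Finset.sum_nonneg fun r _ => mul_self_nonneg _
  have h3 : 0 ≤ ∑ i, V i ⬝ᵥ V i := Finset.sum_nonneg fun i _ => h2 i
  have h4 : 0 < ∏ i, (1 - (h ⬝ᵥ V i) ^ 2) := Finset.prod_pos fun i _ => h1 i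
  refine ⟨div_pos h4 (by linarith), fun i => ?_⟩
  have h5 : ∏ j, (1 - (h ⬝ᵥ V j) ^ 2) ≤ 1 - (h ⬝ᵥ V i) ^ 2 := by
    rw [← Finset.mul_prod_erase _ _ (Finset.mem_univ i)]
    exact mul_le_of_le_one_right (h1 i).le (Finset.prod_le_one (fun j _ => (h1 j).le)
      fun j _ => by linarith [sq_nonneg (h ⬝ᵥ V j)])
  have h6 : V i ⬝ᵥ V i ≤ ∑ i, V i ⬝ᵥ V i :=
    Finset.single_le_sum (f := fun i => V i ⬝ᵥ V i) (fun j _ => h2 j) (Finset.mem_univ i)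
  rw [standardCoeff, div_mul_eq_mul_div, sub_pos, div_lt_iff₀ (by linarith)]
  calc _ ≤ (1 - (h ⬝ᵥ V i) ^ 2) * (V i ⬝ᵥ V i) := mul_le_mul_of_nonneg_right h5 (h2 i)
    _ < _ := mul_lt_mul_of_pos_left (by linarith) (h1 i)

theorem isMarked_standardForm {V : ι → Fin 3 → ℝ} {h : Fin 3 → ℝ} (hh : ∀ i, |h ⬝ᵥ V i| < 1) :
    IsMarked V (standardForm V h) h where
  height_lt := hh
  symm := by
    rw [standardForm]
    refine IsSymm.add (IsSymm.sub ?_ ?_) (isSymm_diagonal _) <;>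
    · ext i j
      simp [vecMulVec_apply, mul_comm]
  null := by
    have h1 : ∀ (c : ι → ℝ) (i : ι), ∑ j, c j * (Pi.single i 1 : ι → ℝ) j ^ 2 = c i := by
      intro c i
      rw [Finset.sum_eq_single i (fun j _ hj => by simp [hj]) (by simp)]
      simp
    rintro (i | i) <;>
    · rw [vertexVec, standardForm_apply, h1, Fintype.sum_pi_single']
      simp
  pos x hx hx0 := by
    obtain ⟨hδ, hD⟩ := standardCoeff_pos hh
    obtain ⟨w, y, rfl⟩ : ∃ w y, x = Sum.elim w y := ⟨_, _, (Sum.elim_comp_inl_inr x).symm⟩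
    rw [heightVec, sumElim_dotProduct_sumElim, one_dotProduct] at hx0
    rw [standardForm_apply, show h ⬝ᵥ w = -∑ i, y i by linarith, neg_sq, sub_self, zero_add]
    by_cases hw : w = 0
    · have hy : y ≠ 0 := by
        rintro rfl
        exact hx (by rw [hw]; ext (i | i) <;> rfl)
      obtain ⟨i, hi⟩ := Function.ne_iff.1 hy
      refine add_pos_of_nonneg_of_pos (by simp [hw]) (Finset.sum_pos' (fun j _ =>
        mul_nonneg (hD j).le (sq_nonneg _)) ⟨i, Finset.mem_univ i, ?_⟩)
      have : y i ≠ 0 := hi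
      have := hD i
      positivity
    · refine add_pos_of_pos_of_nonneg (mul_pos hδ ?_) (Finset.sum_nonneg fun j _ =>
        mul_nonneg (hD j).le (sq_nonneg _))
      obtain ⟨r, hr⟩ := Function.ne_iff.1 hw
      exact Finset.sum_pos' (fun j _ => mul_self_nonneg _)
        ⟨r, Finset.mem_univ r, mul_self_pos.2 hr⟩

lemma IsMarked.convex {V : ι → Fin 3 → ℝ} {B B' : Matrix (Fin 3 ⊕ ι) (Fin 3 ⊕ ι) ℝ}
    {h : Fin 3 → ℝ} (hB : IsMarked V B h) (hB' : IsMarked V B' h) {s t : ℝ} (hs : 0 ≤ s)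
    (ht : 0 ≤ t) (hst : s + t = 1) : IsMarked V (s • B + t • B') h where
  height_lt := hB.height_lt
  symm := (hB.symm.smul s).add (hB'.symm.smul t)
  null a := by
    simp only [add_mulVec, smul_mulVec, dotProduct_add, dotProduct_smul, hB.null, hB'.null]
    simp
  pos x hx hx0 := by
    simp only [add_mulVec, smul_mulVec, dotProduct_add, dotProduct_smul, smul_eq_mul]
    have h1 := hB.pos x hx hx0
    have h2 := hB'.pos x hx hx0
    rcases hs.lt_or_eq with hs | rfl
    · nlinarith [mul_pos hs h1, mul_nonneg ht h2.le]
    · have : t = 1 := by linarith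
      subst this
      linarith

lemma IsMarked.height_pos {V : ι → Fin 3 → ℝ} {B : Matrix (Fin 3 ⊕ ι) (Fin 3 ⊕ ι) ℝ}
    {h : Fin 3 → ℝ} (hB : IsMarked V B h) (a : ι ⊕ ι) : 0 < heightVec h ⬝ᵥ vertexVec V a := by
  rcases a with i | i
  · rw [height_inl]; linarith [(abs_lt.1 (hB.height_lt i)).1]
  · rw [height_inr]; linarith [(abs_lt.1 (hB.height_lt i)).2]

lemma IsSymm_dotProduct_comm {κ : Type*} [Fintype κ] {B : Matrix κ κ ℝ} (hB : B.IsSymm)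
    (x y : κ → ℝ) : x ⬝ᵥ B *ᵥ y = y ⬝ᵥ B *ᵥ x := by
  rw [dotProduct_mulVec, dotProduct_comm, ← mulVec_transpose, hB.eq]

/-- A vector in the kernel of `B` would be parallel to all vertex vectors, of which `vertexVec V a`
for `a = inl i` and `a = inr i` are not parallel to each other if `V i ≠ 0`. -/
lemma IsMarked.det_ne_zero {V : ι → Fin 3 → ℝ} {B : Matrix (Fin 3 ⊕ ι) (Fin 3 ⊕ ι) ℝ}
    {h : Fin 3 → ℝ} (hB : IsMarked V B h) (hV : ∃ i, V i ≠ 0) : B.det ≠ 0 := by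
  intro hdet
  obtain ⟨z, hz, hBz⟩ := exists_mulVec_eq_zero_iff.2 hdet
  have hz0 : heightVec h ⬝ᵥ z ≠ 0 := fun h0 => by
    have := hB.pos z hz h0
    rw [hBz, dotProduct_zero] at this
    exact this.false
  have hpar : ∀ a, (heightVec h ⬝ᵥ z) • vertexVec V a = (heightVec h ⬝ᵥ vertexVec V a) • z := by
    intro a
    by_contra hne
    have := hB.pos _ (sub_ne_zero.2 hne) (by
      rw [dotProduct_sub, dotProduct_smul, dotProduct_smul, smul_eq_mul, smul_eq_mul, mul_comm,
        sub_self])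
    rw [mulVec_sub, mulVec_smul, mulVec_smul, hBz, smul_zero, sub_zero, sub_dotProduct,
      smul_dotProduct, smul_dotProduct, dotProduct_smul, dotProduct_smul, hB.null,
      IsSymm_dotProduct_comm hB.symm, hBz] at this
    simp at this
  obtain ⟨i, hi⟩ := hV
  have e1 := hpar (Sum.inl i)
  have e2 := hpar (Sum.inr i)
  have p1 := hB.height_pos (Sum.inl i)
  have p2 := hB.height_pos (Sum.inr i)
  have hzi : z (Sum.inr i) ≠ 0 := fun h0 => by
    have := congrFun e1 (Sum.inr i)
    simp [vertexVec, h0] at this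
    exact hz0 this
  have q1 := congrFun e1 (Sum.inr i)
  have q2 := congrFun e2 (Sum.inr i)
  simp only [vertexVec, Pi.smul_apply, Sum.elim_inr, Pi.single_eq_same, smul_eq_mul] at q1 q2
  apply hi
  ext r
  have r1 := congrFun e1 (Sum.inl r)
  have r2 := congrFun e2 (Sum.inl r)
  simp only [vertexVec, Pi.smul_apply, Sum.elim_inl, Pi.neg_apply, smul_eq_mul] at r1 r2
  have h3 : heightVec h ⬝ᵥ vertexVec V (Sum.inl i) = heightVec h ⬝ᵥ vertexVec V (Sum.inr i) :=
    mul_right_cancel₀ hzi (q1.symm.trans q2)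
  simp only [vertexVec] at h3
  rw [h3] at r1
  have : heightVec h ⬝ᵥ z * V i r = 0 := by linarith
  exact (mul_eq_zero.1 this).resolve_left hz0

/-- A positive definite form on a space of dimension `card κ` is the Euclidean inner product in
suitable coordinates. -/
lemma exists_isometry {K κ : Type*} [Fintype κ] [AddCommGroup K] [Module ℝ K]
    [FiniteDimensional ℝ K] (β : LinearMap.BilinForm ℝ K) (hsymm : ∀ x y, β x y = β y x)
    (hpos : ∀ x, x ≠ 0 → 0 < β x x) (hdim : Module.finrank ℝ K = Fintype.card κ) :
    ∃ m : K →ₗ[ℝ] EuclideanSpace ℝ κ, ∀ x y, inner ℝ (m x) (m y) = β x y := by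
  let core : InnerProductSpace.Core ℝ K :=
    { inner := fun x y => β x y
      conj_inner_symm := fun x y => hsymm y x
      re_inner_nonneg := fun x => by
        by_cases hx : x = 0
        · simp [hx]
        · exact (hpos x hx).le
      definite := fun x hx => by
        by_contra h0
        exact (hpos x h0).ne' hx
      add_left := fun x y z => by simp
      smul_left := fun x y r => by simp }
  let _ : NormedAddCommGroup K := core.toNormedAddCommGroup
  let _ : InnerProductSpace ℝ K := InnerProductSpace.ofCore core.toCore
  let e := ((stdOrthonormalBasis ℝ K).reindex
    (Fintype.equivOfCardEq (by simpa using hdim) : Fin (Module.finrank ℝ K) ≃ κ)).repr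
  exact ⟨e.toLinearEquiv.toLinearMap, fun x y => e.inner_map_map x y⟩

/-- The value at `heightVec h` of the form dual to `B`; its negative is the inverse of the squared
radius of the ellipsoid `B = 0` in the affine chart given by `h`, measured in the metric that `B`
induces on the kernel of `heightVec h`. -/
noncomputable def dualHeight (B : Matrix (Fin 3 ⊕ ι) (Fin 3 ⊕ ι) ℝ) (h : Fin 3 → ℝ) : ℝ :=
  heightVec h ⬝ᵥ B⁻¹ *ᵥ heightVec h

lemma IsMarked.dualHeight_neg {V : ι → Fin 3 → ℝ} {B : Matrix (Fin 3 ⊕ ι) (Fin 3 ⊕ ι) ℝ}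
    {h : Fin 3 → ℝ} (hB : IsMarked V B h) (hV : ∃ i, V i ≠ 0) : dualHeight B h < 0 := by
  have hdet : IsUnit B.det := (hB.det_ne_zero hV).isUnit
  set τ := B⁻¹ *ᵥ heightVec h with hτ
  have hBτ : B *ᵥ τ = heightVec h := by rw [hτ, mulVec_mulVec, mul_nonsing_inv _ hdet, one_mulVec]
  have hq : dualHeight B h = heightVec h ⬝ᵥ τ := rfl
  obtain ⟨i, hi⟩ := hV
  by_contra! hneg
  rcases hneg.lt_or_eq with hpos | h0
  · -- otherwise `B` would be positive definite, but it has null vectors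
    set a : ι ⊕ ι := Sum.inl i
    have hH := hB.height_pos a
    set c := heightVec h ⬝ᵥ vertexVec V a / dualHeight B h
    have hc : 0 < c := div_pos hH hpos
    have hk : heightVec h ⬝ᵥ (vertexVec V a - c • τ) = 0 := by
      rw [dotProduct_sub, dotProduct_smul, ← hq, smul_eq_mul, div_mul_cancel₀ _ hpos.ne', sub_self]
    have h1 : (vertexVec V a - c • τ) ⬝ᵥ B *ᵥ (vertexVec V a - c • τ) =
        - (c ^ 2 * dualHeight B h) := by
      rw [mulVec_sub, dotProduct_sub, mulVec_smul, hBτ, dotProduct_smul,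
        dotProduct_comm _ (heightVec h), hk, sub_dotProduct, hB.null, smul_dotProduct,
        IsSymm_dotProduct_comm hB.symm, hBτ, dotProduct_comm]
      simp only [c, smul_eq_mul]
      field_simp
      ring
    by_cases hne : vertexVec V a - c • τ = 0
    · rw [hne] at h1
      simp only [zero_dotProduct] at h1
      have : 0 < c ^ 2 * dualHeight B h := by positivity
      linarith
    · have := hB.pos _ hne hk
      have : 0 < c ^ 2 * dualHeight B h := by positivity
      linarith
  · have hτ0 : τ ≠ 0 := fun h1 => by
      rw [h1, mulVec_zero] at hBτ
      have := congrFun hBτ (Sum.inr i)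
      simp [heightVec] at this
    have := hB.pos τ hτ0 (hq ▸ h0.symm)
    rw [hBτ, dotProduct_comm, ← hq, ← h0] at this
    exact this.false

end MarkedForms

/-! ### Inscribed polytopes from marked forms -/

section Realization

variable {ι : Type*} [Fintype ι] [DecidableEq ι]

omit [Fintype ι] in
lemma vertexVec_sub (V : ι → Fin 3 → ℝ) (i : ι) :
    vertexVec V (Sum.inl i) - vertexVec V (Sum.inr i) =
      ∑ r, V i r • ((2 : ℝ) • Pi.single (Sum.inl r) 1 : Fin 3 ⊕ ι → ℝ) := by
  ext (s | j)
  · simp only [vertexVec, Pi.sub_apply, Sum.elim_inl, Pi.neg_apply, Finset.sum_apply,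
      Pi.smul_apply, smul_eq_mul, Pi.single_apply, Sum.inl.injEq]
    simp
    ring
  · simp [vertexVec, Pi.single_apply]

lemma span_vertexVec {V : ι → Fin 3 → ℝ} {b : Fin 3 → ι} (hb : ∀ r, V (b r) = Pi.single r 1) :
    Submodule.span ℝ (range (vertexVec V)) = ⊤ := by
  have hmem : ∀ a, vertexVec V a ∈ Submodule.span ℝ (range (vertexVec V)) := fun a =>
    Submodule.subset_span ⟨a, rfl⟩
  rw [eq_top_iff, ← (Pi.basisFun ℝ (Fin 3 ⊕ ι)).span_eq, Submodule.span_le]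
  rintro _ ⟨r | i, rfl⟩
  · have h1 : (Pi.basisFun ℝ (Fin 3 ⊕ ι)) (Sum.inl r) =
        (1 / 2 : ℝ) • (vertexVec V (Sum.inl (b r)) - vertexVec V (Sum.inr (b r))) := by
      rw [vertexVec_sub, Finset.sum_eq_single r]
      · rw [hb]; simp [smul_smul]
      · intro s _ hs; rw [hb]; simp [hs]
      · simp
    rw [h1]
    exact Submodule.smul_mem _ _ (Submodule.sub_mem _ (hmem _) (hmem _))
  · have h1 : (Pi.basisFun ℝ (Fin 3 ⊕ ι)) (Sum.inr i) =
        (1 / 2 : ℝ) • (vertexVec V (Sum.inl i) + vertexVec V (Sum.inr i)) := by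
      ext (s | j)
      · simp [vertexVec]
      · simp only [vertexVec, Pi.basisFun_apply, Pi.smul_apply, Pi.add_apply, Sum.elim_inr,
          smul_eq_mul, Pi.single_apply, Sum.inr.injEq]
        split_ifs <;> norm_num
    rw [h1]
    exact Submodule.smul_mem _ _ (Submodule.add_mem _ (hmem _) (hmem _))

/-- The points `X` on the unit sphere have, up to positive scaling of their homogeneous
coordinates, the same Gram matrix for the Lorentzian form as the vertex vectors for `B`. -/
def Realizes (X : ι ⊕ ι → UnitSphere (Fin 2 ⊕ ι)) (V : ι → Fin 3 → ℝ)
    (B : Matrix (Fin 3 ⊕ ι) (Fin 3 ⊕ ι) ℝ) : Prop :=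
  ∃ ρ : ι ⊕ ι → ℝ, (∀ a, 0 < ρ a) ∧ ∀ a c,
    dist (X a) (X c) ^ 2 = -(ρ a * ρ c * (vertexVec V a ⬝ᵥ B *ᵥ vertexVec V c))

variable {A : ι → EuclideanSpace ℝ (Fin 2)} {b : Fin 3 → ι} {V : ι → Fin 3 → ℝ}
  {B : Matrix (Fin 3 ⊕ ι) (Fin 3 ⊕ ι) ℝ} {h : Fin 3 → ℝ}
  {X : ι ⊕ ι → UnitSphere (Fin 2 ⊕ ι)}

omit [Fintype ι] [DecidableEq ι] in
lemma exists_ne_zero_of_mem_chart (hV : V ∈ chart A b) : ∃ i, V i ≠ 0 :=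
  ⟨b 0, fun h0 => by simpa [hV.2 0] using congrFun h0 0⟩

/-- A realization identifies `B` with the Lorentzian form, up to the factor `1 / 2` from
`lorentz_lift`, and the vertex vectors with positive multiples of the homogeneous vectors. -/
lemma Realizes.exists_linearEquiv (hX : Realizes X V B) (hB : IsMarked V B h)
    (hV : V ∈ chart A b) :
    ∃ (M : (Fin 3 ⊕ ι → ℝ) ≃ₗ[ℝ] EuclideanSpace ℝ (Fin 2 ⊕ ι) × ℝ) (ρ : ι ⊕ ι → ℝ),
      (∀ a, 0 < ρ a) ∧
      (∀ a, lift (X a : EuclideanSpace ℝ (Fin 2 ⊕ ι)) = ρ a • M (vertexVec V a)) ∧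
      ∀ u v, lorentz _ (M u) (M v) = (1 / 2 : ℝ) * (u ⬝ᵥ B *ᵥ v) := by
  obtain ⟨ρ, hρ, hX⟩ := hX
  have hdet := hB.det_ne_zero (exists_ne_zero_of_mem_chart hV)
  obtain ⟨M, hM, hM'⟩ := exists_linearEquiv_of_gram (B := (1 / 2 : ℝ) • Matrix.toBilin' B)
    (J := lorentz (EuclideanSpace ℝ (Fin 2 ⊕ ι))) (y := vertexVec V)
    (P := fun a => (ρ a)⁻¹ • lift (X a : EuclideanSpace ℝ (Fin 2 ⊕ ι))) (fun a c => by
      have ha := (hρ a).ne'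
      have hc := (hρ c).ne'
      have := hX a c
      rw [Subtype.dist_eq] at this
      simp only [LinearMap.smul_apply, map_smul, smul_eq_mul, Matrix.toBilin'_apply',
        lorentz_lift (norm_unitSphere (X a)) (norm_unitSphere (X c)), this]
      field_simp) (fun z hz => by
      have h0 : B *ᵥ z = 0 := by
        ext j
        have := hz (Pi.single j 1)
        rw [LinearMap.smul_apply, LinearMap.smul_apply, Matrix.toBilin'_apply',
          IsSymm_dotProduct_comm hB.symm, single_dotProduct] at this
        simpa using this
      by_contra hz0
      exact hdet (exists_mulVec_eq_zero_iff.1 ⟨z, hz0, h0⟩)) (span_vertexVec hV.2) (by simp)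
  refine ⟨M, ρ, hρ, fun a => ?_, fun u v => ?_⟩
  · rw [hM, smul_smul, mul_inv_cancel₀ (hρ a).ne', one_smul]
  · rw [hM']
    simp [Matrix.toBilin'_apply']

/-- Realizations of marked forms are inscribed realizations of the Lawrence polytope. -/
theorem Realizes.mem_inscribedRealizations (hX : Realizes X V B) (hB : IsMarked V B h)
    (hV : V ∈ chart A b) : X ∈ inscribedRealizations (lawrence A) := by
  obtain ⟨M, ρ, hρ, hM, -⟩ := hX.exists_linearEquiv hB hV
  have : Nonempty ι := ⟨b 0⟩
  have hL : IsLawrence (fun a => (X a : EuclideanSpace ℝ (Fin 2 ⊕ ι)))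
      (fun i => ρ (Sum.inl i) / ρ (Sum.inr i))
      (fun r => M ((2 : ℝ) • Pi.single (Sum.inl r) 1)) (fun i r => ρ (Sum.inl i) * (1 * V i r)) := by
    refine ⟨fun i => div_pos (hρ _) (hρ _), ?_, fun i => ?_⟩
    · have hind : LinearIndependent ℝ (Sum.elim
          (fun r : Fin 3 => ((2 : ℝ) • Pi.single (Sum.inl r) 1 : Fin 3 ⊕ ι → ℝ))
          fun i => ρ (Sum.inr i) • vertexVec V (Sum.inr i)) := by
        rw [Fintype.linearIndependent_iff]
        intro g hg
        rw [Fintype.sum_sum_type] at hg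
        have hr : ∀ i, g (Sum.inr i) = 0 := fun i => by
          have := congrFun hg (Sum.inr i)
          simp only [Sum.elim_inl, Sum.elim_inr, Pi.add_apply, Finset.sum_apply, Pi.smul_apply,
            vertexVec, Pi.single_apply, smul_eq_mul] at this
          simpa [(hρ _).ne'] using this
        rintro (r | i)
        · have := congrFun hg (Sum.inl r)
          simp only [Sum.elim_inl, Sum.elim_inr, Pi.add_apply, Finset.sum_apply, Pi.smul_apply,
            Pi.single_apply, smul_eq_mul, hr] at this
          simpa using this
        · exact hr i
      have := hind.map' M.toLinearMap M.ker
      have hfun : Sum.elim (fun r => M ((2 : ℝ) • Pi.single (Sum.inl r) 1))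
          (fun i => lift (X (Sum.inr i) : EuclideanSpace ℝ (Fin 2 ⊕ ι))) =
          M.toLinearMap ∘ (Sum.elim
            (fun r : Fin 3 => ((2 : ℝ) • Pi.single (Sum.inl r) 1 : Fin 3 ⊕ ι → ℝ))
            fun i => ρ (Sum.inr i) • vertexVec V (Sum.inr i)) := by
        ext1 (r | i)
        · rfl
        · simp [hM]
      rw [hfun]
      exact this
    · have h1 := congrArg M (vertexVec_sub V i)
      rw [map_sub, map_sum] at h1
      simp only [map_smul M (V i _)] at h1
      rw [hM, hM, smul_smul, div_mul_cancel₀ _ (hρ _).ne', ← smul_sub, h1, Finset.smul_sum]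
      simp only [one_mul, mul_smul]
  have hom := rescale_mem_omRealizations (A := A) (V := V) hV.1 (u := fun i => ρ (Sum.inl i))
    (g := fun _ => 1) (fun i => hρ _) (fun _ => one_pos)
  have hbA : ∃ t, chirotope (homogenization A) t ≠ 0 :=
    ⟨b, (chirotope_homogenization_ne_zero hV.1 b).1 (by rw [chirotope_chart hV]; decide)⟩
  change faceLattice _ = faceLattice _
  rw [hL.faceLattice_eq, (isLawrence_lawrence A).faceLattice_eq,
    covectors_eq_of_chirotope hom hbA]

/-- The realization of a marked form is unique up to Möbius transformations. -/
theorem Realizes.exists_mobius {X' : ι ⊕ ι → UnitSphere (Fin 2 ⊕ ι)} (hX : Realizes X V B)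
    (hX' : Realizes X' V B) (hB : IsMarked V B h) (hV : V ∈ chart A b) :
    ∃ σ ∈ mobiusGroup (Fin 2 ⊕ ι), ∀ a, σ (X a) = X' a := by
  obtain ⟨M, ρ, hρ, hM, hMJ⟩ := hX.exists_linearEquiv hB hV
  obtain ⟨M', ρ', hρ', hM', hMJ'⟩ := hX'.exists_linearEquiv hB hV
  let Λ := (M.symm ≪≫ₗ M').toLinearMap
  have hΛ : ∀ a, Λ (lift (X a : EuclideanSpace ℝ (Fin 2 ⊕ ι))) =
      (ρ a / ρ' a) • lift (X' a : EuclideanSpace ℝ (Fin 2 ⊕ ι)) := fun a => by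
    rw [hM', hM, smul_smul, div_mul_cancel₀ _ (hρ' a).ne']
    simp [Λ]
  obtain ⟨σ, hσ, hσ'⟩ := exists_mobius_of_lorentz (Λ := Λ) (fun u v => by
    have h1 := hMJ (M.symm u) (M.symm v)
    have h2 := hMJ' (M.symm u) (M.symm v)
    rw [LinearEquiv.apply_symm_apply, LinearEquiv.apply_symm_apply] at h1
    exact h2.trans h1.symm) (div_pos (hρ (Sum.inl (b 0))) (hρ' _)) (hΛ _)
  exact ⟨σ, hσ, fun a => hσ' _ _ _ (hΛ a)⟩

/-- The distances fixed by the functional `h`: the points of the ellipsoid `B = 0` in the affine chart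
given by `h`, rescaled to a unit sphere. -/
lemma realizes_of_dist (hB : IsMarked V B h) (hV : ∃ i, V i ≠ 0)
    (hX : ∀ a c, dist (X a) (X c) ^ 2 * ((heightVec h ⬝ᵥ vertexVec V a) *
      (heightVec h ⬝ᵥ vertexVec V c)) =
        2 * dualHeight B h * (vertexVec V a ⬝ᵥ B *ᵥ vertexVec V c)) : Realizes X V B := by
  have hq := hB.dualHeight_neg hV
  refine ⟨fun a => Real.sqrt (-2 * dualHeight B h) / (heightVec h ⬝ᵥ vertexVec V a),
    fun a => div_pos (Real.sqrt_pos.2 (by linarith)) (hB.height_pos a), fun a c => ?_⟩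
  have ha := (hB.height_pos a).ne'
  have hc := (hB.height_pos c).ne'
  have h1 : Real.sqrt (-2 * dualHeight B h) * Real.sqrt (-2 * dualHeight B h) =
      -2 * dualHeight B h := Real.mul_self_sqrt (by linarith)
  rw [div_mul_div_comm, h1]
  have := hX a c
  field_simp
  linarith

/-- The kernel of `heightVec h` with the inner product `B` is a Euclidean space, and the vertices in
the affine chart given by `h` lie on a sphere in it, centred at the pole `B⁻¹ *ᵥ heightVec h` of that
kernel. -/
theorem IsMarked.exists_dist (hB : IsMarked V B h) (hV : ∃ i, V i ≠ 0) :
    ∃ X : ι ⊕ ι → UnitSphere (Fin 2 ⊕ ι), ∀ a c,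
      dist (X a) (X c) ^ 2 * ((heightVec h ⬝ᵥ vertexVec V a) *
      (heightVec h ⬝ᵥ vertexVec V c)) =
        2 * dualHeight B h * (vertexVec V a ⬝ᵥ B *ᵥ vertexVec V c) := by
  have hq := hB.dualHeight_neg hV
  have hdet : IsUnit B.det := (hB.det_ne_zero hV).isUnit
  set τ := B⁻¹ *ᵥ heightVec h with hτ
  have hBτ : B *ᵥ τ = heightVec h := by rw [hτ, mulVec_mulVec, mul_nonsing_inv _ hdet, one_mulVec]
  have hqτ : dualHeight B h = heightVec h ⬝ᵥ τ := rfl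
  let H : (Fin 3 ⊕ ι → ℝ) →ₗ[ℝ] ℝ :=
    { toFun := fun x => heightVec h ⬝ᵥ x
      map_add' := fun x y => dotProduct_add _ _ _
      map_smul' := fun c x => dotProduct_smul _ _ _ }
  have hH : ∀ x, H x = heightVec h ⬝ᵥ x := fun x => rfl
  have hHsurj : Function.Surjective H := fun c => ⟨(c / dualHeight B h) • τ, by
    rw [map_smul, hH, ← hqτ, smul_eq_mul, div_mul_cancel₀ _ hq.ne]⟩
  have hdim : Module.finrank ℝ (LinearMap.ker H) = Fintype.card (Fin 2 ⊕ ι) := by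
    have := LinearMap.finrank_range_add_finrank_ker H
    rw [LinearMap.range_eq_top.2 hHsurj, finrank_top] at this
    simp at this ⊢
    omega
  obtain ⟨m, hm⟩ := exists_isometry (κ := Fin 2 ⊕ ι)
    ((Matrix.toBilin' B).compl₁₂ (LinearMap.ker H).subtype (LinearMap.ker H).subtype)
    (fun x y => by simpa [Matrix.toBilin'_apply'] using IsSymm_dotProduct_comm hB.symm _ _)
    (fun x hx => by
      simpa [Matrix.toBilin'_apply'] using hB.pos x (by simpa using hx) x.2) hdim
  simp only [LinearMap.compl₁₂_apply, Submodule.subtype_apply, Matrix.toBilin'_apply'] at hm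
  have hk : ∀ a, (heightVec h ⬝ᵥ vertexVec V a)⁻¹ • vertexVec V a - (dualHeight B h)⁻¹ • τ ∈
      LinearMap.ker H := fun a => by
    rw [LinearMap.mem_ker, map_sub, map_smul, map_smul, hH, hH, ← hqτ, smul_eq_mul, smul_eq_mul,
      inv_mul_cancel₀ hq.ne, inv_mul_cancel₀ (hB.height_pos a).ne', sub_self]
  set k : ι ⊕ ι → LinearMap.ker H := fun a => ⟨_, hk a⟩
  have hkk : ∀ a c, inner ℝ (m (k a)) (m (k c)) = (vertexVec V a ⬝ᵥ B *ᵥ vertexVec V c) /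
      ((heightVec h ⬝ᵥ vertexVec V a) * (heightVec h ⬝ᵥ vertexVec V c)) - (dualHeight B h)⁻¹ := by
    intro a c
    have ha := (hB.height_pos a).ne'
    have hc := (hB.height_pos c).ne'
    have hq' := hq.ne
    rw [hm]
    simp only [k]
    simp only [mulVec_sub, mulVec_smul, hBτ, sub_dotProduct, dotProduct_sub, smul_dotProduct,
      dotProduct_smul, smul_eq_mul, IsSymm_dotProduct_comm hB.symm τ,
      dotProduct_comm _ (heightVec h), ← hqτ]
    field_simp
    ring
  have hnorm : ∀ a, ‖m (k a)‖ ^ 2 = -(dualHeight B h)⁻¹ := fun a => by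
    rw [← real_inner_self_eq_norm_sq, hkk, hB.null]; simp
  have hs : Real.sqrt (-dualHeight B h) ^ 2 = -dualHeight B h := Real.sq_sqrt (by linarith)
  refine ⟨fun a => ⟨Real.sqrt (-dualHeight B h) • m (k a), ?_⟩, fun a c => ?_⟩
  · rw [mem_sphere_zero_iff_norm, ← sq_eq_sq₀ (norm_nonneg _) zero_le_one, norm_smul, mul_pow,
      hnorm, Real.norm_eq_abs, sq_abs, hs]
    field_simp [hq.ne]
  · have ha := (hB.height_pos a).ne'
    have hc := (hB.height_pos c).ne'
    have hq' := hq.ne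
    rw [Subtype.dist_eq, dist_eq_norm, ← smul_sub, norm_smul, mul_pow, Real.norm_eq_abs, sq_abs,
      hs, norm_sub_sq_real, hnorm, hnorm, hkk]
    field_simp
    ring

end Realization

/-! ### The realization map and the retraction to the chart -/

lemma continuous_inv_of_det_ne_zero {T κ : Type*} [TopologicalSpace T] [Fintype κ] [DecidableEq κ]
    {f : T → Matrix κ κ ℝ} (hf : Continuous f) (hdet : ∀ t, (f t).det ≠ 0) :
    Continuous fun t => (f t)⁻¹ := by
  simp only [Matrix.inv_def, Ring.inverse_eq_inv']
  exact (hf.matrix_det.inv₀ hdet).smul hf.matrix_adjugate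

section RealizationMap

variable {ι : Type*} [Fintype ι] [DecidableEq ι] (A : ι → EuclideanSpace ℝ (Fin 2)) (b : Fin 3 → ι)

/-- Triples of a vector configuration in `chart A b`, a form and a functional that marks it. -/
def markedForms : Set ((ι → Fin 3 → ℝ) × Matrix (Fin 3 ⊕ ι) (Fin 3 ⊕ ι) ℝ × (Fin 3 → ℝ)) :=
  {d | d.1 ∈ chart A b ∧ IsMarked d.1 d.2.1 d.2.2}

variable {A b}

omit [Fintype ι] in
lemma continuous_vertexVec (a : ι ⊕ ι) :
    Continuous fun V : ι → Fin 3 → ℝ => vertexVec V a := by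
  refine continuous_pi fun j => ?_
  rcases a with i | i <;> rcases j with r | j <;> simp only [vertexVec, Sum.elim_inl, Sum.elim_inr,
    Pi.neg_apply] <;> fun_prop

omit [Fintype ι] [DecidableEq ι] in
lemma continuous_heightVec : Continuous (heightVec : (Fin 3 → ℝ) → Fin 3 ⊕ ι → ℝ) := by
  refine continuous_pi fun j => ?_
  rcases j with r | j <;> simp only [heightVec, Sum.elim_inl, Sum.elim_inr] <;> fun_prop

lemma exists_realizes (d : markedForms A b) :
    ∃ X : inscribedRealizations (lawrence A), Realizes X.1 d.1.1 d.1.2.1 := by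
  obtain ⟨X, hX⟩ := d.2.2.exists_dist (exists_ne_zero_of_mem_chart d.2.1)
  have := realizes_of_dist d.2.2 (exists_ne_zero_of_mem_chart d.2.1) hX
  exact ⟨⟨X, this.mem_inscribedRealizations d.2.2 d.2.1⟩, this⟩

/-- The class of the inscribed polytopes realizing a marked form. -/
noncomputable def realizationClass (d : markedForms A b) :
    InscribedRealizationSpace (lawrence A) :=
  Quotient.mk _ (exists_realizes d).choose

lemma realizationClass_eq (d : markedForms A b) (X : inscribedRealizations (lawrence A))
    (hX : Realizes X.1 d.1.1 d.1.2.1) :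
    realizationClass d = Quotient.mk _ X := by
  refine Quotient.sound ?_
  obtain ⟨σ, hσ, h⟩ := hX.exists_mobius (exists_realizes d).choose_spec d.2.2 d.2.1
  exact MulAction.orbitRel_apply.2 ⟨⟨σ, hσ⟩, funext h⟩

/-- The configurations on the sphere whose distances are prescribed by a marked form are the
points of a closed, fibrewise compact family over the marked forms, and this family maps
continuously to the realization space. -/
theorem continuous_realizationClass :
    Continuous (realizationClass : markedForms A b → InscribedRealizationSpace (lawrence A)) := by
  let T : Set (markedForms A b × (ι ⊕ ι → UnitSphere (Fin 2 ⊕ ι))) :=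
    {p | ∀ a c, dist (p.2 a) (p.2 c) ^ 2 * ((heightVec p.1.1.2.2 ⬝ᵥ vertexVec p.1.1.1 a) *
      (heightVec p.1.1.2.2 ⬝ᵥ vertexVec p.1.1.1 c)) = 2 * dualHeight p.1.1.2.1 p.1.1.2.2 *
        (vertexVec p.1.1.1 a ⬝ᵥ p.1.1.2.1 *ᵥ vertexVec p.1.1.1 c)}
  have hT : IsClosed T := by
    have hv : ∀ a, Continuous fun d : markedForms A b => vertexVec d.1.1 a := fun a =>
      (continuous_vertexVec a).comp (by fun_prop)
    have hh : Continuous fun d : markedForms A b => (heightVec d.1.2.2 : Fin 3 ⊕ ι → ℝ) :=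
      continuous_heightVec.comp (by fun_prop)
    have hB : Continuous fun d : markedForms A b => d.1.2.1 := by fun_prop
    have hq : Continuous fun d : markedForms A b => dualHeight d.1.2.1 d.1.2.2 :=
      hh.dotProduct ((continuous_inv_of_det_ne_zero hB fun d =>
        d.2.2.det_ne_zero (exists_ne_zero_of_mem_chart d.2.1)).matrix_mulVec hh)
    have hH : ∀ a, Continuous fun d : markedForms A b => heightVec d.1.2.2 ⬝ᵥ vertexVec d.1.1 a :=
      fun a => hh.dotProduct (hv a)
    have hBv : ∀ a c, Continuous fun d : markedForms A b =>
        vertexVec d.1.1 a ⬝ᵥ d.1.2.1 *ᵥ vertexVec d.1.1 c :=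
      fun a c => (hv a).dotProduct (hB.matrix_mulVec (hv c))
    simp only [T, ofPred_forall]
    refine isClosed_iInter fun a => isClosed_iInter fun c => isClosed_eq ?_ ?_
    · have h1 := (hH a).comp (continuous_fst (Y := ι ⊕ ι → UnitSphere (Fin 2 ⊕ ι)))
      have h2 := (hH c).comp (continuous_fst (Y := ι ⊕ ι → UnitSphere (Fin 2 ⊕ ι)))
      exact Continuous.mul (by fun_prop) (h1.mul h2)
    · exact ((continuous_const.mul hq).mul (hBv a c)).comp continuous_fst
  have hmem : ∀ p : T, Realizes p.1.2 p.1.1.1.1 p.1.1.1.2.1 := fun p =>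
    realizes_of_dist p.1.1.2.2 (exists_ne_zero_of_mem_chart p.1.1.2.1) p.2
  -- the projection forgetting the points is closed since the space of configurations is compact
  have hquot : Topology.IsQuotientMap fun p : T => p.1.1 := by
    refine IsClosedMap.isQuotientMap (isClosedMap_fst_of_compactSpace.comp
      hT.isClosedEmbedding_subtypeVal.isClosedMap) (by fun_prop) fun d => ?_
    obtain ⟨X, hX⟩ := d.2.2.exists_dist (exists_ne_zero_of_mem_chart d.2.1)
    exact ⟨⟨(d, X), hX⟩, rfl⟩
  rw [hquot.continuous_iff]
  have h1 : (realizationClass ∘ fun p : T => p.1.1) = fun p : T =>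
      Quotient.mk _ (⟨p.1.2, (hmem p).mem_inscribedRealizations p.1.1.2.2 p.1.1.2.1⟩ :
        inscribedRealizations (lawrence A)) := by
    ext p
    exact realizationClass_eq _ _ (hmem p)
  rw [h1]
  exact continuous_quotient_mk'.comp (by fun_prop)

end RealizationMap

section Retraction

variable {ι : Type*} [Fintype ι] [DecidableEq ι] {A : ι → EuclideanSpace ℝ (Fin 2)} {b : Fin 3 → ι}

lemma continuous_standardForm :
    Continuous fun p : (ι → Fin 3 → ℝ) × (Fin 3 → ℝ) => standardForm p.1 p.2 := by
  have hc : Continuous fun p : (ι → Fin 3 → ℝ) × (Fin 3 → ℝ) => standardCoeff p.1 p.2 := by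
    refine Continuous.div (by simp only [dotProduct]; fun_prop)
      (by simp only [dotProduct]; fun_prop) fun p => ?_
    have : 0 ≤ ∑ i, p.1 i ⬝ᵥ p.1 i :=
      Finset.sum_nonneg fun i _ => Finset.sum_nonneg fun r _ => mul_self_nonneg _
    positivity
  have he : Continuous fun p : (ι → Fin 3 → ℝ) × (Fin 3 → ℝ) =>
      (Sum.elim p.2 0 : Fin 3 ⊕ ι → ℝ) := by
    refine continuous_pi fun j => ?_
    rcases j with r | j <;> simp only [Sum.elim_inl, Sum.elim_inr] <;> fun_prop
  refine ((he.matrix_vecMulVec he).sub continuous_const).add (Continuous.matrix_diagonal ?_)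
  refine continuous_pi fun j => ?_
  rcases j with r | j <;> simp only [Sum.elim_inl, Sum.elim_inr, dotProduct] <;> fun_prop

/-- The form with functional `0` over a configuration. -/
noncomputable def chartSection : C(chart A b, markedForms A b) where
  toFun V := ⟨(V.1, standardForm V.1 0, 0), V.2, isMarked_standardForm (by simp)⟩
  continuous_toFun := by
    have : Continuous fun V : chart A b => standardForm V.1 0 :=
      continuous_standardForm.comp (by fun_prop : Continuous fun V : chart A b => (V.1, (0 : Fin 3 → ℝ)))
    fun_prop

/-- The projection of the marked forms to the vector configurations. -/
def chartProj : C(markedForms A b, chart A b) where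
  toFun d := ⟨d.1.1, d.2.1⟩
  continuous_toFun := by fun_prop

lemma abs_smul_dotProduct_lt {h v : Fin 3 → ℝ} (hh : |h ⬝ᵥ v| < 1) (t : unitInterval) :
    |((t : ℝ) • h) ⬝ᵥ v| < 1 := by
  rw [smul_dotProduct, smul_eq_mul, abs_mul, abs_of_nonneg t.2.1]
  exact (mul_le_of_le_one_left (abs_nonneg _) t.2.2).trans_lt hh

/-- Marked forms deform to the standard ones: the form moves linearly to the standard form with
the same functional, after which the functional shrinks to `0`. -/
theorem chartSection_comp_chartProj_homotopic :
    ((chartSection (A := A) (b := b)).comp chartProj).Homotopic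
      (ContinuousMap.id (markedForms A b)) := by
  let N : C(markedForms A b, markedForms A b) :=
    { toFun := fun d => ⟨(d.1.1, standardForm d.1.1 d.1.2.2, d.1.2.2), d.2.1,
        isMarked_standardForm d.2.2.height_lt⟩
      continuous_toFun := by
        have : Continuous fun d : markedForms A b => standardForm d.1.1 d.1.2.2 :=
          continuous_standardForm.comp (by fun_prop :
            Continuous fun d : markedForms A b => (d.1.1, d.1.2.2))
        fun_prop }
  have h1 : ((chartSection (A := A) (b := b)).comp chartProj).Homotopic N := by
    refine ⟨⟨⟨fun p => ⟨(p.2.1.1, standardForm p.2.1.1 ((p.1 : ℝ) • p.2.1.2.2),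
      (p.1 : ℝ) • p.2.1.2.2), p.2.2.1, isMarked_standardForm fun i =>
        abs_smul_dotProduct_lt (p.2.2.2.height_lt i) p.1⟩, ?_⟩, fun d => ?_, fun d => ?_⟩⟩
    · have : Continuous fun p : unitInterval × markedForms A b =>
          standardForm p.2.1.1 ((p.1 : ℝ) • p.2.1.2.2) :=
        continuous_standardForm.comp (by fun_prop :
          Continuous fun p : unitInterval × markedForms A b =>
            (p.2.1.1, (p.1 : ℝ) • p.2.1.2.2))
      fun_prop
    · exact Subtype.ext (by simp [chartSection, chartProj])
    · exact Subtype.ext (by simp [N])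
  refine h1.trans ⟨⟨⟨fun p => ⟨(p.2.1.1, (1 - p.1 : ℝ) • standardForm p.2.1.1 p.2.1.2.2 +
      (p.1 : ℝ) • p.2.1.2.1, p.2.1.2.2), p.2.2.1, (isMarked_standardForm
        p.2.2.2.height_lt).convex p.2.2.2 (sub_nonneg.2 p.1.2.2) p.1.2.1 (by ring)⟩, ?_⟩,
      fun d => ?_, fun d => ?_⟩⟩
  · have : Continuous fun p : unitInterval × markedForms A b =>
        standardForm p.2.1.1 p.2.1.2.2 :=
      continuous_standardForm.comp (by fun_prop :
        Continuous fun p : unitInterval × markedForms A b => (p.2.1.1, p.2.1.2.2))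
    fun_prop
  · exact Subtype.ext (by simp [N])
  · exact Subtype.ext (by simp)

end Retraction

/-! ### Normal forms of inscribed Lawrence polytopes -/

section Normalization

variable {ι : Type*} {A : ι → EuclideanSpace ℝ (Fin 2)}

/-- The coordinates of a vector configuration with respect to three of its vectors. -/
noncomputable def normalizeAt (t : Fin 3 → ι) (V : ι → Fin 3 → ℝ) : ι → Fin 3 → ℝ :=
  fun i => V i ᵥ* (Matrix.of fun k => V (t k))⁻¹

lemma det_ne_zero_of_chirotope {V : ι → Fin 3 → ℝ} {t : Fin 3 → ι} (ht : chirotope V t ≠ 0) :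
    (Matrix.of fun k => V (t k)).det ≠ 0 := sign_ne_zero.1 ht

lemma normalizeAt_vecMul {V : ι → Fin 3 → ℝ} {t : Fin 3 → ι} (ht : chirotope V t ≠ 0) (i : ι) :
    normalizeAt t V i ᵥ* (Matrix.of fun k => V (t k)) = V i := by
  rw [normalizeAt, vecMul_vecMul, nonsing_inv_mul _ (det_ne_zero_of_chirotope ht).isUnit,
    vecMul_one]

lemma chirotope_vecMul (V : ι → Fin 3 → ℝ) (M : Matrix (Fin 3) (Fin 3) ℝ) (s : Fin 3 → ι) :
    chirotope (fun i => V i ᵥ* M) s = chirotope V s * SignType.sign M.det := by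
  rw [chirotope, chirotope, ← sign_mul, ← det_mul]
  rfl

lemma vecMul_mem_omRealizations {V : ι → Fin 3 → ℝ} (hV : V ∈ omRealizations A)
    {M : Matrix (Fin 3) (Fin 3) ℝ} (hM : M.det ≠ 0) :
    (fun i => V i ᵥ* M) ∈ omRealizations A := by
  have key : (∀ t, chirotope (fun i => V i ᵥ* M) t = chirotope V t) ∨
      (∀ t, chirotope (fun i => V i ᵥ* M) t = -chirotope V t) := by
    rcases hM.lt_or_gt with h | h
    · right; intro t; rw [chirotope_vecMul, sign_neg h]
      generalize chirotope V t = s; revert s; decide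
    · left; intro t; rw [chirotope_vecMul, sign_pos h, mul_one]
  rcases key with h | h <;> rcases hV with h' | h'
  · exact Or.inl fun t => by rw [h, h']
  · exact Or.inr fun t => by rw [h, h']
  · exact Or.inr fun t => by rw [h, h']
  · exact Or.inl fun t => by rw [h, h', neg_neg]

lemma normalizeAt_mem_chart {V : ι → Fin 3 → ℝ} {t : Fin 3 → ι} (hV : V ∈ omRealizations A)
    (ht : chirotope V t ≠ 0) : normalizeAt t V ∈ chart A t := by
  have hdet := det_ne_zero_of_chirotope ht
  refine ⟨vecMul_mem_omRealizations hV ?_, fun r => ?_⟩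
  · rw [det_nonsing_inv, Ring.inverse_eq_inv']; exact inv_ne_zero hdet
  · have h1 : V (t r) = Pi.single r 1 ᵥ* (Matrix.of fun k => V (t k)) := by
      rw [single_one_vecMul]; rfl
    rw [normalizeAt, h1, vecMul_vecMul, mul_nonsing_inv _ hdet.isUnit, vecMul_one]

/-- The coordinates of a configuration in a chart are themselves basis determinants. -/
lemma chirotope_update [DecidableEq ι] {V : ι → Fin 3 → ℝ} {t : Fin 3 → ι}
    (hV : ∀ r, V (t r) = Pi.single r 1) (i : ι) (s : Fin 3) :
    chirotope V (Function.update t s i) = SignType.sign (V i s) := by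
  have h0 := hV 0
  have h1 := hV 1
  have h2 := hV 2
  rw [chirotope, det_fin_three]
  fin_cases s <;> simp [Function.update, h0, h1, h2]

end Normalization

section NormalForm

variable {ι : Type*} [Fintype ι] [DecidableEq ι] {A : ι → EuclideanSpace ℝ (Fin 2)}

/-- The homogeneous vectors `p` of an inscribed Lawrence polytope in coordinates: the vectors
`p (inl i) - lam i • p (inr i)` span a three-dimensional space, in which those with labels `t`
form a basis and the others have coordinates `v`. -/
structure IsNormalForm {F : Type*} [AddCommGroup F] [Module ℝ F]
    (A : ι → EuclideanSpace ℝ (Fin 2)) (p : ι ⊕ ι → F) (lam : ι → ℝ) (t : Fin 3 → ι)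
    (v : ι → Fin 3 → ℝ) : Prop where
  mem : v ∈ chart A t
  indep : LinearIndependent ℝ (p ∘ Sum.map t id : Fin 3 ⊕ ι → F)
  rel : ∀ i, p (Sum.inl i) - lam i • p (Sum.inr i) =
    ∑ s, v i s • (p (Sum.inl (t s)) - lam (t s) • p (Sum.inr (t s)))

omit [Fintype ι] [DecidableEq ι] in
lemma IsNormalForm.rescale {F : Type*} [AddCommGroup F] [Module ℝ F] {p : ι ⊕ ι → F}
    {lam : ι → ℝ} {t : Fin 3 → ι} {v : ι → Fin 3 → ℝ} (h : IsNormalForm A p lam t v)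
    {H : ι ⊕ ι → ℝ} (hH : ∀ a, 0 < H a) :
    IsNormalForm A (fun a => (H a)⁻¹ • p a)
      (fun i => lam i * H (Sum.inr i) / H (Sum.inl i)) t
      (fun i s => (H (Sum.inl i))⁻¹ * (H (Sum.inl (t s)) * v i s)) := by
  have hlam : ∀ i, (H (Sum.inl i))⁻¹ • p (Sum.inl i) -
      (lam i * H (Sum.inr i) / H (Sum.inl i)) • (H (Sum.inr i))⁻¹ • p (Sum.inr i) =
      (H (Sum.inl i))⁻¹ • (p (Sum.inl i) - lam i • p (Sum.inr i)) := fun i => by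
    have h1 := (hH (Sum.inl i)).ne'
    have h2 := (hH (Sum.inr i)).ne'
    rw [smul_sub, smul_smul, smul_smul]
    congr 2
    field_simp
  refine ⟨⟨rescale_mem_omRealizations h.mem.1 (fun i => inv_pos.2 (hH _)) fun s => hH _,
    fun r => ?_⟩, ?_, fun i => ?_⟩
  · ext s
    have h1 := (hH (Sum.inl (t r))).ne'
    beta_reduce
    rw [h.mem.2, Pi.single_apply]
    split_ifs with hs
    · subst hs; field_simp
    · simp
  · have := h.indep.units_smul (fun a => Units.mk0 (H (Sum.map t id a))⁻¹
      (inv_ne_zero (hH _).ne'))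
    exact this
  · rw [hlam, h.rel, Finset.smul_sum]
    refine Finset.sum_congr rfl fun s _ => ?_
    rw [hlam, smul_smul, smul_smul]
    have h1 := (hH (Sum.inl (t s))).ne'
    congr 1
    field_simp

/-- Inscribed Lawrence polytopes have a normal form with respect to every basis of the
configuration, with factors `lam` that do not depend on the basis. -/
theorem exists_isNormalForm {X : ι ⊕ ι → UnitSphere (Fin 2 ⊕ ι)}
    (hX : X ∈ inscribedRealizations (lawrence A))
    (hA : ∃ t, chirotope (homogenization A) t ≠ 0) :
    ∃ lam : ι → ℝ, (∀ i, 0 < lam i) ∧ ∀ t, chirotope (homogenization A) t ≠ 0 →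
      ∃ v, IsNormalForm A (fun a => lift (X a : EuclideanSpace ℝ (Fin 2 ⊕ ι))) lam t v := by
  have : Nonempty ι := hA.elim fun t _ => ⟨t 0⟩
  obtain ⟨lam, w, V, hL, hcov⟩ := exists_isLawrence (hX.trans (isLawrence_lawrence A).faceLattice_eq)
  have hV : V ∈ omRealizations A := chirotope_eq_of_covectors_eq hcov hA
  refine ⟨lam, hL.pos, fun t ht => ?_⟩
  rw [← chirotope_homogenization_ne_zero hV] at ht
  have hdet := det_ne_zero_of_chirotope ht
  refine ⟨normalizeAt t V, normalizeAt_mem_chart hV ht, ?_, fun i => ?_⟩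
  · have hind := hL.indep
    rw [Fintype.linearIndependent_iff] at hind ⊢
    intro g hg
    rw [Fintype.sum_sum_type] at hg
    simp only [Function.comp_apply, Sum.map_inl, Sum.map_inr, id] at hg
    have hrel : ∀ i, lift (X (Sum.inl i) : EuclideanSpace ℝ (Fin 2 ⊕ ι)) =
        ∑ r, V i r • w r + lam i • lift (X (Sum.inr i) : EuclideanSpace ℝ (Fin 2 ⊕ ι)) := fun i => by
      rw [← hL.rel, sub_add_cancel]
    set c : Fin 3 → ℝ := fun s => g (Sum.inl s)
    set G : Fin 3 ⊕ ι → ℝ := Sum.elim (c ᵥ* (Matrix.of fun k => V (t k)))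
      (fun i => g (Sum.inr i) + ∑ s, if t s = i then c s * lam (t s) else 0) with hG
    have h0 := hind G (by
      rw [← hg, Fintype.sum_sum_type]
      simp only [hG, Sum.elim_inl, Sum.elim_inr, add_smul, Finset.sum_add_distrib, hrel, smul_add,
        Finset.smul_sum, smul_smul, vecMul, dotProduct, Matrix.of_apply, Finset.sum_smul, ite_smul,
        zero_smul]
      rw [Finset.sum_comm]
      have : ∑ i, ∑ s, (if t s = i then (c s * lam (t s)) •
          lift (X (Sum.inr i) : EuclideanSpace ℝ (Fin 2 ⊕ ι)) else 0) =
          ∑ s, (c s * lam (t s)) • lift (X (Sum.inr (t s)) : EuclideanSpace ℝ (Fin 2 ⊕ ι)) := by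
        rw [Finset.sum_comm]
        simp
      rw [this]
      abel)
    have hc : c = 0 := by
      apply eq_zero_of_vecMul_eq_zero hdet
      ext r
      exact h0 (Sum.inl r)
    rintro (s | i)
    · exact congrFun hc s
    · have := h0 (Sum.inr i)
      simpa [hG, hc] using this
  · have h1 : ∀ r, V i r = ∑ s, normalizeAt t V i s * V (t s) r := fun r =>
      (congrFun (normalizeAt_vecMul ht i) r).symm
    rw [hL.rel i]
    simp only [hL.rel, h1 _, Finset.sum_smul, Finset.smul_sum, smul_smul]
    rw [Finset.sum_comm]

omit [Fintype ι] in
/-- If every basis contains `i`, the factor `lam i` of a normal form is arbitrary. -/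
lemma IsNormalForm.change_coloop {F : Type*} [AddCommGroup F] [Module ℝ F] {p : ι ⊕ ι → F}
    {lam lam' : ι → ℝ} {t : Fin 3 → ι} {v : ι → Fin 3 → ℝ} (h : IsNormalForm A p lam t v)
    (hlam : ∀ i, (∃ t, chirotope (homogenization A) t ≠ 0 ∧ ∀ r, t r ≠ i) → lam' i = lam i) :
    IsNormalForm A p lam' t v := by
  refine ⟨h.mem, h.indep, fun i => ?_⟩
  by_cases hi : ∃ r, t r = i
  · obtain ⟨r, rfl⟩ := hi
    rw [h.mem.2, Finset.sum_eq_single r (fun s _ hs => by simp [hs]) (by simp)]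
    simp
  push Not at hi
  have htA : chirotope (homogenization A) t ≠ 0 :=
    (chirotope_homogenization_ne_zero h.mem.1 t).1 (by rw [chirotope_chart h.mem]; decide)
  rw [hlam i ⟨t, htA, hi⟩, h.rel i]
  refine Finset.sum_congr rfl fun s _ => ?_
  by_cases hs : v i s = 0
  · rw [hs, zero_smul, zero_smul]
  rw [hlam (t s) ⟨Function.update t s i, ?_, fun r => ?_⟩]
  · rw [← chirotope_homogenization_ne_zero h.mem.1, chirotope_update h.mem.2]
    exact sign_ne_zero.2 hs
  · have hinj : Function.Injective t := fun r r' hrr' => by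
      have h1 := h.mem.2 r
      rw [hrr', h.mem.2 r'] at h1
      by_contra hne
      have := congrFun h1 r
      simp [hne] at this
    by_cases hr : r = s
    · subst hr; rw [Function.update_self]; exact (hi r).symm
    · rw [Function.update_of_ne hr]; exact fun h0 => hr (hinj h0)

end NormalForm

/-! ### The Möbius invariant Gram matrix and the canonical marked form -/

section NormalizedGram

variable {ι : Type*} [Fintype ι] [DecidableEq ι]

/-- The product of the pairwise squared distances of three reference points. -/
noncomputable def gramScale (b : Fin 3 → ι) (X : ι ⊕ ι → UnitSphere (Fin 2 ⊕ ι)) : ℝ :=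
  dist (X (Sum.inl (b 0))) (X (Sum.inl (b 1))) ^ 2 *
    dist (X (Sum.inl (b 0))) (X (Sum.inl (b 2))) ^ 2 *
    dist (X (Sum.inl (b 1))) (X (Sum.inl (b 2))) ^ 2

/-- The values at the points `X a` of a linear functional in homogeneous coordinates, the pairing
with a positive combination of two of the reference points. -/
noncomputable def apexHeight (b : Fin 3 → ι) (X : ι ⊕ ι → UnitSphere (Fin 2 ⊕ ι)) (a : ι ⊕ ι) : ℝ :=
  dist (X (Sum.inl (b 1))) (X (Sum.inl (b 2))) ^ 2 * dist (X (Sum.inl (b 0))) (X a) ^ 2 +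
    dist (X (Sum.inl (b 0))) (X (Sum.inl (b 2))) ^ 2 * dist (X (Sum.inl (b 1))) (X a) ^ 2

/-- The squared distances of the points, weighted so as to be invariant under Möbius
transformations. -/
noncomputable def normGram (b : Fin 3 → ι) (X : ι ⊕ ι → UnitSphere (Fin 2 ⊕ ι)) :
    Matrix (ι ⊕ ι) (ι ⊕ ι) ℝ :=
  Matrix.of fun a c => gramScale b X * dist (X a) (X c) ^ 2 / (apexHeight b X a * apexHeight b X c)

/-- The homogeneous vectors of the points, scaled to have height `1`. -/
noncomputable def normLift (b : Fin 3 → ι) (X : ι ⊕ ι → UnitSphere (Fin 2 ⊕ ι)) (a : ι ⊕ ι) :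
    EuclideanSpace ℝ (Fin 2 ⊕ ι) × ℝ :=
  (apexHeight b X a)⁻¹ • lift (X a : EuclideanSpace ℝ (Fin 2 ⊕ ι))

omit [DecidableEq ι] in
lemma normGram_mobius (b : Fin 3 → ι) (X : ι ⊕ ι → UnitSphere (Fin 2 ⊕ ι))
    {σ : Equiv.Perm (UnitSphere (Fin 2 ⊕ ι))} (hσ : σ ∈ mobiusGroup (Fin 2 ⊕ ι)) :
    normGram b (fun a => σ (X a)) = normGram b X := by
  obtain ⟨μ, hμ, h⟩ := exists_conformal_factor hσ
  set m := μ (X (Sum.inl (b 0))) * μ (X (Sum.inl (b 1))) * μ (X (Sum.inl (b 2)))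
  have hm : 0 < m := mul_pos (mul_pos (hμ _) (hμ _)) (hμ _)
  have hH : ∀ a, apexHeight b (fun a => σ (X a)) a = m * μ (X a) * apexHeight b X a := fun a => by
    simp only [apexHeight, h, m]; ring
  have hG : gramScale b (fun a => σ (X a)) = m ^ 2 * gramScale b X := by
    simp only [gramScale, h, m]; ring
  ext a c
  simp only [normGram, Matrix.of_apply, hH, hG, h]
  -- all conformal factors cancel, since each reference point contributes equally often to the
  -- numerator and to the denominator
  have ha := hμ (X a)
  have hc := hμ (X c)
  have hk : m ^ 2 * μ (X a) * μ (X c) ≠ 0 := by positivity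
  rw [← mul_div_mul_left (gramScale b X * dist (X a) (X c) ^ 2) _ hk]
  congr 1 <;> ring

variable {b : Fin 3 → ι} {X : ι ⊕ ι → UnitSphere (Fin 2 ⊕ ι)}

omit [DecidableEq ι] in
lemma gramScale_pos (h : ∀ r s, r ≠ s → X (Sum.inl (b r)) ≠ X (Sum.inl (b s))) :
    0 < gramScale b X := by
  have h01 := dist_pos.2 (h 0 1 (by decide))
  have h02 := dist_pos.2 (h 0 2 (by decide))
  have h12 := dist_pos.2 (h 1 2 (by decide))
  rw [gramScale]
  positivity

omit [DecidableEq ι] in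
lemma apexHeight_pos (h : ∀ r s, r ≠ s → X (Sum.inl (b r)) ≠ X (Sum.inl (b s))) (a : ι ⊕ ι) :
    0 < apexHeight b X a := by
  have h02 := dist_pos.2 (h 0 2 (by decide))
  have h12 := dist_pos.2 (h 1 2 (by decide))
  rw [apexHeight]
  by_cases ha : X (Sum.inl (b 0)) = X a
  · have h1 : 0 < dist (X (Sum.inl (b 1))) (X a) := dist_pos.2 (ha ▸ h 1 0 (by decide))
    positivity
  · have h0 := dist_pos.2 ha
    positivity

omit [DecidableEq ι] in
lemma normGram_eq (h : ∀ r s, r ≠ s → X (Sum.inl (b r)) ≠ X (Sum.inl (b s))) (a c : ι ⊕ ι) :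
    normGram b X a c =
      -(2 * gramScale b X * lorentz _ (normLift b X a) (normLift b X c)) := by
  have ha := (apexHeight_pos h a).ne'
  have hc := (apexHeight_pos h c).ne'
  simp only [normGram, normLift, Matrix.of_apply, map_smul, LinearMap.smul_apply, smul_eq_mul,
    lorentz_lift (norm_unitSphere (X a)) (norm_unitSphere (X c)), Subtype.dist_eq]
  field_simp

omit [DecidableEq ι] in
/-- The functional measured by `apexHeight` is the pairing with a timelike vector. -/
lemma exists_apex (h : ∀ r s, r ≠ s → X (Sum.inl (b r)) ≠ X (Sum.inl (b s))) :
    ∃ T : EuclideanSpace ℝ (Fin 2 ⊕ ι) × ℝ, lorentz _ T T < 0 ∧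
      ∀ a, lorentz _ T (normLift b X a) = -(1 / 2) := by
  have h01 := dist_pos.2 (h 0 1 (by decide))
  have h02 := dist_pos.2 (h 0 2 (by decide))
  have h12 := dist_pos.2 (h 1 2 (by decide))
  have hl : ∀ a c, lorentz _ (lift (X a : EuclideanSpace ℝ (Fin 2 ⊕ ι)))
      (lift (X c : EuclideanSpace ℝ (Fin 2 ⊕ ι))) = -(dist (X a) (X c) ^ 2 / 2) := fun a c =>
    lorentz_lift (norm_unitSphere _) (norm_unitSphere _)
  refine ⟨dist (X (Sum.inl (b 1))) (X (Sum.inl (b 2))) ^ 2 •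
    lift (X (Sum.inl (b 0)) : EuclideanSpace ℝ (Fin 2 ⊕ ι)) +
    dist (X (Sum.inl (b 0))) (X (Sum.inl (b 2))) ^ 2 •
    lift (X (Sum.inl (b 1)) : EuclideanSpace ℝ (Fin 2 ⊕ ι)), ?_, fun a => ?_⟩
  · simp only [map_add, map_smul, LinearMap.add_apply, LinearMap.smul_apply, smul_eq_mul, hl,
      dist_self, dist_comm (X (Sum.inl (b 1))) (X (Sum.inl (b 0)))]
    have : 0 < dist (X (Sum.inl (b 1))) (X (Sum.inl (b 2))) ^ 2 *
      dist (X (Sum.inl (b 0))) (X (Sum.inl (b 2))) ^ 2 *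
      dist (X (Sum.inl (b 0))) (X (Sum.inl (b 1))) ^ 2 := by positivity
    linarith
  · have ha := (apexHeight_pos h a).ne'
    simp only [normLift, map_add, map_smul, LinearMap.add_apply, LinearMap.smul_apply, smul_eq_mul,
      hl]
    rw [inv_mul_eq_iff_eq_mul₀ ha, apexHeight]
    ring

end NormalizedGram

section CanonicalForm

variable {ι : Type*} [Fintype ι] [DecidableEq ι]

/-- The coordinates of the vector with label `inl i` with respect to the vectors with labels
`inl (t s)` and `inr j`, computed from the Gram matrix. They are meaningful only if the latter
vectors form a basis. -/
noncomputable def basisCoord (Γ : Matrix (ι ⊕ ι) (ι ⊕ ι) ℝ) (t : Fin 3 → ι) (i : ι) :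
    Fin 3 ⊕ ι → ℝ :=
  (Γ.submatrix (Sum.map t id) (Sum.map t id))⁻¹ *ᵥ fun j => Γ (Sum.map t id j) (Sum.inl i)

open Classical in
/-- The factors of the normal form, computed from the Gram matrix; where the normal form leaves
the factor undetermined, the choice is `1`. -/
noncomputable def factor (A : ι → EuclideanSpace ℝ (Fin 2)) (Γ : Matrix (ι ⊕ ι) (ι ⊕ ι) ℝ)
    (i : ι) : ℝ :=
  if h : ∃ t, chirotope (homogenization A) t ≠ 0 ∧ ∀ r, t r ≠ i then
    basisCoord Γ h.choose i (Sum.inr i) else 1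

/-- The coefficients of the basis of `E × ℝ` adapted to a normal form in terms of the
homogeneous vectors. -/
noncomputable def frame (lam : ι → ℝ) (b : Fin 3 → ι) : Matrix (Fin 3 ⊕ ι) (ι ⊕ ι) ℝ :=
  Matrix.of fun j => Sum.elim
    (fun r => (1 + lam (b r))⁻¹ •
      (Pi.single (Sum.inl (b r)) 1 - lam (b r) • Pi.single (Sum.inr (b r)) 1))
    (fun i => (1 + lam i)⁻¹ • (Pi.single (Sum.inl i) 1 + lam i • Pi.single (Sum.inr i) 1)) j

/-- The vector configuration underlying a Lawrence polytope with normalized Gram matrix `Γ`. -/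
noncomputable def canonVectors (A : ι → EuclideanSpace ℝ (Fin 2)) (b : Fin 3 → ι)
    (Γ : Matrix (ι ⊕ ι) (ι ⊕ ι) ℝ) : ι → Fin 3 → ℝ :=
  fun i r => (1 + factor A Γ i)⁻¹ * ((1 + factor A Γ (b r)) * basisCoord Γ b i (Sum.inl r))

/-- The Lorentzian form in the adapted basis. -/
noncomputable def canonForm (A : ι → EuclideanSpace ℝ (Fin 2)) (b : Fin 3 → ι)
    (Γ : Matrix (ι ⊕ ι) (ι ⊕ ι) ℝ) : Matrix (Fin 3 ⊕ ι) (Fin 3 ⊕ ι) ℝ :=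
  -(frame (factor A Γ) b * Γ * (frame (factor A Γ) b)ᵀ)

/-- The height functional in the adapted basis. -/
noncomputable def canonHeight (A : ι → EuclideanSpace ℝ (Fin 2)) (b : Fin 3 → ι)
    (Γ : Matrix (ι ⊕ ι) (ι ⊕ ι) ℝ) : Fin 3 → ℝ :=
  fun r => (1 - factor A Γ (b r)) / (1 + factor A Γ (b r))

variable {A : ι → EuclideanSpace ℝ (Fin 2)}

/-- `Γ` is the multiple by `-c` of the Gram matrix of `p` for the Lorentzian form, where `c > 0`. -/
def IsGram (Γ : Matrix (ι ⊕ ι) (ι ⊕ ι) ℝ) (p : ι ⊕ ι → EuclideanSpace ℝ (Fin 2 ⊕ ι) × ℝ)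
    (c : ℝ) : Prop :=
  0 < c ∧ ∀ a a', Γ a a' = -(c * lorentz _ (p a) (p a'))

variable {Γ : Matrix (ι ⊕ ι) (ι ⊕ ι) ℝ} {p : ι ⊕ ι → EuclideanSpace ℝ (Fin 2 ⊕ ι) × ℝ} {c : ℝ}
  {t : Fin 3 → ι}

omit [DecidableEq ι] in
lemma IsGram.pairing (h : IsGram Γ p c) (z z' : ι ⊕ ι → ℝ) :
    z ⬝ᵥ Γ *ᵥ z' = -(c * lorentz _ (∑ a, z a • p a) (∑ a, z' a • p a)) := by
  simp only [dotProduct, mulVec, map_sum, map_smul, LinearMap.sum_apply, LinearMap.smul_apply,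
    smul_eq_mul, h.2, Finset.mul_sum]
  rw [Finset.sum_comm, ← Finset.sum_neg_distrib]
  refine Finset.sum_congr rfl fun a _ => ?_
  rw [← Finset.sum_neg_distrib]
  refine Finset.sum_congr rfl fun a' _ => ?_
  ring

omit [DecidableEq ι] in
lemma span_eq_top_of_indep (hp : LinearIndependent ℝ (p ∘ Sum.map t id : Fin 3 ⊕ ι → _)) :
    Submodule.span ℝ (range (p ∘ Sum.map t id)) = ⊤ := by
  refine hp.span_eq_top_of_card_eq_finrank' ?_
  simp
  omega

omit [DecidableEq ι] in
lemma IsGram.submatrix_mulVec (h : IsGram Γ p c) (z : Fin 3 ⊕ ι → ℝ) (l : Fin 3 ⊕ ι) :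
    (Γ.submatrix (Sum.map t id) (Sum.map t id) *ᵥ z) l =
      -(c * lorentz _ (p (Sum.map t id l)) (∑ j, z j • p (Sum.map t id j))) := by
  simp only [dotProduct, mulVec, map_sum, map_smul, smul_eq_mul, h.2, Finset.mul_sum,
    Matrix.submatrix_apply]
  rw [← Finset.sum_neg_distrib]
  refine Finset.sum_congr rfl fun a' _ => ?_
  ring

lemma IsGram.det_ne_zero (h : IsGram Γ p c)
    (hp : LinearIndependent ℝ (p ∘ Sum.map t id : Fin 3 ⊕ ι → _)) :
    (Γ.submatrix (Sum.map t id) (Sum.map t id)).det ≠ 0 := by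
  intro hdet
  obtain ⟨z, hz, hz0⟩ := exists_mulVec_eq_zero_iff.2 hdet
  apply hz
  have h0 : ∑ j, z j • p (Sum.map t id j) = 0 := by
    refine lorentz_nondegenerate fun w => ?_
    rw [lorentz_comm]
    have hw : w ∈ Submodule.span ℝ (range (p ∘ Sum.map t id)) :=
      span_eq_top_of_indep hp ▸ Submodule.mem_top
    induction hw using Submodule.span_induction with
    | mem w hw =>
      obtain ⟨l, rfl⟩ := hw
      have := h.submatrix_mulVec (t := t) z l
      rw [hz0, Pi.zero_apply, eq_comm, neg_eq_zero] at this
      exact (mul_eq_zero.1 this).resolve_left h.1.ne'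
    | zero => simp
    | add u v _ _ hu hv => rw [map_add, LinearMap.add_apply, hu, hv, add_zero]
    | smul s u _ hu => rw [map_smul, LinearMap.smul_apply, hu, smul_zero]
  ext j
  exact Fintype.linearIndependent_iff.1 hp z h0 j

/-- Coordinates are recovered from the Gram matrix by solving a linear system. -/
lemma IsGram.basisCoord_eq (h : IsGram Γ p c)
    (hp : LinearIndependent ℝ (p ∘ Sum.map t id : Fin 3 ⊕ ι → _)) {i : ι} {z : Fin 3 ⊕ ι → ℝ}
    (hz : p (Sum.inl i) = ∑ j, z j • p (Sum.map t id j)) : basisCoord Γ t i = z := by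
  have h1 : (fun j => Γ (Sum.map t id j) (Sum.inl i)) =
      Γ.submatrix (Sum.map t id) (Sum.map t id) *ᵥ z := by
    ext l
    rw [h.submatrix_mulVec, ← hz, h.2]
  rw [basisCoord, h1, mulVec_mulVec, nonsing_inv_mul _ (h.det_ne_zero hp).isUnit, one_mulVec]

lemma IsGram.basisCoord_of_normalForm (h : IsGram Γ p c) {lam : ι → ℝ} {v : ι → Fin 3 → ℝ}
    (hv : IsNormalForm A p lam t v) (i : ι) :
    (∀ s, basisCoord Γ t i (Sum.inl s) = v i s) ∧
      ((∀ r, t r ≠ i) → basisCoord Γ t i (Sum.inr i) = lam i) := by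
  have h1 := h.basisCoord_eq hv.indep (i := i) (z := Sum.elim (v i) fun k =>
    (if i = k then lam i else 0) - ∑ s, if t s = k then v i s * lam (t s) else 0) (by
    rw [Fintype.sum_sum_type]
    simp only [Sum.elim_inl, Sum.elim_inr, Sum.map_inl, Sum.map_inr, id, sub_smul,
      Finset.sum_sub_distrib, ite_smul, zero_smul, Finset.sum_smul]
    rw [Finset.sum_comm (s := Finset.univ (α := ι))]
    simp only [Finset.sum_ite_eq, Finset.mem_univ, if_true]
    have h2 := hv.rel i
    simp only [smul_sub, Finset.sum_sub_distrib, smul_smul] at h2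
    rw [sub_eq_iff_eq_add] at h2
    rw [h2]
    abel)
  rw [h1]
  exact ⟨fun s => rfl, fun hi => by simp [hi]⟩

end CanonicalForm

section Canonical

variable {ι : Type*} [Fintype ι] [DecidableEq ι] {A : ι → EuclideanSpace ℝ (Fin 2)}
  {b : Fin 3 → ι} {X : ι ⊕ ι → UnitSphere (Fin 2 ⊕ ι)}

lemma reference_ne (hX : X ∈ inscribedRealizations (lawrence A))
    (hb : chirotope (homogenization A) b ≠ 0) (r s : Fin 3) (hrs : r ≠ s) :
    X (Sum.inl (b r)) ≠ X (Sum.inl (b s)) := by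
  obtain ⟨lam, -, h⟩ := exists_isNormalForm hX ⟨b, hb⟩
  obtain ⟨v, hv⟩ := h b hb
  intro h0
  have := hv.indep.injective (a₁ := Sum.inl r) (a₂ := Sum.inl s) (by simp [h0])
  exact hrs (Sum.inl_injective this)

lemma isGram_normGram (hX : X ∈ inscribedRealizations (lawrence A))
    (hb : chirotope (homogenization A) b ≠ 0) :
    IsGram (normGram b X) (normLift b X) (2 * gramScale b X) :=
  ⟨mul_pos two_pos (gramScale_pos (reference_ne hX hb)), normGram_eq (reference_ne hX hb)⟩

/-- The factors computed from the normalized Gram matrix are those of a normal form. -/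
theorem factor_spec (hX : X ∈ inscribedRealizations (lawrence A))
    (hb : chirotope (homogenization A) b ≠ 0) :
    (∀ i, 0 < factor A (normGram b X) i) ∧ ∀ t, chirotope (homogenization A) t ≠ 0 →
      ∃ v, IsNormalForm A (normLift b X) (factor A (normGram b X)) t v := by
  obtain ⟨lam, hlam, h⟩ := exists_isNormalForm hX ⟨b, hb⟩
  have hH := apexHeight_pos (reference_ne hX hb)
  have hΓ := isGram_normGram hX hb
  set lam' : ι → ℝ := fun i =>
    lam i * apexHeight b X (Sum.inr i) / apexHeight b X (Sum.inl i) with hlam'_def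
  have hlam' : ∀ i, 0 < lam' i := fun i => div_pos (mul_pos (hlam i) (hH _)) (hH _)
  have hfac : ∀ i, (∃ t, chirotope (homogenization A) t ≠ 0 ∧ ∀ r, t r ≠ i) →
      factor A (normGram b X) i = lam' i := fun i hi => by
    rw [factor, dif_pos hi]
    obtain ⟨v, hv⟩ := h _ hi.choose_spec.1
    exact (hΓ.basisCoord_of_normalForm (hv.rescale hH) i).2 hi.choose_spec.2
  refine ⟨fun i => ?_, fun t ht => ?_⟩
  · by_cases hi : ∃ t, chirotope (homogenization A) t ≠ 0 ∧ ∀ r, t r ≠ i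
    · rw [hfac i hi]; exact hlam' i
    · rw [factor, dif_neg hi]; exact one_pos
  · obtain ⟨v, hv⟩ := h t ht
    exact ⟨_, (hv.rescale hH).change_coloop hfac⟩

/-- The linear map from the coordinates of marked forms to `E × ℝ` given by the adapted basis. -/
noncomputable def frameMap (lam : ι → ℝ) (b : Fin 3 → ι)
    (p : ι ⊕ ι → EuclideanSpace ℝ (Fin 2 ⊕ ι) × ℝ) :
    (Fin 3 ⊕ ι → ℝ) →ₗ[ℝ] EuclideanSpace ℝ (Fin 2 ⊕ ι) × ℝ :=
  Fintype.linearCombination ℝ p ∘ₗ (frame lam b).vecMulLinear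

omit [Fintype ι] in
lemma frame_inl (lam : ι → ℝ) (b : Fin 3 → ι) (r : Fin 3) : frame lam b (Sum.inl r) =
    (1 + lam (b r))⁻¹ •
      (Pi.single (Sum.inl (b r)) 1 - lam (b r) • Pi.single (Sum.inr (b r)) 1) := rfl

omit [Fintype ι] in
lemma frame_inr (lam : ι → ℝ) (b : Fin 3 → ι) (i : ι) : frame lam b (Sum.inr i) =
    (1 + lam i)⁻¹ • (Pi.single (Sum.inl i) 1 + lam i • Pi.single (Sum.inr i) 1) := rfl

lemma frameMap_apply (lam : ι → ℝ) (b : Fin 3 → ι)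
    (p : ι ⊕ ι → EuclideanSpace ℝ (Fin 2 ⊕ ι) × ℝ) (x : Fin 3 ⊕ ι → ℝ) :
    frameMap lam b p x = (∑ r, x (Sum.inl r) • (1 + lam (b r))⁻¹ •
      (p (Sum.inl (b r)) - lam (b r) • p (Sum.inr (b r)))) +
      ∑ i, x (Sum.inr i) • (1 + lam i)⁻¹ • (p (Sum.inl i) + lam i • p (Sum.inr i)) := by
  simp only [frameMap, LinearMap.comp_apply, Matrix.vecMulLinear_apply, vecMul_eq_sum, map_sum,
    map_add, map_smul, Fintype.sum_sum_type]
  congr 1 <;>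
  · refine Finset.sum_congr rfl fun j _ => ?_
    congr 1
    simp [frame_inl, frame_inr]

/-- The adapted basis takes the vertex vectors over the canonical configuration to positive multiples
of the homogeneous vectors. -/
lemma frameMap_vertexVec {F : ι → Fin 3 → ℝ} {lam : ι → ℝ}
    {p : ι ⊕ ι → EuclideanSpace ℝ (Fin 2 ⊕ ι) × ℝ} (hlam : ∀ i, 0 < lam i)
    (h : IsNormalForm A p lam b F) (i : ι) :
    frameMap lam b p (vertexVec (fun i r => (1 + lam i)⁻¹ * ((1 + lam (b r)) * F i r))
      (Sum.inl i)) = (2 / (1 + lam i)) • p (Sum.inl i) ∧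
    frameMap lam b p (vertexVec (fun i r => (1 + lam i)⁻¹ * ((1 + lam (b r)) * F i r))
      (Sum.inr i)) = (2 * lam i / (1 + lam i)) • p (Sum.inr i) := by
  have hl : ∀ i, 1 + lam i ≠ 0 := fun i => by have := hlam i; positivity
  have h1 : ∑ r, ((1 + lam i)⁻¹ * ((1 + lam (b r)) * F i r)) • (1 + lam (b r))⁻¹ •
      (p (Sum.inl (b r)) - lam (b r) • p (Sum.inr (b r))) =
      (1 + lam i)⁻¹ • (p (Sum.inl i) - lam i • p (Sum.inr i)) := by
    rw [h.rel, Finset.smul_sum]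
    refine Finset.sum_congr rfl fun r _ => ?_
    rw [smul_smul, smul_smul]
    congr 1
    field_simp [hl (b r)]
  have h2 : ∑ j, (Pi.single i 1 : ι → ℝ) j • (1 + lam j)⁻¹ •
      (p (Sum.inl j) + lam j • p (Sum.inr j)) =
      (1 + lam i)⁻¹ • (p (Sum.inl i) + lam i • p (Sum.inr i)) := by
    rw [Finset.sum_eq_single i (fun j _ hj => by simp [hj]) (by simp)]
    simp
  constructor
  · rw [frameMap_apply]
    simp only [vertexVec, Sum.elim_inl, Sum.elim_inr, h1, h2]
    module
  · rw [frameMap_apply]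
    simp only [vertexVec, Sum.elim_inl, Sum.elim_inr, Pi.neg_apply, neg_smul,
      Finset.sum_neg_distrib, h1, h2]
    module

lemma frameMap_injective {v : ι → Fin 3 → ℝ} {lam : ι → ℝ}
    {p : ι ⊕ ι → EuclideanSpace ℝ (Fin 2 ⊕ ι) × ℝ} (hlam : ∀ i, 0 < lam i)
    (h : IsNormalForm A p lam b v) : Function.Injective (frameMap lam b p) := by
  rw [LinearMap.injective_iff_surjective_of_finrank_eq_finrank (by simp; omega),
    ← LinearMap.range_eq_top, eq_top_iff, ← span_eq_top_of_indep h.indep, Submodule.span_le]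
  have hmem : ∀ a, p a ∈ LinearMap.range (frameMap lam b p) := by
    rintro (i | i)
    · have h1 := (frameMap_vertexVec hlam h i).1
      have h2 : 0 < 2 / (1 + lam i) := by have := hlam i; positivity
      rw [← inv_smul_eq_iff₀ h2.ne'] at h1
      rw [← h1, ← map_smul]
      exact ⟨_, rfl⟩
    · have h1 := (frameMap_vertexVec hlam h i).2
      have h2 : 0 < 2 * lam i / (1 + lam i) := by have := hlam i; positivity
      rw [eq_comm, ← eq_inv_smul_iff₀ h2.ne'] at h1
      rw [h1, ← map_smul]
      exact ⟨_, rfl⟩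
  rintro _ ⟨j, rfl⟩
  exact hmem _

lemma canonForm_apply {Γ : Matrix (ι ⊕ ι) (ι ⊕ ι) ℝ}
    {p : ι ⊕ ι → EuclideanSpace ℝ (Fin 2 ⊕ ι) × ℝ} {c : ℝ} (h : IsGram Γ p c)
    (x y : Fin 3 ⊕ ι → ℝ) : x ⬝ᵥ canonForm A b Γ *ᵥ y =
      c * lorentz _ (frameMap (factor A Γ) b p x) (frameMap (factor A Γ) b p y) := by
  rw [canonForm, neg_mulVec, dotProduct_neg, ← mulVec_mulVec, ← mulVec_mulVec, mulVec_transpose,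
    dotProduct_mulVec, h.pairing, neg_neg]
  rfl

/-- The data computed from the normalized Gram matrix are a marked form realized by the polytope.
The functional is the pairing with the timelike vector of `exists_apex`, on whose orthogonal
complement the Lorentzian form is positive definite. -/
theorem isMarked_canon (hX : X ∈ inscribedRealizations (lawrence A))
    (hb : chirotope (homogenization A) b ≠ 0) :
    canonVectors A b (normGram b X) ∈ chart A b ∧
    IsMarked (canonVectors A b (normGram b X)) (canonForm A b (normGram b X))
      (canonHeight A b (normGram b X)) ∧
    Realizes X (canonVectors A b (normGram b X)) (canonForm A b (normGram b X)) := by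
  have hΓ := isGram_normGram hX hb
  have hH := apexHeight_pos (reference_ne hX hb)
  obtain ⟨T, hT, hTp⟩ := exists_apex (reference_ne hX hb)
  obtain ⟨hlam, hnf⟩ := factor_spec hX hb
  obtain ⟨v, hv⟩ := hnf b hb
  have hVeq : canonVectors A b (normGram b X) = fun i r => (1 + factor A (normGram b X) i)⁻¹ *
      ((1 + factor A (normGram b X) (b r)) * v i r) := by
    ext i r
    rw [canonVectors, (hΓ.basisCoord_of_normalForm hv i).1 r]
  have happ := canonForm_apply (A := A) (b := b) hΓ
  rw [hVeq]
  set Γ := normGram b X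
  set lam := factor A Γ
  set p := normLift b X
  have hl : ∀ i, 0 < 1 + lam i := fun i => by have := hlam i; positivity
  have hvert := frameMap_vertexVec hlam hv
  have hnull : ∀ a, lorentz _ (p a) (p a) = 0 := fun a => by
    have := hΓ.2 a a
    simp only [Γ, normGram, Matrix.of_apply, dist_self] at this
    simpa [hΓ.1.ne'] using this
  set V : ι → Fin 3 → ℝ := fun i r => (1 + lam i)⁻¹ * ((1 + lam (b r)) * v i r) with hV
  -- the multiples of the vectors `p a` that are the images of the vertex vectors
  obtain ⟨k, hk, hkv⟩ : ∃ k : ι ⊕ ι → ℝ, (∀ a, 0 < k a) ∧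
      ∀ a, frameMap lam b p (vertexVec V a) = k a • p a := by
    refine ⟨Sum.elim (fun i => 2 / (1 + lam i)) (fun i => 2 * lam i / (1 + lam i)), ?_, ?_⟩
    · rintro (i | i)
      · exact div_pos two_pos (hl i)
      · exact div_pos (mul_pos two_pos (hlam i)) (hl i)
    · rintro (i | i)
      · exact (hvert i).1
      · exact (hvert i).2
  have hheight : ∀ x, lorentz _ T (frameMap lam b p x) =
      -(1 / 2) * (heightVec (canonHeight A b Γ) ⬝ᵥ x) := fun x => by
    rw [frameMap_apply]
    simp only [map_add, map_sum, map_smul, map_sub, smul_eq_mul, hTp, heightVec, canonHeight,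
      dotProduct, Fintype.sum_sum_type, Sum.elim_inl, Sum.elim_inr, mul_add, Finset.mul_sum,
      Pi.one_apply]
    congr 1 <;> refine Finset.sum_congr rfl fun j _ => ?_
    · have := (hl (b j)).ne'
      simp only [lam] at this ⊢
      field_simp
      ring
    · have := (hl j).ne'
      field_simp
      ring
  have hhv : ∀ a, heightVec (canonHeight A b Γ) ⬝ᵥ vertexVec V a = k a := fun a => by
    have := hheight (vertexVec V a)
    rw [hkv, map_smul, hTp, smul_eq_mul] at this
    linarith
  refine ⟨⟨rescale_mem_omRealizations hv.mem.1 (fun i => inv_pos.2 (hl i)) fun s => hl _,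
    fun r => ?_⟩, ⟨fun i => ?_, ?_, fun a => ?_, fun x hx hx0 => ?_⟩, ?_⟩
  · ext s
    simp only [hV]
    rw [hv.mem.2, Pi.single_apply]
    split_ifs with hs
    · subst hs; rw [mul_one, inv_mul_cancel₀ (hl _).ne']
    · simp
  · have h1 := hhv (Sum.inl i)
    have h2 := hhv (Sum.inr i)
    rw [height_inl] at h1
    rw [height_inr] at h2
    have h3 := hk (Sum.inl i)
    have h4 := hk (Sum.inr i)
    rw [abs_lt]
    constructor <;> linarith
  · have hΓs : Γᵀ = Γ := by
      ext a a'
      rw [transpose_apply, hΓ.2, hΓ.2, lorentz_comm]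
    rw [IsSymm, canonForm, transpose_neg, transpose_mul, transpose_mul, transpose_transpose, hΓs,
      Matrix.mul_assoc]
  · rw [happ, hkv]
    simp [hnull]
  · rw [happ]
    refine mul_pos hΓ.1 (lorentz_pos_of_orthogonal hT (by rw [hheight, hx0, mul_zero]) ?_)
    rw [← map_zero (frameMap lam b p)]
    exact (frameMap_injective hlam hv).ne hx
  · have hc := gramScale_pos (reference_ne hX hb)
    refine ⟨fun a => apexHeight b X a / (k a * Real.sqrt (gramScale b X)), fun a =>
      div_pos (hH a) (mul_pos (hk a) (Real.sqrt_pos.2 hc)), fun a a' => ?_⟩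
    have h1 := lorentz_lift (norm_unitSphere (X a)) (norm_unitSphere (X a'))
    have h2 : ∀ a, lift (X a : EuclideanSpace ℝ (Fin 2 ⊕ ι)) = apexHeight b X a • p a := fun a => by
      exact (smul_inv_smul₀ (hH a).ne' _).symm
    rw [h2, h2] at h1
    have h3 : Real.sqrt (gramScale b X) * Real.sqrt (gramScale b X) = gramScale b X :=
      Real.mul_self_sqrt hc.le
    have h4 : apexHeight b X a / (k a * Real.sqrt (gramScale b X)) *
        (apexHeight b X a' / (k a' * Real.sqrt (gramScale b X))) =
        apexHeight b X a * apexHeight b X a' / (k a * k a' * gramScale b X) := by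
      rw [div_mul_div_comm, mul_mul_mul_comm (k a), h3]
    rw [happ, hkv, hkv, h4, Subtype.dist_eq]
    simp only [map_smul, LinearMap.smul_apply, smul_eq_mul] at h1 ⊢
    have := (hk a).ne'
    have := (hk a').ne'
    field_simp
    linarith

/-- Every vector configuration from which an inscribed polytope is built differs from the
canonical one only by positive scalings of its rows and columns. -/
theorem canonVectors_eq_rescale {V : ι → Fin 3 → ℝ} {B : Matrix (Fin 3 ⊕ ι) (Fin 3 ⊕ ι) ℝ}
    {h : Fin 3 → ℝ} (hV : V ∈ chart A b) (hB : IsMarked V B h) (hXV : Realizes X V B)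
    (hX : X ∈ inscribedRealizations (lawrence A)) (hb : chirotope (homogenization A) b ≠ 0) :
    ∃ (u : ι → ℝ) (g : Fin 3 → ℝ), (∀ i, 0 < u i) ∧ (∀ r, 0 < g r) ∧
      canonVectors A b (normGram b X) = fun i r => u i * (g r * V i r) := by
  have hΓ := isGram_normGram hX hb
  have hH := apexHeight_pos (reference_ne hX hb)
  obtain ⟨hlam, hnf⟩ := factor_spec hX hb
  obtain ⟨v, hv⟩ := hnf b hb
  obtain ⟨M, ρ, hρ, hM, -⟩ := hXV.exists_linearEquiv hB hV
  have hMp : ∀ a, M (vertexVec V a) = (apexHeight b X a / ρ a) • normLift b X a := fun a => by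
    rw [normLift, smul_smul, hM, smul_smul]
    have h1 := (hH a).ne'
    have h2 := (hρ a).ne'
    have : apexHeight b X a / ρ a * (apexHeight b X a)⁻¹ * ρ a = 1 := by field_simp
    rw [this, one_smul]
  have hl : ∀ i, 0 < 1 + factor A (normGram b X) i := fun i => by have := hlam i; positivity
  have hk : ∀ a, 0 < apexHeight b X a / ρ a := fun a => div_pos (hH a) (hρ a)
  set k : ι ⊕ ι → ℝ := fun a => apexHeight b X a / ρ a
  refine ⟨fun i => (1 + factor A (normGram b X) i)⁻¹ * (k (Sum.inl i))⁻¹,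
    fun r => (1 + factor A (normGram b X) (b r)) * k (Sum.inl (b r)), fun i =>
      mul_pos (inv_pos.2 (hl i)) (inv_pos.2 (hk _)), fun r => mul_pos (hl _) (hk _), ?_⟩
  ext i r
  have hrel : ∀ i, k (Sum.inl i) • normLift b X (Sum.inl i) =
      k (Sum.inr i) • normLift b X (Sum.inr i) + ∑ r, V i r • (k (Sum.inl (b r)) •
        normLift b X (Sum.inl (b r)) - k (Sum.inr (b r)) • normLift b X (Sum.inr (b r))) := by
    intro i
    have h1 : vertexVec V (Sum.inl i) = vertexVec V (Sum.inr i) +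
        ∑ r, V i r • (vertexVec V (Sum.inl (b r)) - vertexVec V (Sum.inr (b r))) := by
      rw [← sub_eq_iff_eq_add', vertexVec_sub]
      refine Finset.sum_congr rfl fun r _ => ?_
      rw [vertexVec_sub, Finset.sum_eq_single r (fun s _ hs => by rw [hV.2]; simp [hs]) (by simp),
        hV.2]
      simp
    have h2 := congrArg M h1
    simp only [map_add, map_sum, map_smul, map_sub, hMp] at h2
    exact h2
  have hz := hΓ.basisCoord_eq hv.indep (i := i) (z := Sum.elim
    (fun r => (k (Sum.inl i))⁻¹ * (V i r * k (Sum.inl (b r))))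
    (fun j => (k (Sum.inl i))⁻¹ * ((if i = j then k (Sum.inr i) else 0) -
      ∑ r, if b r = j then V i r * k (Sum.inr (b r)) else 0))) (by
    rw [← inv_smul_smul₀ (hk (Sum.inl i)).ne' (normLift b X (Sum.inl i)),
      show (apexHeight b X (Sum.inl i) / ρ (Sum.inl i)) = k (Sum.inl i) from rfl, hrel,
      Fintype.sum_sum_type]
    simp only [Sum.elim_inl, Sum.elim_inr, Sum.map_inl, Sum.map_inr, id, mul_smul,
      ← Finset.smul_sum]
    rw [← smul_add]
    congr 1
    simp only [sub_smul, Finset.sum_sub_distrib, ite_smul, zero_smul, Finset.sum_smul, smul_sub,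
      Finset.sum_sub_distrib, mul_smul]
    rw [Finset.sum_comm (s := Finset.univ (α := ι))]
    simp only [Finset.sum_ite_eq, Finset.mem_univ, if_true]
    abel)
  rw [canonVectors, hz, Sum.elim_inl]
  ring

end Canonical

/-! ### The homotopy equivalence -/

section CanonicalData

variable {ι : Type*} [Fintype ι] [DecidableEq ι] {A : ι → EuclideanSpace ℝ (Fin 2)} {b : Fin 3 → ι}

lemma continuous_normGram (hb : chirotope (homogenization A) b ≠ 0) :
    Continuous fun X : inscribedRealizations (lawrence A) => normGram b X.1 := by
  have hd : ∀ a c, Continuous fun X : inscribedRealizations (lawrence A) =>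
      dist (X.1 a) (X.1 c) ^ 2 := fun a c =>
    (((continuous_apply a).comp continuous_subtype_val).dist
      ((continuous_apply c).comp continuous_subtype_val)).pow 2
  have hH : ∀ a, Continuous fun X : inscribedRealizations (lawrence A) => apexHeight b X.1 a :=
    fun a => ((hd _ _).mul (hd _ _)).add ((hd _ _).mul (hd _ _))
  have hG : Continuous fun X : inscribedRealizations (lawrence A) => gramScale b X.1 := 
    ((hd _ _).mul (hd _ _)).mul (hd _ _)
  refine continuous_matrix fun a c => ?_
  simp only [normGram, Matrix.of_apply]
  exact (hG.mul (hd a c)).div ((hH a).mul (hH c)) fun X =>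
    (mul_pos (apexHeight_pos (reference_ne X.2 hb) a) (apexHeight_pos (reference_ne X.2 hb) c)).ne'

lemma continuous_basisCoord (hb : chirotope (homogenization A) b ≠ 0) {t : Fin 3 → ι}
    (ht : chirotope (homogenization A) t ≠ 0) (i : ι) :
    Continuous fun X : inscribedRealizations (lawrence A) => basisCoord (normGram b X.1) t i := by
  have hΓ := continuous_normGram hb
  refine Continuous.matrix_mulVec (continuous_inv_of_det_ne_zero (hΓ.matrix_submatrix _ _)
    fun X => ?_) (continuous_pi fun j => hΓ.matrix_elem _ _)
  obtain ⟨v, hv⟩ := (factor_spec X.2 hb).2 t ht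
  exact (isGram_normGram X.2 hb).det_ne_zero hv.indep

/-- Whether the factor is determined by the normal form depends on the label only, not on the
polytope, so that the case distinction in its definition is harmless. -/
lemma continuous_factor (hb : chirotope (homogenization A) b ≠ 0) (i : ι) :
    Continuous fun X : inscribedRealizations (lawrence A) => factor A (normGram b X.1) i := by
  by_cases h : ∃ t, chirotope (homogenization A) t ≠ 0 ∧ ∀ r, t r ≠ i
  · simp only [factor, dif_pos h]
    exact (continuous_apply _).comp (continuous_basisCoord hb h.choose_spec.1 i)
  · simp only [factor, dif_neg h]
    exact continuous_const

/-- The marked form built from the invariants of an inscribed polytope. -/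
noncomputable def canonData (hb : chirotope (homogenization A) b ≠ 0) :
    C(inscribedRealizations (lawrence A), markedForms A b) where
  toFun X := ⟨(canonVectors A b (normGram b X.1), canonForm A b (normGram b X.1),
    canonHeight A b (normGram b X.1)), (isMarked_canon X.2 hb).1, (isMarked_canon X.2 hb).2.1⟩
  continuous_toFun := by
    have hf := continuous_factor (A := A) hb
    have hne : ∀ i (X : inscribedRealizations (lawrence A)),
        1 + factor A (normGram b X.1) i ≠ 0 := fun i X =>
      (add_pos one_pos ((factor_spec X.2 hb).1 i)).ne'
    have hinv : ∀ i, Continuous fun X : inscribedRealizations (lawrence A) =>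
        (1 + factor A (normGram b X.1) i)⁻¹ := fun i =>
      (continuous_const.add (hf i)).inv₀ (hne i)
    have hF : Continuous fun X : inscribedRealizations (lawrence A) =>
        frame (factor A (normGram b X.1)) b := by
      refine continuous_pi fun j => ?_
      rcases j with r | i
      · simp only [frame_inl]
        exact (hinv _).smul (continuous_const.sub ((hf _).smul continuous_const))
      · simp only [frame_inr]
        exact (hinv _).smul (continuous_const.add ((hf _).smul continuous_const))
    refine Continuous.subtype_mk (Continuous.prodMk ?_ (Continuous.prodMk ?_ ?_)) _
    · refine continuous_pi fun i => continuous_pi fun r => ?_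
      exact (hinv i).mul ((continuous_const.add (hf _)).mul
        ((continuous_apply _).comp (continuous_basisCoord hb hb i)))
    · exact ((hF.matrix_mul (continuous_normGram hb)).matrix_mul hF.matrix_transpose).neg
    · refine continuous_pi fun r => ?_
      exact (continuous_const.sub (hf _)).div (continuous_const.add (hf _)) (hne _)

/-- The canonical marked form is a Möbius invariant. -/
noncomputable def canonClass (hb : chirotope (homogenization A) b ≠ 0) :
    C(InscribedRealizationSpace (lawrence A), markedForms A b) where
  toFun := Quotient.lift (canonData hb) fun X Y hXY => by
    obtain ⟨σ, hσ⟩ := MulAction.orbitRel_apply.1 hXY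
    have h : normGram b X.1 = normGram b Y.1 := by
      rw [← normGram_mobius b Y.1 σ.2]
      congr 1
      exact hσ.symm
    exact Subtype.ext (by simp only [canonData, ContinuousMap.coe_mk, h])
  continuous_toFun := (canonData hb).continuous.quotient_lift _

lemma realizationClass_canonClass (hb : chirotope (homogenization A) b ≠ 0)
    (x : InscribedRealizationSpace (lawrence A)) : realizationClass (canonClass hb x) = x := by
  induction x using Quotient.inductionOn with
  | h X => exact realizationClass_eq _ X (isMarked_canon X.2 hb).2.2

end CanonicalData

section Chart

variable {ι : Type*} {A : ι → EuclideanSpace ℝ (Fin 2)} {b : Fin 3 → ι}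

/-- The linear automorphism of `ℝ³` given by an invertible matrix acting on row vectors. -/
noncomputable def vecMulEquiv (M : Matrix (Fin 3) (Fin 3) ℝ) (hM : M.det ≠ 0) :
    (Fin 3 → ℝ) ≃ₗ[ℝ] (Fin 3 → ℝ) :=
  toLinearEquivRight'OfInv (M := M⁻¹) (M' := M) (nonsing_inv_mul _ hM.isUnit)
    (mul_nonsing_inv _ hM.isUnit)

/-- The coordinates with respect to three of the vectors are invariant under linear automorphisms. -/
lemma normalizeAt_linearEquiv (g : (Fin 3 → ℝ) ≃ₗ[ℝ] (Fin 3 → ℝ)) {V : ι → Fin 3 → ℝ}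
    (hV : chirotope V b ≠ 0) (hgV : chirotope (fun i => g (V i)) b ≠ 0) :
    normalizeAt b (fun i => g (V i)) = normalizeAt b V := by
  ext1 i
  have h1 : V i = ∑ k, normalizeAt b V i k • V (b k) := by
    conv_lhs => rw [← normalizeAt_vecMul hV i, vecMul_eq_sum]
    rfl
  have h2 : g (V i) = normalizeAt b V i ᵥ* (Matrix.of fun k => g (V (b k))) := by
    rw [vecMul_eq_sum]
    conv_lhs => rw [h1]
    simp only [map_sum, map_smul]
    rfl
  rw [normalizeAt, h2, vecMul_vecMul, mul_nonsing_inv _ (det_ne_zero_of_chirotope hgV).isUnit,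
    vecMul_one]

/-- Every class of realizations of the oriented matroid has exactly one representative in the
chart. -/
noncomputable def omRealizationHomeomorph (hb : chirotope (homogenization A) b ≠ 0) :
    OMRealizationSpace A ≃ₜ chart A b where
  toFun := Quotient.lift (fun V => ⟨normalizeAt b V.1, normalizeAt_mem_chart V.2
      ((chirotope_homogenization_ne_zero V.2 b).2 hb)⟩) fun V W hVW => by
    obtain ⟨g, hg⟩ := MulAction.orbitRel_apply.1 hVW
    have hg' : V.1 = fun i => g (W.1 i) := hg.symm
    have hV := (chirotope_homogenization_ne_zero V.2 b).2 hb
    rw [hg'] at hV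
    refine Subtype.ext ?_
    change normalizeAt b V.1 = normalizeAt b W.1
    rw [hg']
    exact normalizeAt_linearEquiv g ((chirotope_homogenization_ne_zero W.2 b).2 hb) hV
  invFun V := Quotient.mk _ ⟨V.1, V.2.1⟩
  left_inv x := by
    induction x using Quotient.inductionOn with
    | h V =>
      have hV := (chirotope_homogenization_ne_zero V.2 b).2 hb
      have hdet : ((Matrix.of fun k => V.1 (b k))⁻¹ : Matrix (Fin 3) (Fin 3) ℝ).det ≠ 0 := by
        rw [det_nonsing_inv, Ring.inverse_eq_inv']
        exact inv_ne_zero (det_ne_zero_of_chirotope hV)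
      exact Quotient.sound (MulAction.orbitRel_apply.2 ⟨vecMulEquiv _ hdet, rfl⟩)
  right_inv V := by
    refine Subtype.ext ?_
    change normalizeAt b V.1 = V.1
    have h : (Matrix.of fun k => V.1 (b k)) = 1 := of_chart V.2
    ext1 i
    rw [normalizeAt, h, inv_one, vecMul_one]
  continuous_toFun := by
    refine Continuous.quotient_lift (Continuous.subtype_mk (continuous_pi fun i => ?_) _) _
    have h1 : Continuous fun V : omRealizations A =>
        (Matrix.of fun k => V.1 (b k) : Matrix (Fin 3) (Fin 3) ℝ) := by
      refine continuous_matrix fun k r => ?_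
      exact (continuous_apply r).comp ((continuous_apply (b k)).comp continuous_subtype_val)
    exact Continuous.matrix_vecMul ((continuous_apply i).comp continuous_subtype_val) (continuous_inv_of_det_ne_zero h1 fun V =>
      det_ne_zero_of_chirotope ((chirotope_homogenization_ne_zero V.2 b).2 hb))
  continuous_invFun := continuous_quotient_mk'.comp (by fun_prop)

/-- A self-map of the chart that only rescales rows and columns by positive factors deforms to the
identity through powers of these factors. -/
theorem homotopic_id_of_rescale [DecidableEq ι] (φ : C(chart A b, chart A b))
    (hφ : ∀ V : chart A b, ∃ (u : ι → ℝ) (g : Fin 3 → ℝ), (∀ i, 0 < u i) ∧ (∀ r, 0 < g r) ∧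
      (φ V).1 = fun i r => u i * (g r * V.1 i r)) :
    φ.Homotopic (ContinuousMap.id _) := by
  have hmem : ∀ (τ : ℝ) (V : chart A b),
      (fun i r => V.1 i r * |(φ V).1 i r / V.1 i r| ^ τ) ∈ chart A b := fun τ V => by
    obtain ⟨u, g, hu, hg, h⟩ := hφ V
    constructor
    · have h1 : (fun i r => V.1 i r * |(φ V).1 i r / V.1 i r| ^ τ) =
          fun i r => u i ^ τ * (g r ^ τ * V.1 i r) := by
        ext i r
        rcases eq_or_ne (V.1 i r) 0 with h0 | h0
        · simp [h0]
        · simp only [h]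
          rw [← mul_assoc, mul_div_cancel_right₀ _ h0, abs_of_pos (mul_pos (hu i) (hg r)),
            Real.mul_rpow (hu i).le (hg r).le]
          ring
      rw [h1]
      exact rescale_mem_omRealizations V.2.1 (fun i => Real.rpow_pos_of_pos (hu i) τ)
        fun r => Real.rpow_pos_of_pos (hg r) τ
    · intro r
      ext s
      beta_reduce
      rw [(φ V).2.2, V.2.2]
      rcases eq_or_ne s r with rfl | hs
      · simp
      · simp [hs]
  -- an entry vanishes either on the whole chart or nowhere on it
  have hzero : ∀ i r, (∀ V : chart A b, V.1 i r = 0) ∨ (∀ V : chart A b, V.1 i r ≠ 0) := by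
    intro i r
    have h1 : ∀ V : chart A b, V.1 i r ≠ 0 ↔
        chirotope (homogenization A) (Function.update b r i) ≠ 0 := fun V => by
      rw [← chirotope_homogenization_ne_zero V.2.1, chirotope_update V.2.2, sign_ne_zero]
    by_cases h : chirotope (homogenization A) (Function.update b r i) ≠ 0
    · exact Or.inr fun V => (h1 V).2 h
    · exact Or.inl fun V => not_not.1 fun h0 => h ((h1 V).1 h0)
  have hcont : Continuous fun p : unitInterval × chart A b =>
      (⟨fun i r => p.2.1 i r * |(φ p.2).1 i r / p.2.1 i r| ^ (p.1 : ℝ), hmem p.1 p.2⟩ :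
        chart A b) := by
    refine Continuous.subtype_mk (continuous_pi fun i => continuous_pi fun r => ?_) _
    rcases hzero i r with h | h
    · simp only [h, zero_mul]
      exact continuous_const
    · have h1 : Continuous fun V : chart A b => V.1 i r :=
        (continuous_apply r).comp ((continuous_apply i).comp continuous_subtype_val)
      have h2 : Continuous fun p : unitInterval × chart A b => p.2.1 i r := h1.comp continuous_snd
      have h3 : Continuous fun p : unitInterval × chart A b => (φ p.2).1 i r :=
        h1.comp (φ.continuous.comp continuous_snd)
      exact h2.mul ((h3.div h2 fun p => h p.2).abs.rpow (by fun_prop) fun p =>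
        Or.inl (abs_pos.2 (div_ne_zero (h _) (h _))).ne')
  refine ContinuousMap.Homotopic.symm ⟨⟨⟨_, hcont⟩, fun V => ?_, fun V => ?_⟩⟩
  · exact Subtype.ext (by simp)
  · obtain ⟨u, g, hu, hg, h⟩ := hφ V
    refine Subtype.ext (funext fun i => funext fun r => ?_)
    simp only [Icc.coe_one, Real.rpow_one]
    rcases eq_or_ne (V.1 i r) 0 with h0 | h0
    · simp [h, h0]
    · simp only [h]
      rw [← mul_assoc, mul_div_cancel_right₀ _ h0, abs_of_pos (mul_pos (hu i) (hg r)), mul_comm]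

end Chart

/-- The charts of the oriented matroid realization space are homotopy equivalent to the inscribed
realization space: the canonical marked form of an inscribed polytope is a right inverse of
`realizationClass`, and the configurations of the standard forms are recovered from it up to
rescaling. -/
theorem nonempty_homotopyEquiv_chart {ι : Type*} [Fintype ι] [DecidableEq ι]
    {A : ι → EuclideanSpace ℝ (Fin 2)} {b : Fin 3 → ι}
    (hb : chirotope (homogenization A) b ≠ 0) :
    Nonempty (ContinuousMap.HomotopyEquiv (chart A b) (InscribedRealizationSpace (lawrence A))) := by
  let Φ : C(markedForms A b, InscribedRealizationSpace (lawrence A)) :=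
    ⟨realizationClass, continuous_realizationClass⟩
  have hΦ : Φ.comp (canonClass hb) = ContinuousMap.id _ :=
    ContinuousMap.ext (realizationClass_canonClass hb)
  refine ⟨⟨Φ.comp chartSection, chartProj.comp (canonClass hb), ?_, ?_⟩⟩
  · refine homotopic_id_of_rescale _ fun V => ?_
    obtain ⟨X, hX⟩ := exists_realizes (chartSection V)
    have h : (chartProj.comp (canonClass hb)).comp (Φ.comp chartSection) V =
        chartProj (canonData hb X) := by
      change chartProj (canonClass hb (realizationClass (chartSection V))) = _
      rw [realizationClass_eq _ X hX]
      rfl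
    rw [h]
    exact canonVectors_eq_rescale V.2 (chartSection V).2.2 hX X.2 hb
  · have h := (ContinuousMap.Homotopic.refl Φ).comp
      ((chartSection_comp_chartProj_homotopic (A := A) (b := b)).comp
        (ContinuousMap.Homotopic.refl (canonClass hb)))
    rw [ContinuousMap.id_comp, hΦ] at h
    exact h

/-- Points that affinely span the plane contain a basis of the oriented matroid. -/
lemma exists_chirotope_ne_zero {ι : Type*} {A : ι → EuclideanSpace ℝ (Fin 2)}
    (hA : affineSpan ℝ (range A) = ⊤) : ∃ b, chirotope (homogenization A) b ≠ 0 := by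
  have hspan : Submodule.span ℝ (range (homogenization A)) = ⊤ := by
    by_contra hne
    obtain ⟨φ, hφ, hle⟩ := Submodule.exists_le_ker_of_lt_top _ (lt_top_iff_ne_top.2 hne)
    have hφx : ∀ x, φ x = ∑ r, x r * φ (Pi.single r 1) := fun x => by
      conv_lhs => rw [pi_eq_sum_univ' x]
      simp [map_sum]
    -- the affine function whose homogenization is `φ`; it vanishes at the points of `A`
    let f : EuclideanSpace ℝ (Fin 2) →ᵃ[ℝ] ℝ :=
      (φ (Pi.single 0 1) • (EuclideanSpace.proj (𝕜 := ℝ) (0 : Fin 2)).toLinearMap +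
        φ (Pi.single 1 1) • (EuclideanSpace.proj (𝕜 := ℝ) (1 : Fin 2)).toLinearMap).toAffineMap +
        AffineMap.const ℝ _ (φ (Pi.single 2 1))
    have hf : f = 0 := by
      refine AffineMap.ext_on hA ?_
      rintro _ ⟨i, rfl⟩
      have h1 : φ (homogenization A i) = 0 :=
        hle (Submodule.subset_span (mem_range_self i))
      rw [hφx, Fin.sum_univ_three] at h1
      have h2 : homogenization A i 0 = A i 0 ∧ homogenization A i 1 = A i 1 ∧
          homogenization A i 2 = 1 := ⟨rfl, rfl, rfl⟩
      rw [h2.1, h2.2.1, h2.2.2] at h1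
      have h3 : f (A i) = A i 0 * φ (Pi.single 0 1) + A i 1 * φ (Pi.single 1 1) +
          1 * φ (Pi.single 2 1) := by
        simp [f, mul_comm]
      rw [h3, h1]
      rfl
    have h : ∀ x y : ℝ, φ (Pi.single 0 1) * x + φ (Pi.single 1 1) * y + φ (Pi.single 2 1) = 0 :=
      fun x y => by
        have := congrArg (fun F : EuclideanSpace ℝ (Fin 2) →ᵃ[ℝ] ℝ => F !₂[x, y]) hf
        simpa [f] using this
    refine hφ (LinearMap.ext fun x => ?_)
    rw [hφx, Fin.sum_univ_three]
    have h0 := h 0 0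
    have h1 := h 1 0
    have h2 := h 0 1
    simp only [mul_zero, mul_one, zero_add, add_zero] at h0 h1 h2
    rw [h0, add_zero] at h1 h2
    simp [h0, h1, h2]
  have hdim : Module.finrank ℝ (Submodule.span ℝ (range (homogenization A))) = 3 := by
    rw [hspan, finrank_top, Module.finrank_fin_fun]
  have hf := Submodule.exists_fun_fin_finrank_span_eq ℝ (range (homogenization A))
  rw [hdim] at hf
  obtain ⟨f, hf, -, hind⟩ := hf
  choose b hb using hf
  obtain rfl : homogenization A ∘ b = f := funext hb
  refine ⟨b, ?_⟩
  have hrow : LinearIndependent ℝ (Matrix.of fun k => homogenization A (b k)).row := hind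
  exact sign_ne_zero.2 ((isUnit_iff_isUnit_det _).1
    (linearIndependent_rows_iff_isUnit.1 hrow)).ne_zero

end LawrenceInscribed

theorem mainTheorem8 (n : ℕ) (A : Fin n → EuclideanSpace ℝ (Fin 2))
    (hA : affineSpan ℝ (Set.range A) = ⊤) :
    Nonempty (ContinuousMap.HomotopyEquiv
      (LawrenceInscribed.OMRealizationSpace A)
      (LawrenceInscribed.InscribedRealizationSpace (LawrenceInscribed.lawrence A))) := by
  obtain ⟨b, hb⟩ := LawrenceInscribed.exists_chirotope_ne_zero hA
  obtain ⟨e⟩ := LawrenceInscribed.nonempty_homotopyEquiv_chart hb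
  exact ⟨(LawrenceInscribed.omRealizationHomeomorph hb).toHomotopyEquiv.trans e⟩
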